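/- Let $K$ be a field of characteristic $0$ (for instance $\mathbb{R}$, $\mathbb{C}$ or $\mathbb{Q}(\alpha)$ with $\alpha$ an indeterminate), and let $\alpha\in K$ not be a rational number $\le 0$. Symmetric functions are taken over $K$ in infinitely many variables $x=(x_1,x_2,\ldots)$; $m_\lambda$ and $p_\lambda$ are the monomial and power sum symmetric functions. For a partition $\lambda$ let $\ell(\lambda)$ be its number of parts, let $z_\lambda=\prod_i i^{m_i(\lambda)}m_i(\lambda)!$ with $m_i(\lambda)$ the number of parts equal to $i$, and let $h_\lambda(\alpha)=\prod_{s\in\lambda}(\alpha a(s)+l(s)+1)$, where $a(s)$ and $l(s)$ are the armlength and leglength of the box $s$ of the Young diagram of $\lambda$. Let $\langle p_\lambda,p_\mu\rangle_\alpha=\alpha^{\ell(\lambda)}z_\lambda\delta_{\lambda\mu}$. The Jack symmetric functions $J^\alpha_\lambda$ are characterized by: they are pairwise orthogonal for $\langle\cdot,\cdot\rangle_\alpha$, and $J^\alpha_\lambda=h_\lambda(\alpha)m_\lambda+\sum_{\mu<\lambda}u^\alpha_{\lambda\mu}m_\mu$ with scalars $u^\alpha_{\lambda\mu}\in K$, where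 $<$ is the (strict) dominance order on partitions of the same integer. Let $n,r\ge 0$ be integers with $n\ge 2$ if $r\geq 1$, let $\lambda\vdash n$, and (for $n\ge 2$) let $\rho=[1^{n-2}2^1]$ be the partition of $n$ with one part $2$ and all other parts $1$. Let $$a^r_\lambda(\alpha)=\Big[p_\lambda(x^1)\prod_{i=2}^{r+1}p_\rho(x^i)\Big]\sum_{\beta\vdash n}\frac{1}{\langle J^\alpha_\beta,J^\alpha_\beta\rangle_\alpha}\prod_{i=1}^{r+1}J^\alpha_\beta(x^i),$$ where $x^1,\ldots,x^{r+1}$ are independent sets of variables and $[\,\cdot\,]$ denotes the coefficient in the power sum expansion. Let $$D(\alpha)=\frac{\alpha}{2}\sum_i x_i^2\frac{\partial^2}{\partial x_i^2}+\sum_i\sum_{j\ne i}\frac{x_ix_j}{x_i-x_j}\frac{\partial}{\partial x_i}$$ be the Laplace–Beltrami operator, where in the second sum the terms for $(i,j)$ and $(j,i)$ are combined. Then $D(\alpha)^r(p_1^n)$ is a linear combination of the $p_\mu$ with $\mu\vdash n$, and $$a^r_\lambda(\alpha)=\frac{1}{\alpha^n\,n!}\,[p_\lambda]\,D(\alpha)^r(p_1^n).$$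 -/

import Mathlib

noncomputable section

namespace JackLB

/-! ### Integer partitions -/

/-- The parts of `lam` in decreasing order. -/
def sortedParts {n : ℕ} (lam : n.Partition) : List ℕ := lam.parts.sort (· ≥ ·)

/-- The length `ℓ(lam)`, i.e. the number of parts. -/
def len {n : ℕ} (lam : n.Partition) : ℕ := Multiset.card lam.parts

/-- `z_lam = ∏ i, i ^ (m_i) * (m_i)!`, where `m_i` is the number of parts equal to `i`. -/
def zee {n : ℕ} (lam : n.Partition) : ℕ :=
  ∏ i ∈ lam.parts.toFinset, i ^ lam.parts.count i * (lam.parts.count i).factorial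

/-- Strict dominance order `mu < lam`: `mu ≠ lam`, and every partial sum
`mu_1 + ... + mu_i` is at most `lam_1 + ... + lam_i`. -/
def DomLT {n : ℕ} (mu lam : n.Partition) : Prop :=
  mu ≠ lam ∧ ∀ i : ℕ, ((sortedParts mu).take i).sum ≤ ((sortedParts lam).take i).sum

/-- The Young diagram whose `i`-th row has `lam_i` boxes. -/
def diagram {n : ℕ} (lam : n.Partition) : YoungDiagram :=
  YoungDiagram.ofRowLens (sortedParts lam)
    (List.Pairwise.sortedGE (Multiset.pairwise_sort lam.parts (· ≥ ·)))

/-- Armlength: number of boxes to the east of the box `s = (row, column)` of `Y`. -/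
def arm (Y : YoungDiagram) (s : ℕ × ℕ) : ℕ := Y.rowLen s.1 - (s.2 + 1)

/-- Leglength: number of boxes to the south of the box `s = (row, column)` of `Y`. -/
def leg (Y : YoungDiagram) (s : ℕ × ℕ) : ℕ := Y.colLen s.2 - (s.1 + 1)

/-- The partition `[1^(n-2) 2^1]` of `n ≥ 2`. -/
def rho (n : ℕ) (hn : 2 ≤ n) : n.Partition where
  parts := 2 ::ₘ Multiset.replicate (n - 2) 1
  parts_pos := by
    intro i hi
    rcases Multiset.mem_cons.1 hi with h | h
    · omega
    · have := Multiset.eq_of_mem_replicate h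
      omega
  parts_sum := by
    simp only [Multiset.sum_cons, Multiset.sum_replicate, smul_eq_mul, mul_one]
    omega

variable {K : Type*} [Field K]

/-- `h_lam(α) = ∏ (α a(s) + l(s) + 1)` over the boxes `s` of `lam`. -/
def hook (α : K) {n : ℕ} (lam : n.Partition) : K :=
  ∏ s ∈ (diagram lam).cells, (α * (arm (diagram lam) s : K) + (leg (diagram lam) s : K) + 1)

/-! ### Symmetric functions

Symmetric functions are realised as formal power series in the variables `x_0, x_1, x_2, ...`;
those that are homogeneous of degree `n` are the linear combinations of the `msym mu` with `mu` a
partition of `n`. -/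

/-- The monomial symmetric function: the sum of all distinct monomials whose nonzero exponents
are, in some order, the parts of `mu`. -/
def msym (K : Type*) [Field K] {n : ℕ} (mu : n.Partition) : MvPowerSeries ℕ K :=
  open Classical in
  fun m => if m.support.val.map m = mu.parts then 1 else 0

/-- The power sum `p_k = ∑ i, x_i ^ k`, for `k ≥ 1`. -/
def psum (K : Type*) [Field K] (k : ℕ) : MvPowerSeries ℕ K :=
  open Classical in
  fun m => if ∃ i : ℕ, m = Finsupp.single i k then 1 else 0

/-- The power sum symmetric function `p_lam = p_(lam_1) p_(lam_2) ...`. -/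
def psumPart (K : Type*) [Field K] {n : ℕ} (lam : n.Partition) : MvPowerSeries ℕ K :=
  (lam.parts.map (psum K)).prod

/-- The coefficient of `v i` in the expansion of `f` in the finite, linearly independent
family `v`; it is `0` if `f` has no such expansion. -/
def coeffIn {ι V : Type*} [Fintype ι] [AddCommGroup V] [Module K V] (v : ι → V) (f : V) (i : ι) :
    K :=
  open Classical in
  if h : ∃ c : ι → K, f = ∑ j, c j • v j then h.choose i else 0

/-- The coefficient `[p_lam] f` in the power sum expansion of a symmetric function `f` that is
homogeneous of degree `n`. -/
def pCoeff {n : ℕ} (lam : n.Partition) (f : MvPowerSeries ℕ K) : K :=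
  coeffIn (fun mu : n.Partition => psumPart K mu) f lam

/-- The scalar product of two symmetric functions that are homogeneous of degree `n`: the bilinear
form with `⟨p_lam, p_mu⟩_α = α ^ ℓ(lam) * z_lam * δ_(lam, mu)`. -/
def scal (α : K) (n : ℕ) (f g : MvPowerSeries ℕ K) : K :=
  ∑ mu : n.Partition, α ^ len mu * (zee mu : K) * pCoeff mu f * pCoeff mu g

/-! ### Jack symmetric functions -/

/-- The two characteristic properties of the Jack symmetric functions indexed by the partitions
of `n`. -/
structure IsJackFamily (α : K) (n : ℕ) (J : n.Partition → MvPowerSeries ℕ K) : Prop where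
  orthogonal : ∀ lam mu : n.Partition, lam ≠ mu → scal α n (J lam) (J mu) = 0
  triangular : ∀ lam : n.Partition, ∃ u : n.Partition → K,
    (∀ mu, ¬ DomLT mu lam → u mu = 0) ∧
      J lam = hook α lam • msym K lam + ∑ mu, u mu • msym K mu

/-- The Jack symmetric function `J_lam^α`. -/
def jack (α : K) {n : ℕ} (lam : n.Partition) : MvPowerSeries ℕ K :=
  open Classical in
  if h : ∃ J : n.Partition → MvPowerSeries ℕ K, IsJackFamily α n J then h.choose lam else 0

/-! ### Jack connection coefficients -/

/-- `f(x^i)`: the series `f` written in the variables `x^i_0, x^i_1, ...` of the `i`-th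
alphabet. -/
def inAlphabet {s : ℕ} (i : Fin s) (f : MvPowerSeries ℕ K) : MvPowerSeries (Fin s × ℕ) K :=
  MvPowerSeries.rename (Function.Embedding.sectR i ℕ) f

/-- The Jack connection coefficient `a_(lam^1, ..., lam^s)(α)`: the coefficient of
`∏ i, p_(lam^i)(x^i)` in `∑ β, ⟨J_β, J_β⟩_α⁻¹ ∏ i, J_β(x^i)`. -/
def connCoeff (α : K) {n s : ℕ} (lam : Fin s → n.Partition) : K :=
  coeffIn
    (fun mu : Fin s → n.Partition => ∏ i, inAlphabet i (psumPart K (mu i)))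
    (∑ β : n.Partition, (1 / scal α n (jack α β) (jack α β)) • ∏ i, inAlphabet i (jack α β))
    lam

/-- `a^r_lam(α) = a_(lam, ρ, ..., ρ)(α)`, with `r` copies of `ρ = [1^(n-2) 2^1]`. For `r = 0` no
`ρ` occurs, and `n` may be arbitrary. -/
def aCoeff (α : K) {n : ℕ} (r : ℕ) (hn : r = 0 ∨ 2 ≤ n) (lam : n.Partition) : K :=
  connCoeff α
    (Fin.cons lam fun i : Fin r => rho n (hn.resolve_left (Nat.ne_zero_of_lt i.isLt)) :
      Fin (r + 1) → n.Partition)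

/-! ### The Laplace-Beltrami operator -/

/-- The quotient `g / d` of formal power series, if `d` divides `g` (and `0` otherwise). -/
def quot (g d : MvPowerSeries ℕ K) : MvPowerSeries ℕ K :=
  open Classical in
  if h : ∃ q, g = d * q then h.choose else 0

/-- The Laplace-Beltrami operator
`D(α) = (α/2) ∑ i, x_i² ∂_i² + ∑_i ∑_(j ≠ i) x_i x_j / (x_i - x_j) ∂_i` on symmetric functions.
In the second sum the terms for `(i, j)` and `(j, i)` are taken together, as
`x_i x_j (∂_i f - ∂_j f) / (x_i - x_j)` with `i < j`. In each degree `m` only the summands whose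
indices lie in the support of `m` contribute, because the others are multiples of an `x_i` that
does not occur in the monomial `x^m`. -/
def laplaceBeltrami (α : K) (f : MvPowerSeries ℕ K) : MvPowerSeries ℕ K := fun m =>
  α / 2 * ∑ i ∈ m.support,
      MvPowerSeries.coeff m
        (MvPowerSeries.X i ^ 2 * MvPowerSeries.pderiv K i (MvPowerSeries.pderiv K i f)) +
    ∑ i ∈ m.support, ∑ j ∈ m.support with i < j,
      MvPowerSeries.coeff m
        (MvPowerSeries.X i * MvPowerSeries.X j *
          quot (MvPowerSeries.pderiv K i f - MvPowerSeries.pderiv K j f)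
            (MvPowerSeries.X i - MvPowerSeries.X j))

end JackLB

end

/-! Everything is computed in the Jack basis of degree `n`. Let `D` be the Laplace-Beltrami operator
and `P_β = J_β / h_β` the monic Jack function (`jackP`). `D` is self-adjoint and triangular on
monomial functions, so `D J_β = e_β J_β` (`IsJackBasis.lbOp_eq`). Since `⟨p_1^n, f⟩ = α^n n! [p_1^n]
f`, expanding `p_1^n` gives `D^r(p_1^n) = α^n n! ∑_β e_β^r [p_1^n]J_β / ⟨J_β, J_β⟩ · J_β`. By
definition `a^r_λ = ∑_β [p_λ]J_β ([p_ρ]J_β)^r / ⟨J_β, J_β⟩`. The two sides therefore agree as soon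
as `[p_1^n] J_β = 1` and `[p_ρ] J_β = e_β`. The second identity follows from the first: `D(p_1^n)`
is a multiple of `p_ρ`, and self-adjointness turns this into `[p_1^n] D f = [p_ρ] f`
(`onesCoeff_lbOp`).

Existence of the Jack functions. The eigenvalues of `D` alone can coincide for different partitions,
so `D` is embedded in the Nazarov-Sklyanin family `[w^0] L^k` (`nsOp`), whose self-adjointness is
visible from the matrix `L` (`lax_selfAdjoint`). Substituting `w = x_0` turns `L` into a Dunkl
operator (`dunkl_theta`), which gives triangularity and the diagonal entries (`co_rows_nsOp_mono`).
The generating function of these entries over `k` determines the numbers `α λ_i - i`, hence `λ`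
(`eq_of_diagCoeff_eq`); a generic combination of the operators has simple spectrum, and its
eigenvectors are orthogonal and triangular (`exists_isJackBasis`). On degree `n` one has `[w^0] L^3
= 2 α D + α (α - 1) n` (`coeff_dunkl_three_toSym`), so `D` inherits self-adjointness.

The normalization `h_λ [p_1^n] P_λ = 1` (`onesCoeff_jackP_mul_hook`) is proved by removing first
columns. If `λ'` is `λ` with a column of height `N ≥ ℓ(λ)` added, then `P_λ' = x_1 ... x_N P_λ` in
`N` variables, because both sides obey the same eigenvalue recursion (`IsJackBasis.co_add_colVec`).
Setting the variables to `1` compares `[p_1^n]` of the two, given the principal specialization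
`P_λ(1^N) = [p_1^n]P_λ · ∏ (N + α j - i)` over the boxes (`spec_jackP`). The latter is an induction
on `n` from Euler's identity, the commutator of `∂/∂p_1` with `D`, and the branching rule that `p_1
P_μ` involves only `P_λ` with `λ` equal to `μ` plus a box (`rows_of_branching`). -/

noncomputable section

/-! ### Symmetric functions as polynomials in the power sums; the monomial basis -/

namespace JackLB

variable {K : Type*} [Field K]

/-! ### Shapes of exponent vectors -/

/-- The multiset of nonzero exponents of a monomial. -/
def shape (η : ℕ →₀ ℕ) : Multiset ℕ := η.support.val.map η

theorem shape_pos {η : ℕ →₀ ℕ} {a : ℕ} (ha : a ∈ shape η) : 0 < a := by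
  obtain ⟨i, hi, rfl⟩ := Multiset.mem_map.1 ha
  exact Nat.pos_of_ne_zero (Finsupp.mem_support_iff.1 hi)

theorem sum_shape (η : ℕ →₀ ℕ) : (shape η).sum = η.degree := rfl

theorem sum_map_shape {M : Type*} [AddCommMonoid M] (η : ℕ →₀ ℕ) (g : ℕ → M) :
    ((shape η).map g).sum = ∑ i ∈ η.support, g (η i) := by
  rw [shape, Multiset.map_map]; rfl

theorem card_shape (η : ℕ →₀ ℕ) : (shape η).card = η.support.card := by simp [shape]

theorem count_shape (η : ℕ →₀ ℕ) {a : ℕ} (ha : a ≠ 0) :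
    (shape η).count a = Nat.card {i // η i = a} := by
  rw [shape, Multiset.count_map, Nat.subtype_card (η.support.filter fun i => a = η i)]
  · rfl
  · intro x
    simp only [Finset.mem_filter, Finsupp.mem_support_iff]
    constructor
    · exact fun h => h.2.symm
    · rintro rfl
      exact ⟨ha, rfl⟩

theorem shape_embDomain (e : ℕ ↪ ℕ) (η : ℕ →₀ ℕ) : shape (Finsupp.embDomain e η) = shape η := by
  simp only [shape, Finsupp.support_embDomain, Finset.map_val, Multiset.map_map]
  exact Multiset.map_congr rfl fun i _ => by simp

/-- The fibres over each nonzero value are finite and equinumerous, and the fibres over `0` are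
countably infinite, so they can be matched one by one. The resulting `e` is in fact a bijection of
`ℕ`. -/
theorem exists_embDomain_of_shape_eq {η θ : ℕ →₀ ℕ} (h : shape η = shape θ) :
    ∃ e : ℕ ↪ ℕ, θ = Finsupp.embDomain e η := by
  have key : ∀ c : ℕ, Nonempty ({i // η i = c} ≃ {i // θ i = c}) := by
    intro c
    by_cases hc : c = 0
    · subst hc
      have inf : ∀ ζ : ℕ →₀ ℕ, Infinite {i // ζ i = 0} := by
        intro ζ
        have h1 : ((ζ.support : Set ℕ)ᶜ).Infinite := ζ.support.finite_toSet.infinite_compl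
        refine Set.infinite_coe_iff.2 (h1.mono fun i hi => ?_)
        change ζ i = 0
        simpa using hi
      have := inf η
      have := inf θ
      exact nonempty_equiv_of_countable
    · have fin : ∀ ζ : ℕ →₀ ℕ, Finite {i // ζ i = c} := by
        intro ζ
        refine Set.Finite.to_subtype (ζ.support.finite_toSet.subset ?_)
        intro i hi
        have : ζ i = c := hi
        simp [this, hc]
      have := fin η
      have := fin θ
      rw [← Finite.card_eq, ← count_shape η hc, ← count_shape θ hc, h]
  let e := fun c => (key c).some
  refine ⟨(Equiv.ofFiberEquiv e).toEmbedding, ?_⟩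
  ext i
  obtain ⟨j, rfl⟩ := (Equiv.ofFiberEquiv e).surjective i
  rw [Equiv.ofFiberEquiv_map (g := θ) e j]
  exact (Finsupp.embDomain_apply_self (Equiv.ofFiberEquiv e).toEmbedding η j).symm

/-! ### Power sums and symmetric power series -/

theorem coeff_psum (k : ℕ) (η : ℕ →₀ ℕ) [Decidable (∃ i : ℕ, η = Finsupp.single i k)] :
    MvPowerSeries.coeff η (psum K k) = if ∃ i : ℕ, η = Finsupp.single i k then 1 else 0 := by
  change (@ite K _ (Classical.propDecidable _) 1 0) = _
  congr

theorem coeff_msym {n : ℕ} (mu : n.Partition) (η : ℕ →₀ ℕ) :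
    MvPowerSeries.coeff η (msym K mu) = if shape η = mu.parts then 1 else 0 := by
  classical
  change (if shape η = mu.parts then (1 : K) else 0) = _
  congr

theorem coeff_X_pow_mul {σ : Type*} [DecidableEq σ] (η : σ →₀ ℕ) (j : σ) (k : ℕ)
    (G : MvPowerSeries σ K) :
    MvPowerSeries.coeff η (MvPowerSeries.X j ^ k * G) =
      if k ≤ η j then MvPowerSeries.coeff (η - Finsupp.single j k) G else 0 := by
  classical
  rw [MvPowerSeries.X_pow_eq, MvPowerSeries.coeff_monomial_mul]
  simp [Finsupp.single_le_iff]

theorem coeff_psum_mul (η : ℕ →₀ ℕ) (S : Finset ℕ) (hS : η.support ⊆ S) {k : ℕ} (hk : k ≠ 0)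
    (G : MvPowerSeries ℕ K) :
    MvPowerSeries.coeff η (psum K k * G) =
      ∑ j ∈ S, MvPowerSeries.coeff η (MvPowerSeries.X j ^ k * G) := by
  classical
  simp only [MvPowerSeries.coeff_mul]
  rw [Finset.sum_comm]
  refine Finset.sum_congr rfl fun p hp => ?_
  rw [← Finset.sum_mul]
  congr 1
  have hle : p.1 ≤ η := by
    rw [← Finset.HasAntidiagonal.mem_antidiagonal.1 hp]; exact le_self_add
  simp only [coeff_psum, MvPowerSeries.coeff_X_pow]
  split_ifs with h
  · obtain ⟨i, hi⟩ := h
    have hi' : i ∈ S := by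
      apply hS
      have := hle i
      rw [hi] at this
      simp only [Finsupp.single_eq_same] at this
      simp only [Finsupp.mem_support_iff]; omega
    rw [Finset.sum_eq_single i]
    · simp [hi]
    · intro j _ hj
      rw [if_neg]
      rw [hi]
      intro h2
      exact hj ((Finsupp.single_left_injective hk h2).symm)
    · exact fun h => absurd hi' h
  · symm
    refine Finset.sum_eq_zero fun j _ => if_neg fun hj => h ⟨j, hj⟩

theorem coeff_psum_mul' (η : ℕ →₀ ℕ) (S : Finset ℕ) (hS : η.support ⊆ S) {k : ℕ} (hk : k ≠ 0)
    (G : MvPowerSeries ℕ K) :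
    MvPowerSeries.coeff η (psum K k * G) =
      ∑ j ∈ S, if k ≤ η j then MvPowerSeries.coeff (η - Finsupp.single j k) G else 0 := by
  rw [coeff_psum_mul η S hS hk]
  simp only [coeff_X_pow_mul]

/-- This is the form in which symmetry is used: it covers transpositions of variables, the shift `i
↦ i + 1`, and arbitrary injections, and it passes to all polynomials in the power sums. Consequently
a coefficient depends only on the shape of the exponent vector. -/
theorem killCompl_psum (e : ℕ ↪ ℕ) (k : ℕ) : MvPowerSeries.killCompl e (psum K k) = psum K k := by
  classical
  ext η
  rw [MvPowerSeries.coeff_killCompl, coeff_psum, coeff_psum]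
  congr 1
  refine propext ⟨?_, ?_⟩
  · rintro ⟨i, hi⟩
    by_cases hk : k = 0
    · subst hk
      refine ⟨0, ?_⟩
      simp only [Finsupp.single_zero] at hi ⊢
      exact Finsupp.embDomain_eq_zero.1 hi
    · have : i ∈ (Finsupp.embDomain e η).support := by simp [hi, hk]
      rw [Finsupp.support_embDomain] at this
      obtain ⟨j, -, rfl⟩ := Finset.mem_map.1 this
      refine ⟨j, Finsupp.embDomain_injective e ?_⟩
      rw [hi, Finsupp.embDomain_single]
  · rintro ⟨i, rfl⟩
    exact ⟨e i, by rw [Finsupp.embDomain_single]⟩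

/-- Polynomials in the power sums `p_1, p_2, …`; the variable `X i` stands for `p_(i+1)`. -/
abbrev Fock (K : Type*) [Field K] := MvPolynomial ℕ K

/-- The degree of `p_(i+1)`. -/
def wt (i : ℕ) : ℕ := i + 1

/-- The symmetric function given by a polynomial in the power sums. -/
def toSym : Fock K →ₐ[K] MvPowerSeries ℕ K := MvPolynomial.aeval fun i => psum K (i + 1)

@[simp] theorem toSym_X (i : ℕ) : toSym (MvPolynomial.X i : Fock K) = psum K (i + 1) := by
  simp [toSym]

theorem killCompl_toSym (e : ℕ ↪ ℕ) (f : Fock K) :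
    MvPowerSeries.killCompl e (toSym f) = toSym f := by
  have : (MvPowerSeries.killCompl e).comp (toSym (K := K)) = toSym := by
    apply MvPolynomial.algHom_ext
    intro i
    simp [killCompl_psum]
  exact DFunLike.congr_fun this f

/-- The coefficient of a monomial in the symmetric function of a polynomial in the power sums. -/
def co (η : ℕ →₀ ℕ) : Fock K →ₗ[K] K := (MvPowerSeries.coeff η).comp toSym.toLinearMap

theorem co_apply (η : ℕ →₀ ℕ) (f : Fock K) : co η f = MvPowerSeries.coeff η (toSym f) := rfl

theorem co_embDomain (e : ℕ ↪ ℕ) (η : ℕ →₀ ℕ) (f : Fock K) :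
    co (Finsupp.embDomain e η) f = co η f := by
  rw [co_apply, ← MvPowerSeries.coeff_killCompl, killCompl_toSym, co_apply]

theorem co_eq_of_shape_eq {η θ : ℕ →₀ ℕ} (h : shape η = shape θ) (f : Fock K) :
    co η f = co θ f := by
  obtain ⟨e, rfl⟩ := exists_embDomain_of_shape_eq h
  exact (co_embDomain e η f).symm

theorem co_X_mul (η : ℕ →₀ ℕ) (S : Finset ℕ) (hS : η.support ⊆ S) (i : ℕ) (f : Fock K) :
    co η (MvPolynomial.X i * f) =
      ∑ j ∈ S, if i + 1 ≤ η j then co (η - Finsupp.single j (i + 1)) f else 0 := by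
  rw [co_apply, map_mul, toSym_X, coeff_psum_mul' η S hS (Nat.succ_ne_zero i)]
  rfl

/-- The coefficient counts the ways of distributing the parts of `s` over the variables, so that
parts falling on the same variable are merged. Merging never increases the number of parts, and
preserves it only if nothing is merged. Recording a natural number lets nonvanishing survive in
characteristic `0`. -/
theorem coeff_psum_prod_aux (s : Multiset ℕ) (hs : ∀ a ∈ s, a ≠ 0) (η : ℕ →₀ ℕ) :
    ∃ c : ℕ, MvPowerSeries.coeff η ((s.map (psum K)).prod) = c ∧
      (c ≠ 0 → η.degree = s.sum ∧ (shape η).card ≤ s.card ∧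
        ((shape η).card = s.card → shape η = s)) ∧ (shape η = s → c ≠ 0) := by
  classical
  induction s using Multiset.induction_on generalizing η with
  | empty =>
    refine ⟨if η = 0 then 1 else 0, ?_, ?_, ?_⟩
    · simp [MvPowerSeries.coeff_one]
    · intro h
      have : η = 0 := by by_contra h2; simp [h2] at h
      subst this
      simp [shape]
    · intro h
      have : η = 0 := by simpa [shape] using h
      simp [this]
  | cons k s ih =>
    have hk : k ≠ 0 := hs k (Multiset.mem_cons_self k s)
    choose c hc1 hc2 hc3 using fun θ => ih (fun a ha => hs a (Multiset.mem_cons_of_mem ha)) θ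
    have hsub : ∀ j, k ≤ η j → η - Finsupp.single j k + Finsupp.single j k = η := by
      intro j hj
      exact tsub_add_cancel_of_le (by simpa [Finsupp.single_le_iff] using hj)
    have hshape : ∀ j, η j = k → shape η = k ::ₘ shape (η - Finsupp.single j k) := by
      intro j hj
      have h1 : (η - Finsupp.single j k) = η.erase j := by
        ext i
        by_cases hij : i = j
        · subst hij; simp [hj]
        · simp [hij]
      have hj' : j ∈ η.support := by simp [hj, hk]
      rw [h1, shape, shape, Finsupp.support_erase]
      conv_lhs => rw [← Finset.insert_erase hj', Finset.insert_val_of_notMem (by simp)]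
      rw [Multiset.map_cons, hj]
      congr 1
      refine Multiset.map_congr rfl fun i hi => ?_
      have : i ≠ j := (Finset.mem_erase.1 (show i ∈ η.support.erase j from hi)).1
      simp [this]
    refine ⟨∑ j ∈ η.support, if k ≤ η j then c (η - Finsupp.single j k) else 0, ?_, ?_, ?_⟩
    · rw [Multiset.map_cons, Multiset.prod_cons, coeff_psum_mul' η _ subset_rfl hk]
      push_cast
      refine Finset.sum_congr rfl fun j _ => ?_
      split_ifs
      · exact hc1 _
      · simp
    · intro h
      obtain ⟨j, hj, hne⟩ := Finset.exists_ne_zero_of_sum_ne_zero h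
      have hkj : k ≤ η j := by by_contra h2; simp [h2] at hne
      rw [if_pos hkj] at hne
      obtain ⟨d1, d2, d3⟩ := hc2 _ hne
      set θ := η - Finsupp.single j k with hθ
      have hη : η = θ + Finsupp.single j k := (hsub j hkj).symm
      have hdeg : η.degree = (k ::ₘ s).sum := by
        rw [hη, map_add, d1]; simp [add_comm]
      have hsupp : η.support ⊆ insert j θ.support := by
        intro i hi
        by_cases hij : i = j
        · simp [hij]
        · have : θ i = η i := by simp [hθ, hij]
          simp only [Finset.mem_insert, Finsupp.mem_support_iff, this]
          exact Or.inr (Finsupp.mem_support_iff.1 hi)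
      have hcard := (Finset.card_le_card hsupp).trans (Finset.card_insert_le _ _)
      rw [card_shape] at d2 d3
      rw [card_shape, Multiset.card_cons]
      refine ⟨hdeg, by omega, fun heq => ?_⟩
      have hjn : j ∉ θ.support := by
        intro hj2
        rw [Finset.insert_eq_of_mem hj2] at hsupp
        have := Finset.card_le_card hsupp
        omega
      have hjk : η j = k := by
        have : θ j = 0 := by simpa using hjn
        rw [hη]; simp [this]
      rw [hshape j hjk, d3 (by omega)]
    · intro h
      have hmem : k ∈ shape η := h ▸ Multiset.mem_cons_self k s
      obtain ⟨j, hj, hjk⟩ := Multiset.mem_map.1 hmem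
      have h2 : shape (η - Finsupp.single j k) = s := by
        have := hshape j hjk
        rw [h] at this
        exact ((Multiset.cons_inj_right k).1 this).symm
      have h3 := hc3 _ h2
      intro h0
      have := (Finset.sum_eq_zero_iff.1 h0) j hj
      rw [if_pos hjk.ge] at this
      exact h3 this

/-! ### Power sum monomials and partitions -/

/-- The exponents of `p_lam` as a monomial in the power sums. -/
def ex {n : ℕ} (lam : n.Partition) : ℕ →₀ ℕ := Multiset.toFinsupp (lam.parts.map Nat.pred)

theorem toMultiset_ex {n : ℕ} (lam : n.Partition) :
    (Finsupp.toMultiset (ex lam)).map Nat.succ = lam.parts := by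
  rw [ex, Multiset.toFinsupp_toMultiset, Multiset.map_map]
  conv_rhs => rw [← Multiset.map_id lam.parts]
  refine Multiset.map_congr rfl fun a ha => ?_
  have := lam.parts_pos ha
  simp only [Function.comp_apply, id]
  exact Nat.succ_pred_eq_of_pos this

theorem weight_wt (d : ℕ →₀ ℕ) :
    Finsupp.weight wt d = ((Finsupp.toMultiset d).map Nat.succ).sum := by
  induction d using Finsupp.induction_linear with
  | zero => simp
  | add f g hf hg => simp [map_add, hf, hg]
  | single i k =>
    rw [Finsupp.weight_apply, Finsupp.sum_single_index (by simp), Finsupp.toMultiset_single,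
      Multiset.map_nsmul, Multiset.sum_nsmul]
    simp [wt]

theorem weight_ex {n : ℕ} (lam : n.Partition) : Finsupp.weight wt (ex lam) = n := by
  rw [weight_wt, toMultiset_ex, lam.parts_sum]

theorem ex_injective {n : ℕ} : Function.Injective (ex (n := n)) := by
  intro lam mu h
  apply Nat.Partition.ext
  rw [← toMultiset_ex, ← toMultiset_ex, h]

theorem exists_ex {n : ℕ} {d : ℕ →₀ ℕ} (hd : Finsupp.weight wt d = n) :
    ∃ lam : n.Partition, ex lam = d := by
  refine ⟨⟨(Finsupp.toMultiset d).map Nat.succ, ?_, ?_⟩, ?_⟩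
  · intro i hi
    obtain ⟨j, -, rfl⟩ := Multiset.mem_map.1 hi
    exact Nat.succ_pos j
  · rw [← weight_wt, hd]
  · have h : Nat.pred ∘ Nat.succ = id := rfl
    rw [ex, Multiset.map_map, h, Multiset.map_id, Finsupp.toMultiset_toFinsupp]

theorem toSym_monomial (d : ℕ →₀ ℕ) :
    toSym (MvPolynomial.monomial d (1 : K)) =
      (((Finsupp.toMultiset d).map Nat.succ).map (psum K)).prod := by
  rw [toSym, MvPolynomial.aeval_monomial, map_one, one_mul, Multiset.map_map,
    Finsupp.toMultiset_map, Finsupp.prod_toMultiset, Finsupp.prod_mapDomain_index]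
  · rfl
  · simp
  · intros; rw [pow_add]

theorem toSym_monomial_ex {n : ℕ} (lam : n.Partition) :
    toSym (MvPolynomial.monomial (ex lam) (1 : K)) = psumPart K lam := by
  rw [toSym_monomial, toMultiset_ex, psumPart]

/-- The polynomials in the power sums that are homogeneous of degree `n`. -/
abbrev H (K : Type*) [Field K] (n : ℕ) : Submodule K (Fock K) :=
  MvPolynomial.weightedHomogeneousSubmodule K wt n

theorem monomial_mem_H {n : ℕ} (lam : n.Partition) :
    MvPolynomial.monomial (ex lam) (1 : K) ∈ H K n :=
  MvPolynomial.isWeightedHomogeneous_monomial _ _ _ (weight_ex lam)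

theorem eq_sum_monomial {n : ℕ} {f : Fock K} (hf : f ∈ H K n) :
    f = ∑ lam : n.Partition, MvPolynomial.coeff (ex lam) f • MvPolynomial.monomial (ex lam) 1 := by
  classical
  ext d
  rw [MvPolynomial.coeff_sum]
  simp only [MvPolynomial.coeff_smul, MvPolynomial.coeff_monomial]
  by_cases hd : Finsupp.weight wt d = n
  · obtain ⟨mu, rfl⟩ := exists_ex hd
    rw [Finset.sum_eq_single mu]
    · simp
    · intro lam _ h
      rw [if_neg (fun h2 => h (ex_injective h2))]; simp
    · simp
  · rw [MvPolynomial.IsWeightedHomogeneous.coeff_eq_zero hf d hd, Finset.sum_eq_zero]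
    intro lam _
    rw [if_neg (by rintro rfl; exact hd (weight_ex lam))]; simp

theorem toSym_eq_sum {n : ℕ} {f : Fock K} (hf : f ∈ H K n) :
    toSym f = ∑ lam : n.Partition, MvPolynomial.coeff (ex lam) f • psumPart K lam := by
  conv_lhs => rw [eq_sum_monomial hf]
  simp [toSym_monomial_ex]

theorem co_eq_zero {n : ℕ} {f : Fock K} (hf : f ∈ H K n) {η : ℕ →₀ ℕ} (hη : η.degree ≠ n) :
    co η f = 0 := by
  rw [co_apply, toSym_eq_sum hf, map_sum]
  refine Finset.sum_eq_zero fun lam _ => ?_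
  obtain ⟨c, h1, h2, -⟩ := coeff_psum_prod_aux (K := K) lam.parts
    (fun a ha => (lam.parts_pos ha).ne') η
  rw [map_smul, psumPart, h1]
  have : c = 0 := by
    by_contra h
    exact hη ((h2 h).1.trans lam.parts_sum)
  simp [this]

/-! ### Rows of a partition -/

/-- The parts of `lam` in decreasing order, followed by zeros. -/
def rows {n : ℕ} (lam : n.Partition) : ℕ →₀ ℕ :=
  Finsupp.onFinset (Finset.range (sortedParts lam).length) (fun i => (sortedParts lam).getD i 0) (by
    intro i hi
    rw [Finset.mem_range]
    by_contra h
    exact hi (List.getD_eq_default _ _ (by omega)))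

theorem rows_apply {n : ℕ} (lam : n.Partition) (i : ℕ) :
    rows lam i = (sortedParts lam).getD i 0 := rfl

theorem coe_sortedParts {n : ℕ} (lam : n.Partition) :
    (sortedParts lam : Multiset ℕ) = lam.parts := Multiset.sort_eq _ _

theorem length_sortedParts {n : ℕ} (lam : n.Partition) : (sortedParts lam).length = len lam := by
  rw [len, ← coe_sortedParts, Multiset.coe_card]

theorem rows_pos_iff {n : ℕ} (lam : n.Partition) (i : ℕ) : rows lam i ≠ 0 ↔ i < len lam := by
  rw [rows_apply, ← length_sortedParts]
  constructor
  · intro h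
    by_contra h2
    exact h (List.getD_eq_default _ _ (by omega))
  · intro h
    rw [List.getD_eq_getElem _ _ h]
    have : (sortedParts lam)[i] ∈ lam.parts := by
      rw [← coe_sortedParts]; exact List.getElem_mem h
    exact (lam.parts_pos this).ne'

theorem support_rows {n : ℕ} (lam : n.Partition) : (rows lam).support = Finset.range (len lam) := by
  ext i
  rw [Finsupp.mem_support_iff, rows_pos_iff, Finset.mem_range]

theorem shape_rows {n : ℕ} (lam : n.Partition) : shape (rows lam) = lam.parts := by
  rw [shape, support_rows, ← length_sortedParts, ← coe_sortedParts]
  change ((List.range _).map (rows lam) : Multiset ℕ) = _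
  congr 1
  apply List.ext_getElem (by simp)
  intro i h1 h2
  simp [rows_apply, List.getElem?_eq_getElem h2]

theorem rows_antitone {n : ℕ} (lam : n.Partition) : Antitone (rows lam) := by
  intro i j hij
  by_cases hj : j < (sortedParts lam).length
  · have hi : i < (sortedParts lam).length := by omega
    rw [rows_apply, rows_apply, List.getD_eq_getElem _ _ hj, List.getD_eq_getElem _ _ hi]
    rcases hij.eq_or_lt with rfl | h
    · exact le_rfl
    · exact List.pairwise_iff_getElem.1 (Multiset.pairwise_sort lam.parts (· ≥ ·)) i j hi hj h
  · rw [rows_apply, List.getD_eq_default _ _ (by omega)]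
    exact Nat.zero_le _

theorem rows_injective {n : ℕ} : Function.Injective (rows (n := n)) := by
  intro lam mu h
  apply Nat.Partition.ext
  rw [← shape_rows, ← shape_rows, h]

theorem degree_rows {n : ℕ} (lam : n.Partition) : (rows lam).degree = n := by
  rw [← sum_shape, shape_rows, lam.parts_sum]

/-- The partition whose parts are the nonzero exponents of a monomial. -/
def ofShape {n : ℕ} (η : ℕ →₀ ℕ) (h : η.degree = n) : n.Partition where
  parts := shape η
  parts_pos := shape_pos
  parts_sum := by rw [sum_shape, h]

theorem antitone_eq_of_shape_eq {η θ : ℕ →₀ ℕ} (hη : Antitone η) (hθ : Antitone θ)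
    (h : shape η = shape θ) : η = θ := by
  have key : ∀ ζ : ℕ →₀ ℕ, Antitone ζ → ∀ i c, c ≠ 0 →
      (c ≤ ζ i ↔ i < ((shape ζ).filter (c ≤ ·)).card) := by
    intro ζ hζ i c hc
    have h1 : ((shape ζ).filter (c ≤ ·)).card = (ζ.support.filter (fun j => c ≤ ζ j)).card := by
      rw [shape, Multiset.filter_map, Multiset.card_map]; rfl
    rw [h1]
    constructor
    · intro h
      have : Finset.range (i + 1) ⊆ ζ.support.filter (fun j => c ≤ ζ j) := by
        intro j hj
        have h2 : ζ i ≤ ζ j := hζ (by simp at hj; omega)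
        simp only [Finset.mem_filter, Finsupp.mem_support_iff]
        omega
      have := Finset.card_le_card this
      rw [Finset.card_range] at this
      omega
    · intro h
      by_contra h2
      have : ζ.support.filter (fun j => c ≤ ζ j) ⊆ Finset.range i := by
        intro j hj
        simp only [Finset.mem_filter, Finset.mem_range] at hj ⊢
        by_contra h3
        have : ζ j ≤ ζ i := hζ (by omega)
        omega
      have := Finset.card_le_card this
      rw [Finset.card_range] at this
      omega
  ext i
  apply le_antisymm
  · by_cases h0 : η i = 0
    · omega
    · rw [key θ hθ i _ h0, ← h, ← key η hη i _ h0]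
  · by_cases h0 : θ i = 0
    · omega
    · rw [key η hη i _ h0, h, ← key θ hθ i _ h0]

theorem rows_ofShape {n : ℕ} {η : ℕ →₀ ℕ} (h : η.degree = n) (hη : Antitone η) :
    rows (ofShape η h) = η :=
  antitone_eq_of_shape_eq (rows_antitone _) hη (by rw [shape_rows]; rfl)

/-! ### The monomial basis -/

theorem coeffIn_eq {ι V : Type*} [Fintype ι] [AddCommGroup V] [Module K V] {v : ι → V}
    (hv : LinearIndependent K v) {f : V} {c : ι → K} (hf : f = ∑ j, c j • v j) (i : ι) :
    coeffIn v f i = c i := by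
  have h : ∃ c : ι → K, f = ∑ j, c j • v j := ⟨c, hf⟩
  rw [coeffIn, dif_pos h]
  have h2 := h.choose_spec
  have h3 := Fintype.linearIndependent_iff.1 hv (fun j => c j - h.choose j) (by
    simp only [sub_smul, Finset.sum_sub_distrib]
    rw [← hf, ← h2, sub_self]) i
  exact (sub_eq_zero.1 h3).symm


variable [CharZero K]

/-- Power sums are triangular in the monomial functions with respect to the number of parts. -/
theorem eq_zero_of_co_rows {n : ℕ} {f : Fock K} (hf : f ∈ H K n)
    (h : ∀ lam : n.Partition, co (rows lam) f = 0) : f = 0 := by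
  classical
  by_contra hne
  have : ∃ lam : n.Partition, MvPolynomial.coeff (ex lam) f ≠ 0 := by
    by_contra! h2
    apply hne
    rw [eq_sum_monomial hf]
    simp [h2]
  obtain ⟨lam0, hlam0⟩ := this
  -- Take a `p_lam` with the most parts among those occurring in `f`; then no other `p_mu` occurring
  -- in `f` contributes to the monomial with exponents `rows lam`.
  obtain ⟨lam, hlam, hmax⟩ := Finset.exists_max_image
    (Finset.univ.filter fun lam : n.Partition => MvPolynomial.coeff (ex lam) f ≠ 0) len
    ⟨lam0, by simpa using hlam0⟩
  simp only [Finset.mem_filter, Finset.mem_univ, true_and] at hlam hmax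
  have h1 := h lam
  rw [co_apply, toSym_eq_sum hf, map_sum, Finset.sum_eq_single lam] at h1
  · obtain ⟨c, c1, -, c3⟩ := coeff_psum_prod_aux (K := K) lam.parts
      (fun a ha => (lam.parts_pos ha).ne') (rows lam)
    rw [map_smul, psumPart, c1, smul_eq_mul] at h1
    rcases mul_eq_zero.1 h1 with h2 | h2
    · exact hlam h2
    · exact c3 (shape_rows lam) (by exact_mod_cast h2)
  · intro mu _ hmu
    obtain ⟨c, c1, c2, -⟩ := coeff_psum_prod_aux (K := K) mu.parts
      (fun a ha => (mu.parts_pos ha).ne') (rows lam)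
    rw [map_smul, psumPart, c1, smul_eq_mul]
    by_cases hc : MvPolynomial.coeff (ex mu) f = 0
    · rw [hc, zero_mul]
    · have hl := hmax mu hc
      by_cases hc0 : c = 0
      · simp [hc0]
      · exfalso
        obtain ⟨-, h3, h4⟩ := c2 hc0
        rw [shape_rows] at h3 h4
        have h5 : Multiset.card lam.parts = Multiset.card mu.parts := le_antisymm h3 hl
        exact hmu (Nat.Partition.ext (h4 h5).symm)
  · simp

theorem ext_co {n : ℕ} {f g : Fock K} (hf : f ∈ H K n) (hg : g ∈ H K n)
    (h : ∀ lam : n.Partition, co (rows lam) f = co (rows lam) g) : f = g := by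
  refine sub_eq_zero.1 (eq_zero_of_co_rows (Submodule.sub_mem _ hf hg) fun lam => ?_)
  rw [map_sub, h, sub_self]

/-- Both sides are indexed by the partitions of `n`, so the injectivity already shown gives
surjectivity. This is where the monomial functions are seen to be polynomials in the power sums. -/
theorem exists_co_eq {n : ℕ} (v : n.Partition → K) :
    ∃ f ∈ H K n, ∀ lam : n.Partition, co (rows lam) f = v lam := by
  classical
  let comb : (n.Partition → K) →ₗ[K] Fock K :=
    Fintype.linearCombination K fun lam : n.Partition => MvPolynomial.monomial (ex lam) (1 : K)
  have hcomb : ∀ w, comb w ∈ H K n := by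
    intro w
    rw [Fintype.linearCombination_apply]
    exact Submodule.sum_mem _ fun lam _ => Submodule.smul_mem _ _ (monomial_mem_H lam)
  have hcoeff : ∀ w lam, MvPolynomial.coeff (ex lam) (comb w) = w lam := by
    intro w lam
    rw [Fintype.linearCombination_apply, MvPolynomial.coeff_sum, Finset.sum_eq_single lam]
    · simp
    · intro mu _ h
      simp [MvPolynomial.coeff_monomial, ex_injective.ne h]
    · simp
  let F : (n.Partition → K) →ₗ[K] (n.Partition → K) :=
    LinearMap.pi fun lam => (co (rows lam)).comp comb
  have hinj : Function.Injective F := by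
    rw [injective_iff_map_eq_zero]
    intro w hw
    have h0 : comb w = 0 := eq_zero_of_co_rows (hcomb w) fun lam => congrFun hw lam
    funext lam
    rw [← hcoeff w, h0]; simp
  obtain ⟨w, hw⟩ := LinearMap.injective_iff_surjective.1 hinj v
  exact ⟨comb w, hcomb w, fun lam => congrFun hw lam⟩

/-- The monomial symmetric function as a polynomial in the power sums. -/
def mono (K : Type*) [Field K] [CharZero K] {n : ℕ} (lam : n.Partition) : Fock K :=
  (exists_co_eq (K := K) fun mu => open Classical in if mu = lam then 1 else 0).choose

theorem mono_mem {n : ℕ} (lam : n.Partition) : mono K lam ∈ H K n :=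
  (exists_co_eq (K := K) fun mu => open Classical in if mu = lam then 1 else 0).choose_spec.1

theorem co_rows_mono {n : ℕ} (lam mu : n.Partition) [Decidable (mu = lam)] :
    co (rows mu) (mono K lam) = if mu = lam then 1 else 0 := by
  refine ((exists_co_eq (K := K) fun mu =>
    open Classical in if mu = lam then 1 else 0).choose_spec.2 mu).trans ?_
  congr

theorem eq_sum_mono {n : ℕ} {f : Fock K} (hf : f ∈ H K n) :
    f = ∑ lam : n.Partition, co (rows lam) f • mono K lam := by
  classical
  refine ext_co hf (Submodule.sum_mem _ fun lam _ => Submodule.smul_mem _ _ (mono_mem lam)) ?_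
  intro mu
  simp [co_rows_mono]

theorem toSym_mono {n : ℕ} (lam : n.Partition) : toSym (mono K lam) = msym K lam := by
  classical
  ext η
  rw [coeff_msym, ← co_apply]
  by_cases hη : η.degree = n
  · rw [co_eq_of_shape_eq (θ := rows (ofShape η hη)) (by rw [shape_rows]; rfl), co_rows_mono]
    congr 1
    exact propext ⟨fun h => by rw [← h]; rfl, fun h => Nat.Partition.ext h⟩
  · rw [co_eq_zero (mono_mem lam) hη, if_neg]
    intro h
    exact hη (by rw [← sum_shape, h, lam.parts_sum])

theorem toSym_injOn {n : ℕ} {f g : Fock K} (hf : f ∈ H K n) (hg : g ∈ H K n)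
    (h : toSym f = toSym g) : f = g :=
  ext_co hf hg fun lam => by rw [co_apply, co_apply, h]

theorem linearIndependent_psumPart (n : ℕ) :
    LinearIndependent K fun lam : n.Partition => psumPart K lam := by
  classical
  rw [Fintype.linearIndependent_iff]
  intro c hc lam
  have h0 : ∑ mu : n.Partition, c mu • MvPolynomial.monomial (ex mu) (1 : K) = 0 := by
    refine toSym_injOn (n := n) (Submodule.sum_mem _ fun mu _ =>
      Submodule.smul_mem _ _ (monomial_mem_H mu)) (Submodule.zero_mem _) ?_
    simp [toSym_monomial_ex, hc]
  have h1 := congrArg (MvPolynomial.coeff (ex lam)) h0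
  rw [MvPolynomial.coeff_sum, Finset.sum_eq_single lam] at h1
  · simpa using h1
  · intro mu _ h
    simp [MvPolynomial.coeff_monomial, ex_injective.ne h]
  · simp

theorem pCoeff_toSym {n : ℕ} (lam : n.Partition) {f : Fock K} (hf : f ∈ H K n) :
    pCoeff lam (toSym f) = MvPolynomial.coeff (ex lam) f := by
  have h := linearIndependent_psumPart (K := K) n
  have h2 := toSym_eq_sum hf
  rw [pCoeff]
  exact coeffIn_eq h h2 lam

end JackLB
end

/-! ### The scalar product, the Lax operator and its commutator with `∂/∂p_1` -/

noncomputable section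

namespace JackLB

variable {K : Type*} [Field K]

open MvPolynomial (pderiv)

/-! ### The scalar product on polynomials in the power sums -/

/-- The squared norm of a monomial in the power sums. -/
def monoNorm (α : K) (d : ℕ →₀ ℕ) : K :=
  d.prod fun i k => (α * ((i + 1 : ℕ) : K)) ^ k * (k.factorial : K)

theorem monoNorm_add_single (α : K) (d : ℕ →₀ ℕ) (i : ℕ) :
    monoNorm α (d + Finsupp.single i 1) =
      monoNorm α d * (α * ((i + 1 : ℕ) : K) * ((d i + 1 : ℕ) : K)) := by
  classical
  have hs : ∀ e : ℕ →₀ ℕ, e.support ⊆ insert i (d.support) → monoNorm α e =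
      ∏ j ∈ insert i d.support, (α * ((j + 1 : ℕ) : K)) ^ e j * ((e j).factorial : K) :=
    fun e he => Finsupp.prod_of_support_subset _ he _ (by simp)
  rw [hs d (Finset.subset_insert _ _), hs (d + Finsupp.single i 1)]
  · rw [← Finset.mul_prod_erase _ _ (Finset.mem_insert_self i _),
      ← Finset.mul_prod_erase (insert i d.support) (fun j => (α * ((j + 1 : ℕ) : K)) ^ d j *
        ((d j).factorial : K)) (Finset.mem_insert_self i _)]
    rw [Finset.prod_congr rfl (g := fun j => (α * ((j + 1 : ℕ) : K)) ^ d j *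
        ((d j).factorial : K))]
    · simp only [Finsupp.add_apply, Finsupp.single_eq_same, Nat.factorial_succ]
      push_cast
      ring
    · intro j hj
      have : i ≠ j := fun h => (Finset.mem_erase.1 hj).1 h.symm
      simp [Finsupp.single_eq_of_ne' this]
  · intro j hj
    simp only [Finsupp.mem_support_iff, Finsupp.add_apply] at hj
    by_cases hij : i = j
    · simp [hij]
    · rw [Finsupp.single_eq_of_ne' hij] at hj
      simp only [Finset.mem_insert, Finsupp.mem_support_iff]
      exact Or.inr (by simpa using hj)

/-- The scalar product on polynomials in the power sums for which the monomials are orthogonal. -/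
def form (α : K) : Fock K →ₗ[K] Fock K →ₗ[K] K :=
  (MvPolynomial.basisMonomials ℕ K).constr K fun d => monoNorm α d • MvPolynomial.lcoeff K d

theorem form_monomial (α : K) (d : ℕ →₀ ℕ) (g : Fock K) :
    form α (MvPolynomial.monomial d 1) g = monoNorm α d * MvPolynomial.coeff d g := by
  have := (MvPolynomial.basisMonomials ℕ K).constr_basis K
    (fun d => monoNorm α d • MvPolynomial.lcoeff K d) d
  rw [MvPolynomial.coe_basisMonomials] at this
  rw [form, this]
  rfl

theorem fock_induction {p : Fock K → Prop} (hm : ∀ d, p (MvPolynomial.monomial d 1))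
    (ha : ∀ f g, p f → p g → p (f + g)) (hs : ∀ (c : K) f, p f → p (c • f)) (f : Fock K) : p f := by
  induction f using MvPolynomial.monomial_add_induction_on with
  | C a =>
    have := hs a _ (hm 0)
    rwa [MvPolynomial.smul_monomial, smul_eq_mul, mul_one] at this
  | monomial_add a b f _ _ h =>
    refine ha _ _ ?_ h
    have := hs b _ (hm a)
    rwa [MvPolynomial.smul_monomial, smul_eq_mul, mul_one] at this

theorem form_symm (α : K) (f g : Fock K) : form α f g = form α g f := by
  classical
  induction f using fock_induction with
  | hm d =>
    induction g using fock_induction with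
    | hm e =>
      rw [form_monomial, form_monomial, MvPolynomial.coeff_monomial, MvPolynomial.coeff_monomial]
      by_cases h : d = e
      · simp [h]
      · simp [h, Ne.symm h]
    | ha g h hg hh => rw [map_add, hg, hh, map_add, LinearMap.add_apply]
    | hs c g hg => rw [map_smul, hg, map_smul, LinearMap.smul_apply]
  | ha f h hf hh => rw [map_add, LinearMap.add_apply, hf, hh, map_add]
  | hs c f hf => rw [map_smul, LinearMap.smul_apply, hf, map_smul]

/-- On monomials this is the recursion `monoNorm_add_single`. The adjunction between `p_k` and `α k
∂/∂p_k` is what makes the Lax operator self-adjoint. -/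
theorem form_X_mul (α : K) (i : ℕ) (f g : Fock K) :
    form α (MvPolynomial.X i * f) g = form α f ((α * ((i + 1 : ℕ) : K)) • pderiv i g) := by
  classical
  induction f using fock_induction with
  | hm d =>
    have h1 : (MvPolynomial.X i : Fock K) * MvPolynomial.monomial d 1 =
        MvPolynomial.monomial (d + Finsupp.single i 1) 1 := by
      rw [MvPolynomial.X, MvPolynomial.monomial_mul, one_mul, add_comm]
    rw [h1, form_monomial, form_monomial, monoNorm_add_single, MvPolynomial.coeff_smul]
    have h2 : MvPolynomial.coeff d (pderiv i g) =
        MvPolynomial.coeff (d + Finsupp.single i 1) g * ((d i + 1 : ℕ) : K) := by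
      rw [MvPolynomial.coeff_pderiv]; push_cast; ring
    rw [h2, smul_eq_mul]
    ring
  | ha f h hf hh => rw [mul_add, map_add, LinearMap.add_apply, hf, hh, map_add, LinearMap.add_apply]
  | hs c f hf =>
    rw [mul_smul_comm, map_smul, LinearMap.smul_apply, hf, map_smul (form α) c f,
      LinearMap.smul_apply]

theorem monoNorm_ex (α : K) {n : ℕ} (lam : n.Partition) :
    monoNorm α (ex lam) = α ^ len lam * (zee lam : K) := by
  classical
  have h1 : ∀ i, ex lam i = lam.parts.count (i + 1) := by
    intro i
    rw [← toMultiset_ex lam, show i + 1 = Nat.succ i from rfl,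
      Multiset.count_map_eq_count' _ _ Nat.succ_injective, Finsupp.count_toMultiset]
  have h2 : len lam = ∑ a ∈ lam.parts.toFinset, lam.parts.count a :=
    (Multiset.toFinset_sum_count_eq _).symm
  rw [h2, zee, ← Finset.prod_pow_eq_pow_sum]
  push_cast
  rw [← Finset.prod_mul_distrib, monoNorm, Finsupp.prod]
  refine Finset.prod_bij (fun i _ => i + 1) ?_ ?_ ?_ ?_
  · intro i hi
    rw [Finsupp.mem_support_iff, h1] at hi
    rw [Multiset.mem_toFinset]
    exact Multiset.count_ne_zero.1 hi
  · intro i _ j _ h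
    simpa using h
  · intro a ha
    rw [Multiset.mem_toFinset] at ha
    have := lam.parts_pos ha
    refine ⟨a - 1, ?_, by omega⟩
    rw [Finsupp.mem_support_iff, h1, show a - 1 + 1 = a by omega]
    exact Multiset.count_ne_zero.2 ha
  · intro i _
    rw [h1]
    push_cast
    rw [mul_pow]
    ring

theorem form_eq_sum (α : K) {n : ℕ} {f : Fock K} (hf : f ∈ H K n) (g : Fock K) :
    form α f g = ∑ lam : n.Partition,
      α ^ len lam * (zee lam : K) * MvPolynomial.coeff (ex lam) f *
        MvPolynomial.coeff (ex lam) g := by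
  conv_lhs => rw [eq_sum_monomial hf]
  rw [map_sum, LinearMap.sum_apply]
  refine Finset.sum_congr rfl fun lam _ => ?_
  rw [map_smul, LinearMap.smul_apply, form_monomial, monoNorm_ex, smul_eq_mul]
  ring

theorem scal_toSym [CharZero K] (α : K) {n : ℕ} {f g : Fock K} (hf : f ∈ H K n) (hg : g ∈ H K n) :
    scal α n (toSym f) (toSym g) = form α f g := by
  rw [scal, form_eq_sum α hf]
  refine Finset.sum_congr rfl fun lam _ => ?_
  rw [pCoeff_toSym lam hf, pCoeff_toSym lam hg]

theorem zee_ne_zero {n : ℕ} (lam : n.Partition) : zee lam ≠ 0 := by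
  rw [zee]
  refine Finset.prod_ne_zero_iff.2 fun i hi => mul_ne_zero (pow_ne_zero _ ?_) (Nat.factorial_ne_zero _)
  exact (lam.parts_pos (Multiset.mem_toFinset.1 hi)).ne'

/-- The scalar product is nondegenerate. -/
theorem eq_zero_of_form [CharZero K] {α : K} (hα : α ≠ 0) {n : ℕ} {f : Fock K} (hf : f ∈ H K n)
    (h : ∀ g ∈ H K n, form α f g = 0) : f = 0 := by
  rw [eq_sum_monomial hf]
  refine Finset.sum_eq_zero fun lam _ => ?_
  have h1 := h _ (monomial_mem_H lam)
  rw [form_symm, form_monomial, monoNorm_ex] at h1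
  have : α ^ len lam * (zee lam : K) ≠ 0 :=
    mul_ne_zero (pow_ne_zero _ hα) (Nat.cast_ne_zero.2 (zee_ne_zero lam))
  rw [(mul_eq_zero.1 h1).resolve_left this, zero_smul]

/-! ### The Lax operator -/

theorem pderiv_smul (i : ℕ) (c : K) (f : Fock K) : pderiv i (c • f) = c • pderiv i f :=
  (pderiv i).map_smul c f

theorem pderiv_comm (i j : ℕ) (f : Fock K) : pderiv i (pderiv j f) = pderiv j (pderiv i f) := by
  ext d
  simp only [MvPolynomial.coeff_pderiv]
  by_cases h : i = j
  · rw [h]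
  · rw [add_right_comm d]
    simp [h, Ne.symm h]
    ring

theorem pderiv_mem_H {n i : ℕ} {f : Fock K} (hf : f ∈ H K (n + (i + 1))) : pderiv i f ∈ H K n :=
  MvPolynomial.IsWeightedHomogeneous.pderiv hf rfl

theorem pderiv_eq_zero {n i : ℕ} (hi : n < i + 1) {f : Fock K} (hf : f ∈ H K n) :
    pderiv i f = 0 := by
  rw [eq_sum_monomial hf, map_sum]
  refine Finset.sum_eq_zero fun lam _ => ?_
  rw [pderiv_smul, MvPolynomial.pderiv_monomial]
  have : ex lam i = 0 := by
    by_contra h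
    have h1 := weight_ex lam
    have h2 := Finsupp.le_weight wt (s := i) (by simp [wt]) (ex lam)
    have h3 := Finsupp.le_weight_of_ne_zero' wt h
    simp only [wt] at h3
    omega
  simp [this]

theorem X_mul_mem_H {n i : ℕ} {f : Fock K} (hf : f ∈ H K n) :
    MvPolynomial.X i * f ∈ H K (n + (i + 1)) := by
  rw [add_comm]
  exact (MvPolynomial.isWeightedHomogeneous_X K wt i).mul hf

/-- The Lax operator of Nazarov and Sklyanin, acting on polynomials in an auxiliary variable `w`
whose coefficient of `w ^ k` is the `k`-th term of a sequence; powers of `w` beyond `M` are cut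
off. -/
def lax (α : K) (M : ℕ) : (ℕ → Fock K) →ₗ[K] (ℕ → Fock K) where
  toFun F k := ((α - 1) * (k : K)) • F k +
    ∑ j ∈ Finset.range k, (α * ((k - j : ℕ) : K)) • pderiv (k - j - 1) (F j) +
    ∑ j ∈ Finset.Ioc k M, MvPolynomial.X (j - k - 1) * F j
  map_add' F G := by
    funext k
    simp only [Pi.add_apply, smul_add, map_add, mul_add, Finset.sum_add_distrib]
    abel
  map_smul' c F := by
    funext k
    simp only [Pi.smul_apply, RingHom.id_apply, smul_add, Finset.smul_sum, pderiv_smul,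
      mul_smul_comm, smul_comm c]

theorem lax_apply (α : K) (M : ℕ) (F : ℕ → Fock K) (k : ℕ) :
    lax α M F k = ((α - 1) * (k : K)) • F k +
      ∑ j ∈ Finset.range k, (α * ((k - j : ℕ) : K)) • pderiv (k - j - 1) (F j) +
      ∑ j ∈ Finset.Ioc k M, MvPolynomial.X (j - k - 1) * F j := rfl

/-- As a matrix in powers of `w`, the entries on one side of the diagonal are multiplications by
`p_k`, those on the other side are the adjoints `α k ∂/∂p_k`, and the diagonal is scalar. The cutoff
at `M` keeps the pairing finite and respects this symmetry. -/
theorem lax_selfAdjoint (α : K) (M : ℕ) (F G : ℕ → Fock K) :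
    ∑ k ∈ Finset.range (M + 1), form α (lax α M F k) (G k) =
      ∑ k ∈ Finset.range (M + 1), form α (F k) (lax α M G k) := by
  have swap : ∀ F G : ℕ → Fock K,
      ∑ k ∈ Finset.range (M + 1), ∑ j ∈ Finset.range k,
        form α ((α * ((k - j : ℕ) : K)) • pderiv (k - j - 1) (F j)) (G k) =
      ∑ k ∈ Finset.range (M + 1), ∑ j ∈ Finset.Ioc k M,
        form α (F k) (MvPolynomial.X (j - k - 1) * G j) := by
    intro F G
    rw [Finset.sum_comm' (s' := fun j => Finset.Ioc j M) (t' := Finset.range (M + 1))]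
    · refine Finset.sum_congr rfl fun j _ => Finset.sum_congr rfl fun k hk => ?_
      rw [form_symm α (F j), form_X_mul, form_symm]
      have := (Finset.mem_Ioc.1 hk).1
      rw [show k - j - 1 + 1 = k - j by omega]
    · intro k j
      simp only [Finset.mem_range, Finset.mem_Ioc]
      omega
  simp only [lax_apply, map_add, LinearMap.add_apply, map_sum, LinearMap.sum_apply,
    Finset.sum_add_distrib]
  rw [swap F G]
  have h2 := swap G F
  simp only [form_symm α _ (F _), form_symm α (G _)] at h2
  rw [h2]
  simp only [map_smul, LinearMap.smul_apply]
  ring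

/-- The operator `[w ^ 0] L ^ r`, where `L` is the Lax operator. -/
def nsOp (α : K) (M r : ℕ) : Fock K →ₗ[K] Fock K :=
  (LinearMap.proj 0).comp (((lax α M) ^ r).comp (LinearMap.single K (fun _ : ℕ => Fock K) 0))

theorem nsOp_apply (α : K) (M r : ℕ) (f : Fock K) :
    nsOp α M r f = (lax α M)^[r] (Pi.single 0 f) 0 := by
  simp [nsOp, Module.End.pow_apply]

theorem nsOp_selfAdjoint (α : K) (M r : ℕ) (f g : Fock K) :
    form α (nsOp α M r f) g = form α f (nsOp α M r g) := by
  have h : ∀ r (F G : ℕ → Fock K),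
      ∑ k ∈ Finset.range (M + 1), form α ((lax α M)^[r] F k) (G k) =
      ∑ k ∈ Finset.range (M + 1), form α (F k) ((lax α M)^[r] G k) := by
    intro r
    induction r with
    | zero => intros; rfl
    | succ r ih =>
      intro F G
      rw [Function.iterate_succ_apply, ih, lax_selfAdjoint, Function.iterate_succ_apply']
  have h1 := h r (Pi.single 0 f) (Pi.single 0 g)
  rw [Finset.sum_eq_single 0, Finset.sum_eq_single 0] at h1
  · simpa [nsOp_apply] using h1
  all_goals simp +contextual

/-- The sequences that represent polynomials in `w` which are homogeneous of degree `d`. -/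
def IsHomSeq (d : ℕ) (F : ℕ → Fock K) : Prop :=
  ∀ k, (k ≤ d → F k ∈ H K (d - k)) ∧ (d < k → F k = 0)

theorem IsHomSeq.single {d : ℕ} {f : Fock K} (hf : f ∈ H K d) : IsHomSeq d (Pi.single 0 f) := by
  intro k
  by_cases hk : k = 0
  · subst hk; simpa using hf
  · simp [hk]

theorem IsHomSeq.lax {d M : ℕ} {α : K} {F : ℕ → Fock K} (hF : IsHomSeq d F) :
    IsHomSeq d (lax α M F) := by
  intro k
  constructor
  · intro hk
    rw [lax_apply]
    refine Submodule.add_mem _ (Submodule.add_mem _ (Submodule.smul_mem _ _ ((hF k).1 hk)) ?_) ?_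
    · refine Submodule.sum_mem _ fun j hj => Submodule.smul_mem _ _ (pderiv_mem_H ?_)
      have hj := Finset.mem_range.1 hj
      rw [show d - k + (k - j - 1 + 1) = d - j by omega]
      exact (hF j).1 (by omega)
    · refine Submodule.sum_mem _ fun j hj => ?_
      have hj := Finset.mem_Ioc.1 hj
      by_cases hjd : j ≤ d
      · have := X_mul_mem_H (i := j - k - 1) ((hF j).1 hjd)
        rwa [show d - j + (j - k - 1 + 1) = d - k by omega] at this
      · rw [(hF j).2 (by omega), mul_zero]
        exact Submodule.zero_mem _
  · intro hk
    rw [lax_apply, (hF k).2 hk, smul_zero, zero_add, Finset.sum_eq_zero, Finset.sum_eq_zero,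
      add_zero]
    · intro j hj
      rw [(hF j).2 (by have := Finset.mem_Ioc.1 hj; omega), mul_zero]
    · intro j hj
      have hj := Finset.mem_range.1 hj
      by_cases hjd : j ≤ d
      · rw [pderiv_eq_zero _ ((hF j).1 hjd), smul_zero]
        omega
      · rw [(hF j).2 (by omega), map_zero, smul_zero]

theorem IsHomSeq.iterate {d M : ℕ} {α : K} {F : ℕ → Fock K} (hF : IsHomSeq d F)
    (r : ℕ) : IsHomSeq d ((JackLB.lax α M)^[r] F) := by
  induction r with
  | zero => exact hF
  | succ r ih =>
    rw [Function.iterate_succ_apply']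
    exact ih.lax

theorem nsOp_mem {d : ℕ} (α : K) (M r : ℕ) {f : Fock K} (hf : f ∈ H K d) :
    nsOp α M r f ∈ H K d := by
  rw [nsOp_apply]
  exact (((IsHomSeq.single hf).iterate r) 0).1 (Nat.zero_le d)

/-! ### Commutation with the derivative along `p_1` -/

/-- `∑ i, (i + 1) p_i ∂/∂p_(i+1)`, over `1 ≤ i < M`. -/
def lowerOp (M : ℕ) : Fock K →ₗ[K] Fock K :=
  ∑ j ∈ Finset.range (M - 1), ((j + 2 : ℕ) : K) •
    (LinearMap.mulLeft K (MvPolynomial.X j)).comp (pderiv (j + 1)).toLinearMap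

theorem lowerOp_apply (M : ℕ) (f : Fock K) :
    lowerOp M f = ∑ j ∈ Finset.range (M - 1), ((j + 2 : ℕ) : K) •
      (MvPolynomial.X j * pderiv (j + 1) f) := by
  simp [lowerOp, LinearMap.sum_apply]

theorem lax_single (α : K) (M : ℕ) (f : Fock K) (k : ℕ) :
    lax α M (Pi.single 0 f) (k + 1) = (α * ((k + 1 : ℕ) : K)) • pderiv k f := by
  rw [lax_apply, Finset.sum_eq_single 0, Finset.sum_eq_zero]
  · simp
  · intro j hj
    have : j ≠ 0 := by have := Finset.mem_Ioc.1 hj; omega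
    simp [this]
  · intro j _ hj
    simp [hj]
  · simp

theorem lax_single_zero (α : K) (M : ℕ) (f : Fock K) : lax α M (Pi.single 0 f) 0 = 0 := by
  rw [lax_apply, Finset.sum_eq_zero, Finset.sum_eq_zero]
  · simp
  · intro j hj
    have : j ≠ 0 := by have := Finset.mem_Ioc.1 hj; omega
    simp [this]
  · simp

/-- Only the entries `p_1` next to the diagonal depend on `p_1`, so the commutator is the shift of
the sequence by one place. -/
theorem pderiv_zero_lax (α : K) (M : ℕ) (F : ℕ → Fock K) (k : ℕ) :
    pderiv 0 (lax α M F k) =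
      lax α M (fun j => pderiv 0 (F j)) k + if k < M then F (k + 1) else 0 := by
  have h1 : ∀ j ∈ Finset.Ioc k M, pderiv 0 (MvPolynomial.X (j - k - 1) * F j) =
      MvPolynomial.X (j - k - 1) * pderiv 0 (F j) + if j = k + 1 then F (k + 1) else 0 := by
    intro j hj
    have := (Finset.mem_Ioc.1 hj).1
    rw [Derivation.leibniz, smul_eq_mul, smul_eq_mul]
    by_cases h : j = k + 1
    · subst h
      simp
    · rw [MvPolynomial.pderiv_X_of_ne (by omega : (j - k - 1) ≠ 0)]
      simp [h]
  rw [lax_apply, lax_apply, map_add, map_add, map_sum, map_sum, Finset.sum_congr rfl h1,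
    Finset.sum_add_distrib, Finset.sum_ite_eq', pderiv_smul]
  simp only [pderiv_smul, pderiv_comm 0, Finset.mem_Ioc]
  simp only [show (k < k + 1 ∧ k + 1 ≤ M) = (k < M) from propext (by omega)]
  abel

theorem lax_apply' (α : K) (M : ℕ) (F : ℕ → Fock K) (k : ℕ) :
    lax α M F k = ((α - 1) * (k : K)) • F k +
      ∑ j ∈ Finset.range k, (α * ((k - j : ℕ) : K)) • pderiv (k - j - 1) (F j) +
      ∑ j ∈ Finset.range (M - k), MvPolynomial.X j * F (k + j + 1) := by
  have h : Finset.Ioc k M = Finset.Ico (k + 1) (M + 1) := by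
    ext; simp only [Finset.mem_Ioc, Finset.mem_Ico]; omega
  rw [lax_apply, h, Finset.sum_Ico_eq_sum_range, show M + 1 - (k + 1) = M - k by omega]
  congr 1
  refine Finset.sum_congr rfl fun j _ => ?_
  rw [show k + 1 + j - k - 1 = j by omega, show k + 1 + j = k + j + 1 by omega]

/-- Moving `∂/∂p_1` through three factors produces one shift term `S` per factor. `S` kills the
initial sequence concentrated at `w^0`; the terms `L S L` and `S L L` each give `α • lowerOp`, and
the diagonal of `L` adds the multiple of `∂/∂p_1` in the latter. -/
theorem pderiv_zero_nsOp_three (α : K) {M : ℕ} (hM : 1 ≤ M) (f : Fock K) :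
    pderiv 0 (nsOp α M 3 f) =
      nsOp α M 3 (pderiv 0 f) + ((α - 1) * α) • pderiv 0 f + (2 * α) • lowerOp M f := by
  let S : (ℕ → Fock K) → ℕ → Fock K := fun F k => if k < M then F (k + 1) else 0
  let s : ℕ → Fock K := Pi.single 0 f
  have h : ∀ F : ℕ → Fock K, (fun j => pderiv 0 (lax α M F j)) =
      lax α M (fun j => pderiv 0 (F j)) + S F := fun F => funext fun k => pderiv_zero_lax α M F k
  have h0 : S s = 0 := by funext k; simp [S, s]
  have h1 : (fun j => pderiv 0 (s j)) = (Pi.single 0 (pderiv 0 f) : ℕ → Fock K) := by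
    funext k
    by_cases hk : k = 0
    · subst hk; simp [s]
    · simp [s, hk]
  have h2 : pderiv 0 (lax α M (lax α M (lax α M s)) 0) =
      lax α M (lax α M (lax α M (Pi.single 0 (pderiv 0 f)))) 0 +
        lax α M (S (lax α M s)) 0 + S (lax α M (lax α M s)) 0 := by
    have := congrFun (h (lax α M (lax α M s))) 0
    rw [h, h, h0, h1, add_zero, map_add] at this
    exact this
  have hlow : ∀ c : ℕ → Fock K, (∀ j, c j = (α * ((j + 2 : ℕ) : K)) • pderiv (j + 1) f) →
      ∑ j ∈ Finset.range (M - 1), MvPolynomial.X j * c j = α • lowerOp M f := by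
    intro c hc
    rw [lowerOp_apply, Finset.smul_sum]
    refine Finset.sum_congr rfl fun j _ => ?_
    rw [hc, mul_smul_comm, smul_smul]
  have h3 : lax α M (S (lax α M s)) 0 = α • lowerOp M f := by
    obtain ⟨m, rfl⟩ : ∃ m, M = m + 1 := ⟨M - 1, by omega⟩
    rw [lax_apply', ← hlow (fun j => lax α (m + 1) s (j + 2)) fun j => lax_single α _ f (j + 1)]
    rw [Nat.sub_zero, Finset.sum_range_succ]
    -- The shift is cut off at `M`, which is why `lowerOp` has `M - 1` summands.
    have : S (lax α (m + 1) s) (0 + m + 1) = 0 := by simp [S]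
    rw [this]
    simp only [Nat.cast_zero, mul_zero, zero_smul, Finset.range_zero, Finset.sum_empty,
      add_zero, zero_add, Nat.add_sub_cancel]
    refine Finset.sum_congr rfl fun j hj => ?_
    have := Finset.mem_range.1 hj
    simp [S, this]
  have h4 : S (lax α M (lax α M s)) 0 = ((α - 1) * α) • pderiv 0 f + α • lowerOp M f := by
    have : S (lax α M (lax α M s)) 0 = lax α M (lax α M s) 1 := by simp [S]; omega
    rw [this, lax_apply', ← hlow (fun j => lax α M s (1 + j + 1)) fun j => by
      rw [show 1 + j + 1 = (j + 1) + 1 by omega]; exact lax_single α _ f (j + 1)]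
    have e1 : lax α M s 1 = α • pderiv 0 f := by
      have := lax_single α M f 0
      simpa using this
    have e0 : lax α M s 0 = 0 := lax_single_zero α M f
    rw [e1, Finset.sum_range_one, e0, map_zero, smul_zero, add_zero, smul_smul, Nat.cast_one,
      mul_one]
  rw [nsOp_apply, nsOp_apply]
  change pderiv 0 (lax α M (lax α M (lax α M s)) 0) = _
  rw [h2, h3, h4]
  change _ = lax α M (lax α M (lax α M (Pi.single 0 (pderiv 0 f)))) 0 + _ + _
  module

/-- The action of `[w ^ 0] L ^ 3` on powers of `p_1`. -/
theorem nsOp_three_X_pow (α : K) {M n : ℕ} (hM : 2 ≤ M) :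
    nsOp α M 3 (MvPolynomial.X 0 ^ n) =
      ((α - 1) * α * (n : K)) • (MvPolynomial.X 0 ^ n) +
        (α ^ 2 * ((n * (n - 1) : ℕ) : K)) •
          (MvPolynomial.X 1 * MvPolynomial.X 0 ^ (n - 2) : Fock K) := by
  obtain ⟨m, rfl⟩ : ∃ m, M = m + 2 := ⟨M - 2, by omega⟩
  set f : Fock K := MvPolynomial.X 0 ^ n with hf
  set L := lax α (m + 2)
  set s : ℕ → Fock K := Pi.single 0 f
  have hd0 : pderiv 0 f = (n : K) • (MvPolynomial.X 0 ^ (n - 1) : Fock K) := by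
    rw [hf, MvPolynomial.pderiv_pow, MvPolynomial.pderiv_X_self, mul_one, MvPolynomial.smul_eq_C_mul,
      map_natCast]
  have hd1 : ∀ k, pderiv (k + 1) f = 0 := by
    intro k
    rw [hf, MvPolynomial.pderiv_pow, MvPolynomial.pderiv_X_of_ne (by omega), mul_zero]
  have a0 : L s 0 = 0 := lax_single_zero α _ f
  have a1 : L s 1 = (α * (n : K)) • (MvPolynomial.X 0 ^ (n - 1) : Fock K) := by
    have := lax_single α (m + 2) f 0
    rw [hd0, smul_smul] at this
    simpa using this
  have a2 : ∀ k, L s (k + 2) = 0 := by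
    intro k
    have := lax_single α (m + 2) f (k + 1)
    rw [hd1, smul_zero] at this
    exact this
  -- The row `w^0` of `L` has no diagonal part and only multiplies the component at `w^k` by `p_k`,
  -- so `L (L s)` is needed only in positive degrees. Since `f` depends on `p_1` alone, these are
  -- the components at `w` and `w^2`.
  have b1 : L (L s) 1 = ((α - 1) * (α * (n : K))) • (MvPolynomial.X 0 ^ (n - 1) : Fock K) := by
    rw [lax_apply', a1, Finset.sum_range_one, a0, Finset.sum_eq_zero]
    · simp [smul_smul]
    · intro j _
      rw [show 1 + j + 1 = j + 2 by omega, a2, mul_zero]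
  have b2 : L (L s) 2 = (α ^ 2 * ((n * (n - 1) : ℕ) : K)) •
      (MvPolynomial.X 0 ^ (n - 2) : Fock K) := by
    rw [lax_apply', a2 0, Finset.sum_range_succ, Finset.sum_range_one, a0, a1, Finset.sum_eq_zero]
    · rw [smul_zero, map_zero, smul_zero, pderiv_smul, show 2 - 1 - 1 = 0 from rfl,
        MvPolynomial.pderiv_pow, MvPolynomial.pderiv_X_self, mul_one, ← map_natCast MvPolynomial.C,
        ← MvPolynomial.smul_eq_C_mul, smul_smul, smul_smul, zero_add, zero_add, add_zero,
        Nat.sub_sub]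
      congr 1
      push_cast
      ring
    · intro j _
      rw [show 2 + j + 1 = (j + 1) + 2 by omega, a2, mul_zero]
  have b3 : ∀ k, L (L s) (k + 3) = 0 := by
    intro k
    rw [lax_apply', show k + 3 = (k + 1) + 2 by omega, a2, Finset.sum_eq_zero, Finset.sum_eq_zero]
    · simp
    · intro j _
      rw [show k + 1 + 2 + j + 1 = (k + j + 2) + 2 by omega, a2, mul_zero]
    · intro j _
      rcases j with _ | _ | j
      · rw [a0, map_zero, smul_zero]
      · rw [a1, pderiv_smul, show k + 1 + 2 - (0 + 1) - 1 = k + 1 by omega,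
          MvPolynomial.pderiv_pow, MvPolynomial.pderiv_X_of_ne (by omega), mul_zero, smul_zero,
          smul_zero]
      · rw [show j + 1 + 1 = j + 2 from rfl, a2, map_zero, smul_zero]
  rw [nsOp_apply]
  change L (L (L s)) 0 = _
  have b4 : ∑ j ∈ Finset.range m, MvPolynomial.X (j + 1 + 1) * L (L s) (0 + (j + 1 + 1) + 1) = 0 :=
    Finset.sum_eq_zero fun j _ => by
      rw [show 0 + (j + 1 + 1) + 1 = j + 3 by omega, b3, mul_zero]
  rw [lax_apply', Nat.sub_zero, Finset.sum_range_succ', Finset.sum_range_succ', b4,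
    show 0 + 0 + 1 = 1 from rfl, show 0 + (0 + 1) + 1 = 2 from rfl, b1, b2]
  simp only [Nat.cast_zero, mul_zero, zero_smul, Finset.range_zero, Finset.sum_empty,
    zero_add, mul_smul_comm]
  rw [add_comm]
  congr 1
  rcases n with _ | n
  · simp
  · rw [hf, Nat.add_sub_cancel, ← pow_succ', mul_assoc]

end JackLB
end

/-! ### Divided differences and the Dunkl realization of the Lax operator -/

noncomputable section

namespace JackLB

variable {K : Type*} [Field K]

/-! ### Divided differences -/

/-- Replace the exponents of `x_i` and `x_j` by `a` and `b`. -/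
def put (η : ℕ →₀ ℕ) (i j a b : ℕ) : ℕ →₀ ℕ := (η.update i a).update j b

theorem put_apply (η : ℕ →₀ ℕ) (i j a b l : ℕ) :
    put η i j a b l = if l = j then b else if l = i then a else η l := by
  classical
  simp [put, Finsupp.update_apply]

theorem put_self (η : ℕ →₀ ℕ) (i j : ℕ) : put η i j (η i) (η j) = η := by
  ext l
  rw [put_apply]
  split_ifs with h h' <;> simp_all

theorem put_put (η : ℕ →₀ ℕ) {i j : ℕ} (a b c d : ℕ) :
    put (put η i j a b) i j c d = put η i j c d := by
  ext l
  simp only [put_apply]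
  split_ifs <;> rfl

theorem put_comm (η : ℕ →₀ ℕ) {i j : ℕ} (hij : i ≠ j) (a b : ℕ) :
    put η i j a b = put η j i b a := by
  ext l
  simp only [put_apply]
  split_ifs with h1 h2 <;> simp_all

theorem put_sub_single_left (η : ℕ →₀ ℕ) (i j a b k : ℕ) :
    put (η - Finsupp.single i k) i j a b = put η i j a b := by
  classical
  ext l
  simp only [put_apply, Finsupp.tsub_apply, Finsupp.single_apply]
  split_ifs with h1 h2 h3 <;> simp_all

theorem put_sub_single_right (η : ℕ →₀ ℕ) (i j a b k : ℕ) :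
    put (η - Finsupp.single j k) i j a b = put η i j a b := by
  classical
  ext l
  simp only [put_apply, Finsupp.tsub_apply, Finsupp.single_apply]
  split_ifs with h1 h2 h3 <;> simp_all

theorem embDomain_swap (η : ℕ →₀ ℕ) {i j : ℕ} (hij : i ≠ j) :
    Finsupp.embDomain (Equiv.swap i j).toEmbedding η = put η i j (η j) (η i) := by
  ext l
  obtain ⟨m, rfl⟩ := (Equiv.swap i j).surjective l
  have := Finsupp.embDomain_apply_self (Equiv.swap i j).toEmbedding η m
  rw [Equiv.coe_toEmbedding] at this
  rw [this, put_apply]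
  by_cases h1 : m = i
  · subst h1; simp
  · by_cases h2 : m = j
    · subst h2; simp [hij]
    · simp [Equiv.swap_apply_of_ne_of_ne h1 h2, h1, h2]

/-- Exchange of the variables `x_i` and `x_j`. -/
def swp (K : Type*) [Field K] (i j : ℕ) : MvPowerSeries ℕ K →ₐ[K] MvPowerSeries ℕ K :=
  MvPowerSeries.killCompl (Equiv.swap i j).toEmbedding

theorem coeff_swp {i j : ℕ} (hij : i ≠ j) (F : MvPowerSeries ℕ K) (η : ℕ →₀ ℕ) :
    MvPowerSeries.coeff η (swp K i j F) = MvPowerSeries.coeff (put η i j (η j) (η i)) F := by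
  rw [swp, MvPowerSeries.coeff_killCompl, embDomain_swap η hij]

theorem swp_toSym (i j : ℕ) (f : Fock K) : swp K i j (toSym f) = toSym f := killCompl_toSym _ f

theorem co_put_swap {i j : ℕ} (hij : i ≠ j) (η : ℕ →₀ ℕ) (a b : ℕ) (f : Fock K) :
    co (put η i j a b) f = co (put η i j b a) f := by
  have := coeff_swp hij (toSym f) (put η i j a b)
  rw [swp_toSym, put_put] at this
  simpa [put_apply, hij, co_apply] using this

/-- The quotient of `g` by `x_i - x_j`, for a power series `g` that is antisymmetric in `x_i` and
`x_j`. -/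
def ddiv (i j : ℕ) (g : MvPowerSeries ℕ K) : MvPowerSeries ℕ K := fun η =>
  ∑ r ∈ Finset.range (η j + 1), MvPowerSeries.coeff (put η i j (η i + 1 + r) (η j - r)) g

theorem coeff_ddiv (i j : ℕ) (g : MvPowerSeries ℕ K) (η : ℕ →₀ ℕ) :
    MvPowerSeries.coeff η (ddiv i j g) =
      ∑ r ∈ Finset.range (η j + 1), MvPowerSeries.coeff (put η i j (η i + 1 + r) (η j - r)) g := rfl

theorem coeff_X_mul' (η : ℕ →₀ ℕ) (j : ℕ) (G : MvPowerSeries ℕ K) :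
    MvPowerSeries.coeff η (MvPowerSeries.X j * G) =
      if 1 ≤ η j then MvPowerSeries.coeff (η - Finsupp.single j 1) G else 0 := by
  have := coeff_X_pow_mul η j 1 G
  rwa [pow_one] at this

/-- `ddiv` is `g / (x_i - x_j)` expanded geometrically in `x_j / x_i`, with negative exponents of
`x_i` dropped. Multiplying back by `x_i - x_j` telescopes; antisymmetry is needed only at exponents
with `η i = 0`, where the dropped terms would enter. -/
theorem mul_ddiv [CharZero K] {i j : ℕ} (hij : i ≠ j) {g : MvPowerSeries ℕ K} (hg : swp K i j g = -g) :
    (MvPowerSeries.X i - MvPowerSeries.X j) * ddiv i j g = g := by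
  have hg' : ∀ η a b, MvPowerSeries.coeff (put η i j a b) g =
      -MvPowerSeries.coeff (put η i j b a) g := by
    intro η a b
    have := coeff_swp hij g (put η i j b a)
    rw [hg, put_put] at this
    simp only [put_apply, hij, if_true, if_false, map_neg] at this
    exact this.symm
  ext η
  rw [sub_mul, map_sub, coeff_X_mul', coeff_X_mul', coeff_ddiv, coeff_ddiv]
  simp only [put_sub_single_left, put_sub_single_right]
  have e1 : (η - Finsupp.single i 1 : ℕ →₀ ℕ) j = η j := by simp [Finsupp.single_eq_of_ne' hij]
  have e2 : (η - Finsupp.single i 1 : ℕ →₀ ℕ) i = η i - 1 := by simp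
  have e3 : (η - Finsupp.single j 1 : ℕ →₀ ℕ) i = η i := by simp [Finsupp.single_eq_of_ne hij]
  have e4 : (η - Finsupp.single j 1 : ℕ →₀ ℕ) j = η j - 1 := by simp
  rw [e1, e2, e3, e4]
  set s := η i
  set t := η j
  set u : ℕ → ℕ → K := fun a b => MvPowerSeries.coeff (put η i j a b) g with hu
  have h0 : MvPowerSeries.coeff η g = u s t := by rw [hu]; simp only; rw [put_self]
  have hanti : ∀ a b, u a b = -u b a := fun a b => hg' η a b
  have hB : (if 1 ≤ t then ∑ r ∈ Finset.range (t - 1 + 1), u (s + 1 + r) (t - 1 - r) else 0) =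
      ∑ r ∈ Finset.range t, u (s + (r + 1)) (t - (r + 1)) := by
    split_ifs with ht
    · rw [show t - 1 + 1 = t by omega]
      refine Finset.sum_congr rfl fun r _ => ?_
      rw [show s + 1 + r = s + (r + 1) by omega, show t - 1 - r = t - (r + 1) by omega]
    · rw [show t = 0 by omega]; simp
  have hsucc := Finset.sum_range_succ' (fun r => u (s + r) (t - r)) t
  change (if 1 ≤ s then ∑ r ∈ Finset.range (t + 1), u (s - 1 + 1 + r) (t - r) else 0) -
    (if 1 ≤ t then ∑ r ∈ Finset.range (t - 1 + 1), u (s + 1 + r) (t - 1 - r) else 0) = _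
  rw [hB, h0]
  by_cases hs : 1 ≤ s
  · rw [if_pos hs, show s - 1 + 1 = s by omega, hsucc]
    simp
  · rw [if_neg hs]
    have hs0 : s = 0 := by omega
    -- With `s = 0` the sum runs over a full antidiagonal, which reflection maps to its negative.
    have hz : ∑ r ∈ Finset.range (t + 1), u (s + r) (t - r) = 0 := by
      have h1 := Finset.sum_range_reflect (fun r => u (s + r) (t - r)) (t + 1)
      have h2 : ∑ r ∈ Finset.range (t + 1), u (s + (t + 1 - 1 - r)) (t - (t + 1 - 1 - r)) =
          -∑ r ∈ Finset.range (t + 1), u (s + r) (t - r) := by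
        rw [← Finset.sum_neg_distrib]
        refine Finset.sum_congr rfl fun r hr => ?_
        have := Finset.mem_range.1 hr
        rw [hanti, hs0, show t - (t + 1 - 1 - r) = 0 + r by omega,
          show 0 + (t + 1 - 1 - r) = t - r by omega]
      rw [h2] at h1
      exact self_eq_neg.1 h1.symm
    rw [hsucc, add_zero, Nat.sub_zero] at hz
    rw [zero_sub]
    exact neg_eq_of_add_eq_zero_right hz

theorem X_sub_X_ne_zero {i j : ℕ} (hij : i ≠ j) :
    (MvPowerSeries.X i - MvPowerSeries.X j : MvPowerSeries ℕ K) ≠ 0 := by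
  classical
  intro h
  have := congrArg (MvPowerSeries.coeff (Finsupp.single i 1)) h
  rw [map_sub, MvPowerSeries.coeff_X, MvPowerSeries.coeff_X] at this
  simp [Finsupp.single_left_inj, hij] at this

theorem swp_X_left (i j : ℕ) : swp K i j (MvPowerSeries.X i) = MvPowerSeries.X j := by
  have := MvPowerSeries.killCompl_X (R := K) (e := (Equiv.swap i j).toEmbedding) j
  simpa [swp] using this

theorem swp_swp {i j : ℕ} (hij : i ≠ j) (F : MvPowerSeries ℕ K) : swp K i j (swp K i j F) = F := by
  ext η
  rw [coeff_swp hij, coeff_swp hij, put_put]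
  simp [put_apply, hij, put_self]

/-! ### The operators `x_j (1 - s) / (x_0 - x_j)` -/

/-- `x_j (F - s F) / (x_0 - x_j)`, where `s` exchanges `x_0` and `x_j`. -/
def exch (j : ℕ) (F : MvPowerSeries ℕ K) : MvPowerSeries ℕ K :=
  MvPowerSeries.X j * ddiv 0 j (F - swp K 0 j F)

theorem mul_exch [CharZero K] {j : ℕ} (hj : j ≠ 0) (F : MvPowerSeries ℕ K) :
    (MvPowerSeries.X 0 - MvPowerSeries.X j) * exch j F =
      MvPowerSeries.X j * (F - swp K 0 j F) := by
  rw [exch, mul_left_comm, mul_ddiv hj.symm]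
  rw [map_sub, swp_swp hj.symm, neg_sub]

theorem exch_mul [CharZero K] {j : ℕ} (hj : j ≠ 0) {G : MvPowerSeries ℕ K} (hG : swp K 0 j G = G)
    (F : MvPowerSeries ℕ K) : exch j (F * G) = exch j F * G := by
  apply mul_left_cancel₀ (X_sub_X_ne_zero (K := K) hj.symm)
  rw [mul_exch hj, ← mul_assoc, mul_exch hj, map_mul, hG]
  ring

theorem exch_X_pow [CharZero K] {j : ℕ} (hj : j ≠ 0) (k : ℕ) :
    exch j (MvPowerSeries.X 0 ^ k : MvPowerSeries ℕ K) =
      ∑ a ∈ Finset.range k, MvPowerSeries.X j ^ (k - a) * MvPowerSeries.X 0 ^ a := by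
  apply mul_left_cancel₀ (X_sub_X_ne_zero (K := K) hj.symm)
  have h := geom_sum₂_mul (MvPowerSeries.X 0 : MvPowerSeries ℕ K) (MvPowerSeries.X j) k
  rw [mul_exch hj, map_pow, swp_X_left, ← h, mul_comm _ (_ - _), mul_left_comm]
  congr 1
  rw [Finset.mul_sum]
  refine Finset.sum_congr rfl fun a ha => ?_
  have := Finset.mem_range.1 ha
  rw [show k - a = k - 1 - a + 1 by omega, pow_succ]
  ring

theorem coeff_exch {j : ℕ} (hj : j ≠ 0) (F : MvPowerSeries ℕ K) (η : ℕ →₀ ℕ) :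
    MvPowerSeries.coeff η (exch j F) = ∑ b ∈ Finset.range (η j),
      (MvPowerSeries.coeff (put η 0 j (η 0 + η j - b) b) F -
        MvPowerSeries.coeff (put η 0 j b (η 0 + η j - b)) F) := by
  rw [exch, coeff_X_mul']
  by_cases h : 1 ≤ η j
  · rw [if_pos h, coeff_ddiv]
    simp only [put_sub_single_right]
    have e3 : (η - Finsupp.single j 1 : ℕ →₀ ℕ) 0 = η 0 := by simp [Finsupp.single_eq_of_ne hj.symm]
    have e4 : (η - Finsupp.single j 1 : ℕ →₀ ℕ) j = η j - 1 := by simp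
    rw [e3, e4, show η j - 1 + 1 = η j by omega, ← Finset.sum_range_reflect]
    refine Finset.sum_congr rfl fun b hb => ?_
    have := Finset.mem_range.1 hb
    rw [map_sub, coeff_swp hj.symm, put_put,
      show η 0 + 1 + (η j - 1 - b) = η 0 + η j - b by omega,
      show η j - 1 - (η j - 1 - b) = b by omega]
    simp [put_apply, hj.symm]
  · rw [if_neg h, show η j = 0 by omega]; simp

theorem exch_zero_of_swp {j : ℕ} (F : MvPowerSeries ℕ K) (h : swp K 0 j F = F) : exch j F = 0 := by
  ext η
  rw [exch, h, sub_self, coeff_X_mul']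
  simp [coeff_ddiv]

theorem exch_add (j : ℕ) (F G : MvPowerSeries ℕ K) : exch j (F + G) = exch j F + exch j G := by
  have h : ∀ F G : MvPowerSeries ℕ K, ddiv 0 j (F + G) = ddiv 0 j F + ddiv 0 j G := by
    intro F G
    ext η
    simp [coeff_ddiv, Finset.sum_add_distrib]
  rw [exch, exch, exch, ← mul_add, ← h, map_add]
  congr 2
  ring

theorem exch_smul (j : ℕ) (c : K) (F : MvPowerSeries ℕ K) : exch j (c • F) = c • exch j F := by
  have h : ∀ F : MvPowerSeries ℕ K, ddiv 0 j (c • F) = c • ddiv 0 j F := by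
    intro F
    ext η
    simp [coeff_ddiv, Finset.mul_sum]
  rw [exch, exch, map_smul, ← smul_sub, h, mul_smul_comm]

/-- The Dunkl type operator `α x_0 ∂_0 + ∑_j x_j (1 - s_(0 j)) / (x_0 - x_j)`. -/
def dunkl (α : K) : MvPowerSeries ℕ K →ₗ[K] MvPowerSeries ℕ K where
  toFun F := fun η => α * (η 0 : K) * MvPowerSeries.coeff η F +
    ∑ j ∈ η.support.erase 0, MvPowerSeries.coeff η (exch j F)
  map_add' F G := by
    ext η
    change α * (η 0 : K) * MvPowerSeries.coeff η (F + G) +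
      ∑ j ∈ η.support.erase 0, MvPowerSeries.coeff η (exch j (F + G)) =
      (α * (η 0 : K) * MvPowerSeries.coeff η F +
        ∑ j ∈ η.support.erase 0, MvPowerSeries.coeff η (exch j F)) +
      (α * (η 0 : K) * MvPowerSeries.coeff η G +
        ∑ j ∈ η.support.erase 0, MvPowerSeries.coeff η (exch j G))
    simp only [exch_add, map_add, Finset.sum_add_distrib]
    ring
  map_smul' c F := by
    ext η
    change α * (η 0 : K) * MvPowerSeries.coeff η (c • F) +
      ∑ j ∈ η.support.erase 0, MvPowerSeries.coeff η (exch j (c • F)) =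
      c * (α * (η 0 : K) * MvPowerSeries.coeff η F +
        ∑ j ∈ η.support.erase 0, MvPowerSeries.coeff η (exch j F))
    simp only [exch_smul, map_smul, smul_eq_mul, ← Finset.mul_sum]
    ring

theorem coeff_dunkl (α : K) (F : MvPowerSeries ℕ K) (η : ℕ →₀ ℕ) :
    MvPowerSeries.coeff η (dunkl α F) = α * (η 0 : K) * MvPowerSeries.coeff η F +
      ∑ j ∈ η.support.erase 0, MvPowerSeries.coeff η (exch j F) := rfl

/-! ### Comparison with the Lax operator -/

theorem pderiv_zero_psum (i : ℕ) : MvPowerSeries.pderiv K 0 (psum K (i + 1)) =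
    ((i + 1 : ℕ) : K) • (MvPowerSeries.X 0 ^ i : MvPowerSeries ℕ K) := by
  classical
  ext η
  rw [MvPowerSeries.coeff_pderiv, coeff_psum, map_smul, MvPowerSeries.coeff_X_pow]
  by_cases h : η = Finsupp.single 0 i
  · subst h
    rw [if_pos ⟨0, by rw [← Finsupp.single_add]⟩]
    simp
  · rw [if_neg h, if_neg]
    · simp
    · rintro ⟨l, hl⟩
      apply h
      have h0 := DFunLike.congr_fun hl 0
      by_cases hl0 : l = 0
      · subst hl0
        rw [Finsupp.single_add] at hl
        exact add_right_cancel hl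
      · simp [Finsupp.single_eq_of_ne (Ne.symm hl0)] at h0

/-- Chain rule, with `∂p_(i+1)/∂x_0 = (i + 1) x_0 ^ i`. A polynomial involves only finitely many
power sums, whence the threshold `m0`; for homogeneous `f` the degree will do. -/
theorem X_mul_pderiv_toSym_aux (f : Fock K) : ∃ m0, ∀ m ≥ m0,
    MvPowerSeries.X 0 * MvPowerSeries.pderiv K 0 (toSym f) =
      ∑ i ∈ Finset.range m, ((i + 1 : ℕ) : K) •
        (MvPowerSeries.X 0 ^ (i + 1) * toSym (MvPolynomial.pderiv i f)) := by
  induction f using MvPolynomial.induction_on with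
  | C a =>
    refine ⟨0, fun m _ => ?_⟩
    have : toSym (MvPolynomial.C a : Fock K) = algebraMap K _ a := by
      rw [← MvPolynomial.algebraMap_eq, AlgHom.commutes]
    rw [this, Derivation.map_algebraMap, mul_zero, Finset.sum_eq_zero]
    intro i _
    rw [MvPolynomial.pderiv_C, map_zero, mul_zero, smul_zero]
  | add f g hf hg =>
    obtain ⟨a, ha⟩ := hf
    obtain ⟨b, hb⟩ := hg
    refine ⟨max a b, fun m hm => ?_⟩
    simp only [map_add, mul_add, smul_add, Finset.sum_add_distrib]
    rw [ha m (le_trans (le_max_left _ _) hm), hb m (le_trans (le_max_right _ _) hm)]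
  | mul_X f j hf =>
    obtain ⟨a, ha⟩ := hf
    refine ⟨max a (j + 1), fun m hm => ?_⟩
    have h1 : ∀ i ∈ Finset.range m, ((i + 1 : ℕ) : K) •
        (MvPowerSeries.X 0 ^ (i + 1) * toSym (MvPolynomial.pderiv i (f * MvPolynomial.X j))) =
        (if i = j then ((i + 1 : ℕ) : K) • (MvPowerSeries.X 0 ^ (i + 1) * toSym f) else 0) +
          psum K (j + 1) * (((i + 1 : ℕ) : K) •
            (MvPowerSeries.X 0 ^ (i + 1) * toSym (MvPolynomial.pderiv i f))) := by
      intro i _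
      rw [Derivation.leibniz, smul_eq_mul, smul_eq_mul, map_add, map_mul, map_mul, toSym_X,
        MvPolynomial.pderiv_X, Pi.single_apply, mul_add, smul_add]
      congr 1
      · by_cases h : i = j
        · subst h; simp
        · simp [h, Ne.symm h]
      · rw [mul_left_comm, mul_smul_comm]
    rw [Finset.sum_congr rfl h1, Finset.sum_add_distrib, ← Finset.mul_sum,
      ← ha m (le_trans (le_max_left _ _) hm), Finset.sum_ite_eq', if_pos, map_mul, toSym_X,
      Derivation.leibniz, pderiv_zero_psum, smul_eq_mul, smul_eq_mul, mul_add, pow_succ]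
    · congr 1
      · rw [mul_smul_comm, mul_smul_comm]
        congr 1
        ring
      · ring
    · rw [Finset.mem_range]
      exact lt_of_lt_of_le (Nat.lt_succ_self j) (le_trans (le_max_right _ _) hm)

theorem X_mul_pderiv_toSym {d m : ℕ} (hm : d ≤ m) {f : Fock K} (hf : f ∈ H K d) :
    MvPowerSeries.X 0 * MvPowerSeries.pderiv K 0 (toSym f) =
      ∑ i ∈ Finset.range m, ((i + 1 : ℕ) : K) •
        (MvPowerSeries.X 0 ^ (i + 1) * toSym (MvPolynomial.pderiv i f)) := by
  obtain ⟨a, ha⟩ := X_mul_pderiv_toSym_aux f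
  rw [ha (max a m) (le_max_left _ _)]
  symm
  refine Finset.sum_subset ?_ ?_
  · intro i hi
    rw [Finset.mem_range] at hi ⊢
    exact lt_of_lt_of_le hi (le_max_right _ _)
  · intro i _ hi
    rw [Finset.mem_range] at hi
    rw [pderiv_eq_zero (by omega) hf, map_zero, mul_zero, smul_zero]

theorem coeff_X_mul_pderiv (η : ℕ →₀ ℕ) (F : MvPowerSeries ℕ K) :
    MvPowerSeries.coeff η (MvPowerSeries.X 0 * MvPowerSeries.pderiv K 0 F) =
      (η 0 : K) * MvPowerSeries.coeff η F := by
  rw [coeff_X_mul']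
  split_ifs with h
  · rw [MvPowerSeries.coeff_pderiv, tsub_add_cancel_of_le (by simpa [Finsupp.single_le_iff] using h)]
    have : (η - Finsupp.single 0 1 : ℕ →₀ ℕ) 0 = η 0 - 1 := by simp
    rw [this, Nat.cast_sub h]
    push_cast
    ring
  · rw [show η 0 = 0 by omega]; simp

/-- The symmetric factor passes through the exchange terms, which send `x_0 ^ k` to `∑_(a<k) x_j ^
(k-a) x_0 ^ a`. Summing over `j ≠ 0` gives `p_(k-a) - x_0 ^ (k-a)` in front of `x_0 ^ a`; the `k`
subtracted copies of `x_0 ^ k` change the factor `α k` of the Euler part into `(α - 1) k`. -/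
theorem dunkl_X_pow_mul [CharZero K] (α : K) {d m : ℕ} (hm : d ≤ m) {f : Fock K} (hf : f ∈ H K d) (k : ℕ) :
    dunkl α (MvPowerSeries.X 0 ^ k * toSym f) =
      ((α - 1) * (k : K)) • (MvPowerSeries.X 0 ^ k * toSym f) +
      ∑ i ∈ Finset.range m, (α * ((i + 1 : ℕ) : K)) •
        (MvPowerSeries.X 0 ^ (k + i + 1) * toSym (MvPolynomial.pderiv i f)) +
      ∑ a ∈ Finset.range k, MvPowerSeries.X 0 ^ a * toSym (MvPolynomial.X (k - a - 1) * f) := by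
  classical
  have h1 : ∀ η : ℕ →₀ ℕ, (η 0 : K) * MvPowerSeries.coeff η (MvPowerSeries.X 0 ^ k * toSym f) =
      (k : K) * MvPowerSeries.coeff η (MvPowerSeries.X 0 ^ k * toSym f) +
      MvPowerSeries.coeff η (∑ i ∈ Finset.range m, ((i + 1 : ℕ) : K) •
        (MvPowerSeries.X 0 ^ (k + i + 1) * toSym (MvPolynomial.pderiv i f))) := by
    intro η
    rw [← coeff_X_mul_pderiv, Derivation.leibniz, smul_eq_mul, smul_eq_mul, mul_add, add_comm,
      map_add]
    congr 1
    · have : (MvPowerSeries.X 0 * (toSym f * MvPowerSeries.pderiv K 0 (MvPowerSeries.X 0 ^ k)) :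
          MvPowerSeries ℕ K) = (k : K) • (MvPowerSeries.X 0 ^ k * toSym f) := by
        rw [MvPowerSeries.pderiv_pow, MvPowerSeries.pderiv_X_self, mul_one]
        rcases k with _ | k
        · simp
        · rw [Nat.add_sub_cancel, ← map_natCast (algebraMap K (MvPowerSeries ℕ K)),
            Algebra.smul_def]
          ring
      rw [this, map_smul, smul_eq_mul]
    · rw [mul_left_comm, X_mul_pderiv_toSym hm hf, Finset.mul_sum]
      congr 1
      refine Finset.sum_congr rfl fun i _ => ?_
      rw [mul_smul_comm, ← mul_assoc, ← pow_add, add_assoc]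
  have h2 : ∀ η : ℕ →₀ ℕ, ∑ j ∈ η.support.erase 0,
      MvPowerSeries.coeff η (exch j (MvPowerSeries.X 0 ^ k * toSym f)) =
      MvPowerSeries.coeff η (∑ a ∈ Finset.range k,
        MvPowerSeries.X 0 ^ a * toSym (MvPolynomial.X (k - a - 1) * f)) -
      (k : K) * MvPowerSeries.coeff η (MvPowerSeries.X 0 ^ k * toSym f) := by
    intro η
    have h3 : ∀ a ∈ Finset.range k, MvPowerSeries.coeff η
        (MvPowerSeries.X 0 ^ a * toSym (MvPolynomial.X (k - a - 1) * f)) =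
        MvPowerSeries.coeff η (MvPowerSeries.X 0 ^ k * toSym f) + ∑ j ∈ η.support.erase 0,
        MvPowerSeries.coeff η (MvPowerSeries.X j ^ (k - a) * MvPowerSeries.X 0 ^ a * toSym f) := by
      intro a ha
      have ha := Finset.mem_range.1 ha
      have h4 : η.support ⊆ insert 0 (η.support.erase 0) := by
        intro i hi
        by_cases h : i = 0
        · simp [h]
        · simp only [Finset.mem_insert, Finset.mem_erase]
          exact Or.inr ⟨h, hi⟩
      rw [map_mul toSym, toSym_X, mul_left_comm, show k - a - 1 + 1 = k - a by omega,
        coeff_psum_mul η _ h4 (by omega), Finset.sum_insert (by simp)]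
      simp only [← mul_assoc]
      rw [← pow_add, show k - a + a = k by omega]
    rw [map_sum, Finset.sum_congr rfl h3, Finset.sum_add_distrib, Finset.sum_const,
      Finset.card_range, nsmul_eq_mul, add_sub_cancel_left, Finset.sum_comm]
    refine Finset.sum_congr rfl fun j hj => ?_
    have hj := (Finset.mem_erase.1 hj).1
    rw [exch_mul hj (swp_toSym 0 j f), exch_X_pow hj, Finset.sum_mul, map_sum]
  ext η
  rw [coeff_dunkl, mul_assoc, h1, h2, map_add, map_add, map_smul, smul_eq_mul]
  have h5 : ∑ i ∈ Finset.range m, (α * ((i + 1 : ℕ) : K)) •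
        (MvPowerSeries.X 0 ^ (k + i + 1) * toSym (MvPolynomial.pderiv i f)) =
      α • ∑ i ∈ Finset.range m, ((i + 1 : ℕ) : K) •
        (MvPowerSeries.X 0 ^ (k + i + 1) * toSym (MvPolynomial.pderiv i f)) := by
    rw [Finset.smul_sum]
    exact Finset.sum_congr rfl fun i _ => mul_smul _ _ _
  rw [h5, map_smul, smul_eq_mul]
  ring

/-- The power series `∑ k, x_0 ^ k F_k`. -/
def theta (M : ℕ) (F : ℕ → Fock K) : MvPowerSeries ℕ K :=
  ∑ k ∈ Finset.range (M + 1), MvPowerSeries.X 0 ^ k * toSym (F k)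

/-- Collecting powers of `x_0` in `dunkl_X_pow_mul` reproduces the matrix of the Lax operator, with
`x_0` in the role of `w`. Homogeneity of degree `d ≤ M` ensures that the cutoff discards nothing. -/
theorem dunkl_theta [CharZero K] (α : K) {d M : ℕ} (hd : d ≤ M) {F : ℕ → Fock K} (hF : IsHomSeq d F) :
    dunkl α (theta M F) = theta M (lax α M F) := by
  have h1 : ∀ k ∈ Finset.range (M + 1), dunkl α (MvPowerSeries.X 0 ^ k * toSym (F k)) =
      ((α - 1) * (k : K)) • (MvPowerSeries.X 0 ^ k * toSym (F k)) +
      ∑ j ∈ Finset.Ioc k M, (α * ((j - k : ℕ) : K)) •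
        (MvPowerSeries.X 0 ^ j * toSym (MvPolynomial.pderiv (j - k - 1) (F k))) +
      ∑ a ∈ Finset.range k, MvPowerSeries.X 0 ^ a * toSym (MvPolynomial.X (k - a - 1) * F k) := by
    intro k hk
    have hk := Finset.mem_range.1 hk
    have h2 : ∃ e, e ≤ M - k ∧ F k ∈ H K e := by
      by_cases hkd : k ≤ d
      · exact ⟨d - k, by omega, (hF k).1 hkd⟩
      · refine ⟨0, by omega, ?_⟩
        rw [(hF k).2 (by omega)]
        exact Submodule.zero_mem _
    obtain ⟨e, he, hFe⟩ := h2
    rw [dunkl_X_pow_mul α he hFe]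
    congr 2
    have h : Finset.Ioc k M = Finset.Ico (k + 1) (M + 1) := by
      ext; simp only [Finset.mem_Ioc, Finset.mem_Ico]; omega
    rw [h, Finset.sum_Ico_eq_sum_range, show M + 1 - (k + 1) = M - k by omega]
    refine Finset.sum_congr rfl fun j _ => ?_
    rw [show k + 1 + j - k = j + 1 by omega, show k + 1 + j = k + j + 1 by omega,
      Nat.add_sub_cancel]
  rw [theta, theta, map_sum, Finset.sum_congr rfl h1]
  simp only [lax_apply, map_add, mul_add, map_sum, map_smul, mul_smul_comm, Finset.mul_sum,
    Finset.sum_add_distrib]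
  congr 1
  · congr 1
    refine Finset.sum_comm' fun k j => ?_
    simp only [Finset.mem_range, Finset.mem_Ioc]
    omega
  · refine Finset.sum_comm' fun k j => ?_
    simp only [Finset.mem_range, Finset.mem_Ioc]
    omega

theorem coeff_theta (M : ℕ) (F : ℕ → Fock K) {η : ℕ →₀ ℕ} (hη : η 0 = 0) :
    MvPowerSeries.coeff η (theta M F) = co η (F 0) := by
  rw [theta, map_sum, Finset.sum_eq_single 0]
  · rw [pow_zero, one_mul, co_apply]
  · intro k _ hk
    rw [coeff_X_pow_mul, if_neg (by omega)]
  · simp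

theorem theta_single (M : ℕ) (f : Fock K) : theta M (Pi.single 0 f) = toSym f := by
  rw [theta, Finset.sum_eq_single 0]
  · simp
  · intro k _ hk
    simp [hk]
  · simp

theorem dunkl_iterate_toSym [CharZero K] (α : K) {d M : ℕ} (hd : d ≤ M) {f : Fock K} (hf : f ∈ H K d) (r : ℕ) :
    (dunkl α)^[r] (toSym f) = theta M ((lax α M)^[r] (Pi.single 0 f)) := by
  induction r with
  | zero => exact (theta_single M f).symm
  | succ r ih =>
    rw [Function.iterate_succ_apply', ih, Function.iterate_succ_apply',
      dunkl_theta α hd ((IsHomSeq.single hf).iterate r)]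

/-- A monomial free of `x_0` sees only the `w^0` component. By symmetry every coefficient of `nsOp`
can be read at such a monomial. -/
theorem co_nsOp [CharZero K] (α : K) {d M : ℕ} (hd : d ≤ M) {f : Fock K} (hf : f ∈ H K d) (r : ℕ)
    {η : ℕ →₀ ℕ} (hη : η 0 = 0) :
    co η (nsOp α M r f) = MvPowerSeries.coeff η ((dunkl α)^[r] (toSym f)) := by
  rw [dunkl_iterate_toSym α hd hf, coeff_theta M _ hη, nsOp_apply]

end JackLB
end

/-! ### The Laplace-Beltrami operator as the third Nazarov-Sklyanin operator -/

noncomputable section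

namespace JackLB

variable {K : Type*} [Field K]

/-! ### Coefficients of the Laplace-Beltrami operator -/

/-- The contribution of the pair of variables `x_i`, `x_j` to the coefficient of a monomial in the
image of a symmetric function under the Laplace-Beltrami operator. -/
def pairTerm (η : ℕ →₀ ℕ) (i j : ℕ) (f : Fock K) : K :=
  ∑ b ∈ Finset.range (min (η i) (η j)), ((η i : K) + (η j : K) - 2 * (b : K)) *
    co (put η i j (η i + η j - b) b) f - ((min (η i) (η j) : ℕ) : K) * co η f

theorem pairTerm_comm {i j : ℕ} (hij : i ≠ j) (η : ℕ →₀ ℕ) (f : Fock K) :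
    pairTerm η i j f = pairTerm η j i f := by
  rw [pairTerm, pairTerm, min_comm]
  congr 1
  refine Finset.sum_congr rfl fun b _ => ?_
  rw [co_put_swap hij, put_comm η hij, add_comm (η i), add_comm (η i : K)]

/-- The coefficient of a monomial in the image of a symmetric function under the Laplace-Beltrami
operator. -/
def lbCoeff (α : K) (η : ℕ →₀ ℕ) (f : Fock K) : K :=
  α / 2 * ∑ i ∈ η.support, (η i : K) * ((η i : K) - 1) * co η f +
    1 / 2 * ∑ i ∈ η.support, ∑ j ∈ η.support.erase i, pairTerm η i j f

theorem put_embDomain (e : ℕ ↪ ℕ) (η : ℕ →₀ ℕ) (i j a b : ℕ) :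
    put (Finsupp.embDomain e η) (e i) (e j) a b = Finsupp.embDomain e (put η i j a b) := by
  ext l
  rw [put_apply]
  by_cases hl : l ∈ Set.range e
  · obtain ⟨m, rfl⟩ := hl
    simp [put_apply]
  · rw [Finsupp.embDomain_of_notMem_range _ _ _ hl, Finsupp.embDomain_of_notMem_range _ _ _ hl,
      if_neg, if_neg]
    · rintro rfl; exact hl ⟨i, rfl⟩
    · rintro rfl; exact hl ⟨j, rfl⟩

theorem pairTerm_embDomain (e : ℕ ↪ ℕ) (η : ℕ →₀ ℕ) (i j : ℕ) (f : Fock K) :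
    pairTerm (Finsupp.embDomain e η) (e i) (e j) f = pairTerm η i j f := by
  simp only [pairTerm, put_embDomain, co_embDomain, Finsupp.embDomain_apply_self]

theorem lbCoeff_embDomain (α : K) (e : ℕ ↪ ℕ) (η : ℕ →₀ ℕ) (f : Fock K) :
    lbCoeff α (Finsupp.embDomain e η) f = lbCoeff α η f := by
  simp only [lbCoeff, Finsupp.support_embDomain, Finset.sum_map, ← Finset.map_erase,
    pairTerm_embDomain, co_embDomain, Finsupp.embDomain_apply_self]

/-- Under `b ↦ s + t - b` the weight is odd and `u` is even, so the terms with `s ≤ b ≤ t` cancel.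
This brings sums over `b < t` into a form symmetric in the two variables. -/
theorem sum_symm_window {s t : ℕ} (u : ℕ → K) (hu : ∀ b ≤ s + t, u b = u (s + t - b)) [CharZero K] :
    ∑ b ∈ Finset.range t, ((s : K) + (t : K) - 2 * (b : K)) * u b =
      ∑ b ∈ Finset.range (min s t), ((s : K) + (t : K) - 2 * (b : K)) * u b +
        ((t : K) - ((min s t : ℕ) : K)) * u t := by
  rcases le_or_gt t s with h | h
  · rw [min_eq_right h]; ring
  · rw [min_eq_left h.le, ← Finset.sum_range_add_sum_Ico _ h.le]
    congr 1
    have hz : ∑ b ∈ Finset.Ico s (t + 1), ((s : K) + (t : K) - 2 * (b : K)) * u b = 0 := by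
      have h1 : ∑ b ∈ Finset.Ico s (t + 1), ((s : K) + (t : K) - 2 * (b : K)) * u b =
          -∑ b ∈ Finset.Ico s (t + 1), ((s : K) + (t : K) - 2 * (b : K)) * u b := by
        rw [← Finset.sum_neg_distrib]
        refine Finset.sum_bij' (fun b _ => s + t - b) (fun b _ => s + t - b) ?_ ?_ ?_ ?_ ?_
        · intro b hb; simp only [Finset.mem_Ico] at hb ⊢; omega
        · intro b hb; simp only [Finset.mem_Ico] at hb ⊢; omega
        · intro b hb; simp only [Finset.mem_Ico] at hb ⊢; omega
        · intro b hb; simp only [Finset.mem_Ico] at hb ⊢; omega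
        · intro b hb
          simp only [Finset.mem_Ico] at hb
          rw [hu b (by omega), Nat.cast_sub (by omega)]
          push_cast
          ring
      exact self_eq_neg.1 h1
    rw [Finset.sum_Ico_succ_top h.le] at hz
    linear_combination hz

theorem quot_eq {g d q : MvPowerSeries ℕ K} (hd : d ≠ 0) (h : g = d * q) : quot g d = q := by
  have hex : ∃ q, g = d * q := ⟨q, h⟩
  rw [quot, dif_pos hex]
  exact mul_left_cancel₀ hd (hex.choose_spec.symm.trans h)

theorem put_add_single_left (η : ℕ →₀ ℕ) {i j : ℕ} (hij : i ≠ j) (a b k : ℕ) :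
    put η i j a b + Finsupp.single i k = put η i j (a + k) b := by
  classical
  ext l
  rw [Finsupp.add_apply, put_apply, put_apply, Finsupp.single_apply]
  by_cases h1 : l = j
  · subst h1; simp [hij]
  · by_cases h2 : l = i
    · subst h2; simp [h1]
    · simp [h1, h2, Ne.symm h2]

theorem put_add_single_right (η : ℕ →₀ ℕ) {i j : ℕ} (a b k : ℕ) :
    put η i j a b + Finsupp.single j k = put η i j a (b + k) := by
  classical
  ext l
  rw [Finsupp.add_apply, put_apply, put_apply, Finsupp.single_apply]
  by_cases h1 : l = j
  · subst h1; simp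
  · simp [h1, Ne.symm h1]

theorem put_single_add (η : ℕ →₀ ℕ) {i j : ℕ} (a b k : ℕ) :
    put (η + Finsupp.single j k) i j a b = put η i j a b := by
  classical
  ext l
  rw [put_apply, put_apply, Finsupp.add_apply, Finsupp.single_apply]
  by_cases h1 : l = j
  · simp [h1]
  · simp [h1, Ne.symm h1]

theorem put_zero_left {η : ℕ →₀ ℕ} {i : ℕ} (h : η i = 0) (j : ℕ) : put η i j 0 (η j) = η := by
  have := put_self η i j
  rwa [h] at this

theorem swp_pderiv {i j : ℕ} (hij : i ≠ j) {F : MvPowerSeries ℕ K} (hF : swp K i j F = F) :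
    swp K i j (MvPowerSeries.pderiv K i F) = MvPowerSeries.pderiv K j F := by
  ext η
  rw [coeff_swp hij, MvPowerSeries.coeff_pderiv, MvPowerSeries.coeff_pderiv]
  conv_rhs => rw [← hF, coeff_swp hij]
  rw [put_add_single_left η hij]
  have e1 : (η + Finsupp.single j 1 : ℕ →₀ ℕ) j = η j + 1 := by simp
  have e2 : (η + Finsupp.single j 1 : ℕ →₀ ℕ) i = η i := by simp [Finsupp.single_eq_of_ne hij]
  have e3 : put η i j (η j) (η i) i = η j := by simp [put_apply, hij]
  rw [e1, e2, e3, put_single_add]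

/-- Along an antidiagonal, `∂_i` contributes the weight `s + t - b` and `∂_j`, after a shift of
index, the weight `b`. The difference is the weight `s + t - 2 b` of `sum_symm_window`, and the two
boundary terms at `b = t` combine to `- min s t`. -/
theorem coeff_pair [CharZero K] {i j : ℕ} (hij : i ≠ j) {η : ℕ →₀ ℕ} (hi : η i ≠ 0) (hj : η j ≠ 0)
    (f : Fock K) :
    MvPowerSeries.coeff η (MvPowerSeries.X i * MvPowerSeries.X j *
      quot (MvPowerSeries.pderiv K i (toSym f) - MvPowerSeries.pderiv K j (toSym f))
        (MvPowerSeries.X i - MvPowerSeries.X j)) = pairTerm η i j f := by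
  classical
  set F := toSym f
  have hF : swp K i j F = F := swp_toSym i j f
  have hanti : swp K i j (MvPowerSeries.pderiv K i F - MvPowerSeries.pderiv K j F) =
      -(MvPowerSeries.pderiv K i F - MvPowerSeries.pderiv K j F) := by
    rw [map_sub, swp_pderiv hij hF]
    conv_lhs => rw [← swp_pderiv hij hF, swp_swp hij]
    rw [← swp_pderiv hij hF, neg_sub]
  rw [quot_eq (X_sub_X_ne_zero hij) (mul_ddiv hij hanti).symm, mul_assoc, coeff_X_mul',
    if_pos (by omega), coeff_X_mul']
  have e1 : (η - Finsupp.single i 1 : ℕ →₀ ℕ) j = η j := by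
    simp [Finsupp.single_eq_of_ne' hij]
  rw [e1, if_pos (by omega), coeff_ddiv]
  simp only [put_sub_single_left, put_sub_single_right]
  have e2 : (η - Finsupp.single i 1 - Finsupp.single j 1 : ℕ →₀ ℕ) j = η j - 1 := by
    simp [Finsupp.single_eq_of_ne' hij]
  have e3 : (η - Finsupp.single i 1 - Finsupp.single j 1 : ℕ →₀ ℕ) i = η i - 1 := by
    simp [Finsupp.single_eq_of_ne hij]
  rw [e2, e3, show η j - 1 + 1 = η j by omega]
  set s := η i with hs
  set t := η j with ht
  set u : ℕ → K := fun b => co (put η i j (s + t - b) b) f with hu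
  have hut : u t = co η f := by
    rw [hu]; simp only; rw [Nat.add_sub_cancel, hs, ht, put_self]
  have hsym : ∀ b ≤ s + t, u b = u (s + t - b) := by
    intro b hb
    simp only [hu]
    rw [co_put_swap hij, show s + t - (s + t - b) = b by omega]
  have hc : ∀ a b, MvPowerSeries.coeff (put η i j a b) (MvPowerSeries.pderiv K i F) =
      ((a : K) + 1) * co (put η i j (a + 1) b) f := by
    intro a b
    have e : put η i j a b i = a := by simp [put_apply, hij]
    rw [MvPowerSeries.coeff_pderiv, put_add_single_left η hij, e, co_apply, mul_comm]
  have hc' : ∀ a b, MvPowerSeries.coeff (put η i j a b) (MvPowerSeries.pderiv K j F) =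
      ((b : K) + 1) * co (put η i j a (b + 1)) f := by
    intro a b
    have e : put η i j a b j = b := by simp [put_apply]
    rw [MvPowerSeries.coeff_pderiv, put_add_single_right, e, co_apply, mul_comm]
  have h1 : ∑ r ∈ Finset.range t, MvPowerSeries.coeff (put η i j (s - 1 + 1 + r) (t - 1 - r))
      (MvPowerSeries.pderiv K i F - MvPowerSeries.pderiv K j F) =
      ∑ b ∈ Finset.range t, (((s : K) + (t : K) - (b : K)) * u b - ((b : K) + 1) * u (b + 1)) := by
    rw [← Finset.sum_range_reflect]
    refine Finset.sum_congr rfl fun b hb => ?_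
    have := Finset.mem_range.1 hb
    rw [map_sub, hc, hc', show t - 1 - (t - 1 - b) = b by omega,
      show s - 1 + 1 + (t - 1 - b) = s + t - (b + 1) by omega,
      show s + t - (b + 1) + 1 = s + t - b by omega, Nat.cast_sub (by omega)]
    simp only [hu]
    push_cast
    ring
  have h2 : ∑ b ∈ Finset.range t, ((b : K) + 1) * u (b + 1) =
      ∑ b ∈ Finset.range t, (b : K) * u b + (t : K) * u t := by
    have h3 := Finset.sum_range_succ' (fun b => (b : K) * u b) t
    rw [Finset.sum_range_succ] at h3
    simp only [Nat.cast_zero, zero_mul, add_zero, Nat.cast_add, Nat.cast_one] at h3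
    exact h3.symm
  rw [h1, Finset.sum_sub_distrib, h2, ← sub_sub, ← Finset.sum_sub_distrib]
  have h3 := sum_symm_window u hsym
  have h4 : ∑ b ∈ Finset.range t, (((s : K) + (t : K) - (b : K)) * u b - (b : K) * u b) =
      ∑ b ∈ Finset.range t, ((s : K) + (t : K) - 2 * (b : K)) * u b :=
    Finset.sum_congr rfl fun b _ => by ring
  rw [h4, h3, hut, pairTerm]
  ring

theorem coeff_laplaceBeltrami [CharZero K] (α : K) (η : ℕ →₀ ℕ) (f : Fock K) :
    MvPowerSeries.coeff η (laplaceBeltrami α (toSym f)) = lbCoeff α η f := by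
  have h0 : MvPowerSeries.coeff η (laplaceBeltrami α (toSym f)) = α / 2 * ∑ i ∈ η.support,
      MvPowerSeries.coeff η
        (MvPowerSeries.X i ^ 2 *
          MvPowerSeries.pderiv K i (MvPowerSeries.pderiv K i (toSym f))) +
    ∑ i ∈ η.support, ∑ j ∈ η.support with i < j,
      MvPowerSeries.coeff η
        (MvPowerSeries.X i * MvPowerSeries.X j *
          quot (MvPowerSeries.pderiv K i (toSym f) - MvPowerSeries.pderiv K j (toSym f))
            (MvPowerSeries.X i - MvPowerSeries.X j)) := rfl
  rw [h0, lbCoeff]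
  congr 1
  · congr 1
    refine Finset.sum_congr rfl fun i hi => ?_
    rw [coeff_X_pow_mul]
    have hi := Finsupp.mem_support_iff.1 hi
    by_cases h2 : 2 ≤ η i
    · rw [if_pos h2, MvPowerSeries.coeff_pderiv, MvPowerSeries.coeff_pderiv, add_assoc,
        ← Finsupp.single_add, tsub_add_cancel_of_le (by simpa [Finsupp.single_le_iff] using h2),
        co_apply]
      have : (η - Finsupp.single i 2 : ℕ →₀ ℕ) i = η i - 2 := by simp
      simp only [Finsupp.add_apply, this, Finsupp.single_eq_same]
      push_cast [Nat.cast_sub h2]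
      ring
    · rw [if_neg h2, show η i = 1 by omega]; simp
  · have h1 : ∀ i ∈ η.support, ∀ j ∈ η.support.filter (i < ·), MvPowerSeries.coeff η
        (MvPowerSeries.X i * MvPowerSeries.X j *
          quot (MvPowerSeries.pderiv K i (toSym f) - MvPowerSeries.pderiv K j (toSym f))
            (MvPowerSeries.X i - MvPowerSeries.X j)) = pairTerm η i j f := by
      intro i hi j hj
      obtain ⟨hj, hij⟩ := Finset.mem_filter.1 hj
      exact coeff_pair hij.ne (Finsupp.mem_support_iff.1 hi) (Finsupp.mem_support_iff.1 hj) f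
    rw [Finset.sum_congr rfl fun i hi => Finset.sum_congr rfl (h1 i hi)]
    have h2 : ∀ i ∈ η.support, ∑ j ∈ η.support.erase i, pairTerm η i j f =
        ∑ j ∈ η.support with i < j, pairTerm η i j f +
          ∑ j ∈ η.support with j < i, pairTerm η i j f := by
      intro i _
      rw [← Finset.sum_union]
      · refine Finset.sum_congr ?_ fun _ _ => rfl
        ext j
        simp only [Finset.mem_erase, Finset.mem_union, Finset.mem_filter]
        constructor
        · rintro ⟨h3, h4⟩
          rcases lt_or_gt_of_ne h3 with h5 | h5
          · exact Or.inr ⟨h4, h5⟩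
          · exact Or.inl ⟨h4, h5⟩
        · rintro (⟨h3, h4⟩ | ⟨h3, h4⟩)
          · exact ⟨h4.ne', h3⟩
          · exact ⟨h4.ne, h3⟩
      · rw [Finset.disjoint_left]
        intro j h3 h4
        exact absurd (Finset.mem_filter.1 h3).2 (not_lt.2 (Finset.mem_filter.1 h4).2.le)
    rw [Finset.sum_congr rfl h2, Finset.sum_add_distrib]
    have h3 : ∑ i ∈ η.support, ∑ j ∈ η.support with j < i, pairTerm η i j f =
        ∑ i ∈ η.support, ∑ j ∈ η.support with i < j, pairTerm η i j f := by
      rw [Finset.sum_comm' (s' := fun j => η.support.filter (j < ·)) (t' := η.support)]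
      · refine Finset.sum_congr rfl fun i _ => Finset.sum_congr rfl fun j hj => ?_
        exact pairTerm_comm (Finset.mem_filter.1 hj).2.ne' η f
      · intro i j
        simp only [Finset.mem_filter]
        tauto
    rw [h3]
    ring

/-! ### Comparison with the third power of the Lax operator -/

theorem coeff_dunkl_toSym (α : K) (f : Fock K) (η : ℕ →₀ ℕ) :
    MvPowerSeries.coeff η (dunkl α (toSym f)) = α * (η 0 : K) * co η f := by
  rw [coeff_dunkl, Finset.sum_eq_zero, add_zero, co_apply]
  intro j _
  rw [exch_zero_of_swp _ (swp_toSym 0 j f), map_zero]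

/-- Exchange terms vanish on symmetric functions, so the first application is only `α x_0 ∂_0`. The
exchange terms of the second one see the difference `α ((s + t - b) - b)` of two `x_0`-exponents,
the weight occurring in `pairTerm`. -/
theorem coeff_dunkl_dunkl_toSym [CharZero K] (α : K) (f : Fock K) (η : ℕ →₀ ℕ) :
    MvPowerSeries.coeff η (dunkl α (dunkl α (toSym f))) = α ^ 2 * (η 0 : K) ^ 2 * co η f +
      α * ∑ l ∈ η.support.erase 0, ((η l : K) * co η f + pairTerm η 0 l f) := by
  rw [coeff_dunkl, coeff_dunkl_toSym, Finset.mul_sum]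
  congr 1
  · ring
  · refine Finset.sum_congr rfl fun l hl => ?_
    have hl := (Finset.mem_erase.1 hl).1
    rw [coeff_exch hl]
    simp only [coeff_dunkl_toSym]
    set s := η 0 with hs
    set t := η l with ht
    set u : ℕ → K := fun b => co (put η 0 l (s + t - b) b) f with hu
    have hut : u t = co η f := by
      rw [hu]; simp only; rw [Nat.add_sub_cancel, hs, ht, put_self]
    have hsym : ∀ b ≤ s + t, u b = u (s + t - b) := by
      intro b hb
      simp only [hu]
      rw [co_put_swap hl.symm, show s + t - (s + t - b) = b by omega]
    have h1 : ∀ b ∈ Finset.range t,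
        (α * (put η 0 l (s + t - b) b 0 : K) * co (put η 0 l (s + t - b) b) f -
          α * (put η 0 l b (s + t - b) 0 : K) * co (put η 0 l b (s + t - b)) f) =
        α * (((s : K) + (t : K) - 2 * (b : K)) * u b) := by
      intro b hb
      have := Finset.mem_range.1 hb
      rw [co_put_swap hl.symm η b]
      simp only [put_apply, hl.symm, if_true, if_false, hu]
      rw [Nat.cast_sub (by omega)]
      push_cast
      ring
    rw [Finset.sum_congr rfl h1, ← Finset.mul_sum, sum_symm_window u hsym, hut, pairTerm]
    ring

theorem pairTerm_zero_left {η : ℕ →₀ ℕ} {i : ℕ} (h : η i = 0) (j : ℕ) (f : Fock K) :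
    pairTerm η i j f = 0 := by
  simp [pairTerm, h]

/-- At a monomial free of `x_0` only the exchange terms of the outer operator survive. Each
telescopes to a difference of two coefficients of `G`: the one with the exponent of `x_j` moved to
`x_0`, and the original. Summing the second-power formula over `j` gives all ordered pairs of
variables. -/
theorem coeff_dunkl_three_toSym [CharZero K] (α : K) (f : Fock K) {θ : ℕ →₀ ℕ} (hθ : θ 0 = 0) :
    MvPowerSeries.coeff θ (dunkl α (dunkl α (dunkl α (toSym f)))) =
      2 * α * lbCoeff α θ f + (α - 1) * α * (θ.degree : K) * co θ f := by
  set G := dunkl α (dunkl α (toSym f)) with hG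
  have h0 : (0 : ℕ) ∉ θ.support := by simpa using hθ
  rw [coeff_dunkl, Finset.erase_eq_of_notMem h0, hθ, Nat.cast_zero, mul_zero, zero_mul, zero_add]
  have hj0 : ∀ j ∈ θ.support, j ≠ 0 := fun j hj h => h0 (h ▸ hj)
  have hdeg : (θ.degree : K) = ∑ l ∈ θ.support, (θ l : K) := by
    rw [Finsupp.degree_apply]; push_cast; rfl
  have h1 : ∀ j ∈ θ.support, MvPowerSeries.coeff θ (exch j G) =
      MvPowerSeries.coeff (put θ 0 j (θ j) 0) G - MvPowerSeries.coeff θ G := by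
    intro j hj
    rw [coeff_exch (hj0 j hj), hθ, Finset.sum_sub_distrib]
    set t := θ j with ht
    set u : ℕ → K := fun b => MvPowerSeries.coeff (put θ 0 j (0 + t - b) b) G with hu
    have h2 : ∑ b ∈ Finset.range t, MvPowerSeries.coeff (put θ 0 j b (0 + t - b)) G =
        ∑ b ∈ Finset.range t, u (t - b) := by
      refine Finset.sum_congr rfl fun b hb => ?_
      have := Finset.mem_range.1 hb
      simp only [hu]
      rw [show 0 + t - (t - b) = b by omega, zero_add]
    -- The two sums run through the same antidiagonal from opposite ends, missing one end point
    -- each.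
    have h3 := Finset.sum_range_reflect u (t + 1)
    rw [Finset.sum_range_succ, Finset.sum_range_succ, show t + 1 - 1 - t = 0 by omega] at h3
    simp only [Nat.add_sub_cancel] at h3
    have h4 : u 0 = MvPowerSeries.coeff (put θ 0 j t 0) G := by simp [hu]
    have h5 : u t = MvPowerSeries.coeff θ G := by
      simp only [hu]
      rw [Nat.add_sub_cancel, ht, put_zero_left hθ]
    change ∑ b ∈ Finset.range t, u b - _ = _
    rw [h2, ← h4, ← h5]
    linear_combination -h3
  have h6 : MvPowerSeries.coeff θ G = α * (θ.degree : K) * co θ f := by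
    rw [hG, coeff_dunkl_dunkl_toSym, hθ, Finset.erase_eq_of_notMem h0, hdeg]
    simp only [pairTerm_zero_left hθ, add_zero, ← Finset.sum_mul]
    simp
    ring
  have h7 : ∀ j ∈ θ.support, MvPowerSeries.coeff (put θ 0 j (θ j) 0) G =
      α ^ 2 * (θ j : K) ^ 2 * co θ f + α * (((θ.degree : K) - (θ j : K)) * co θ f +
        ∑ l ∈ θ.support.erase j, pairTerm θ j l f) := by
    intro j hj
    have hj' := hj0 j hj
    have hsupp : (put θ 0 j (θ j) 0).support.erase 0 = θ.support.erase j := by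
      ext l
      simp only [Finset.mem_erase, Finsupp.mem_support_iff, put_apply]
      by_cases h1 : l = 0
      · subst h1; simp [hθ]
      · by_cases h2 : l = j
        · simp [h2]
        · simp [h1, h2]
    have hco : co (put θ 0 j (θ j) 0) f = co θ f := by
      rw [co_put_swap hj'.symm, put_zero_left hθ]
    have hpair : ∀ l ∈ θ.support.erase j, pairTerm (put θ 0 j (θ j) 0) 0 l f = pairTerm θ j l f := by
      intro l hl
      have hlj := (Finset.mem_erase.1 hl).1
      have hl0 := hj0 l (Finset.mem_erase.1 hl).2
      have e1 : put θ 0 j (θ j) 0 0 = θ j := by simp [put_apply, hj'.symm]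
      have e2 : put θ 0 j (θ j) 0 l = θ l := by simp [put_apply, hlj, hl0]
      rw [pairTerm, pairTerm, e1, e2, hco]
      congr 1
      refine Finset.sum_congr rfl fun b _ => ?_
      congr 1
      have e3 : ∀ a b, put (put θ 0 j (θ j) 0) 0 l a b = put (put θ 0 l a b) 0 j a 0 := by
        intro a b
        ext m
        simp only [put_apply]
        split_ifs <;> simp_all
      have e4 : ∀ a b, put θ j l a b = put (put θ 0 l a b) 0 j 0 a := by
        intro a b
        ext m
        simp only [put_apply]
        split_ifs <;> simp_all
      rw [e3, e4, co_put_swap hj'.symm]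
    rw [hG, coeff_dunkl_dunkl_toSym, hsupp, hco, Finset.sum_add_distrib, Finset.sum_congr rfl hpair,
      hdeg, ← Finset.add_sum_erase _ _ hj]
    have e1 : put θ 0 j (θ j) 0 0 = θ j := by simp [put_apply, hj'.symm]
    have e2 : ∑ l ∈ θ.support.erase j, (put θ 0 j (θ j) 0 l : K) * co θ f =
        (∑ l ∈ θ.support.erase j, (θ l : K)) * co θ f := by
      rw [Finset.sum_mul]
      refine Finset.sum_congr rfl fun l hl => ?_
      have hlj := (Finset.mem_erase.1 hl).1
      have hl0 := hj0 l (Finset.mem_erase.1 hl).2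
      simp [put_apply, hlj, hl0]
    rw [e1, e2]
    ring
  rw [Finset.sum_congr rfl h1, h6, Finset.sum_congr rfl fun j hj => by rw [h7 j hj]]
  have h8 : ∀ j ∈ θ.support, (α ^ 2 * (θ j : K) ^ 2 * co θ f + α * (((θ.degree : K) - (θ j : K)) *
      co θ f + ∑ l ∈ θ.support.erase j, pairTerm θ j l f)) - α * (θ.degree : K) * co θ f =
      α ^ 2 * ((θ j : K) * ((θ j : K) - 1) * co θ f) +
        α * (∑ l ∈ θ.support.erase j, pairTerm θ j l f) +
        (α - 1) * α * co θ f * (θ j : K) := fun j _ => by ring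
  rw [Finset.sum_congr rfl h8, Finset.sum_add_distrib, Finset.sum_add_distrib, ← Finset.mul_sum,
    ← Finset.mul_sum, ← Finset.mul_sum, ← hdeg, lbCoeff]
  ring

/-- The Laplace-Beltrami operator on polynomials in the power sums of degree `n ≤ M`. -/
def lbOp (α : K) (M n : ℕ) : Fock K →ₗ[K] Fock K :=
  (2 * α)⁻¹ • (nsOp α M 3 - ((α - 1) * α * (n : K)) • LinearMap.id)

theorem lbOp_apply (α : K) (M n : ℕ) (f : Fock K) :
    lbOp α M n f = (2 * α)⁻¹ • (nsOp α M 3 f - ((α - 1) * α * (n : K)) • f) := rfl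

theorem lbOp_mem (α : K) (M : ℕ) {n : ℕ} {f : Fock K} (hf : f ∈ H K n) : lbOp α M n f ∈ H K n :=
  Submodule.smul_mem _ _ (Submodule.sub_mem _ (nsOp_mem α M 3 hf) (Submodule.smul_mem _ _ hf))

theorem lbOp_selfAdjoint (α : K) (M n : ℕ) (f g : Fock K) :
    form α (lbOp α M n f) g = form α f (lbOp α M n g) := by
  simp only [lbOp_apply, map_smul, map_sub, LinearMap.smul_apply, LinearMap.sub_apply,
    nsOp_selfAdjoint]

theorem co_lbOp [CharZero K] {α : K} (hα : α ≠ 0) {M n : ℕ} (hn : n ≤ M) {f : Fock K}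
    (hf : f ∈ H K n) (η : ℕ →₀ ℕ) : co η (lbOp α M n f) = lbCoeff α η f := by
  -- Shifting the variables makes the exponent of `x_0` vanish without changing any coefficient.
  let e : ℕ ↪ ℕ := ⟨Nat.succ, Nat.succ_injective⟩
  have h0 : Finsupp.embDomain e η 0 = 0 :=
    Finsupp.embDomain_of_notMem_range _ _ _ (by rintro ⟨m, hm⟩; exact Nat.succ_ne_zero m hm)
  -- Exponent vectors of degree other than `n` have coefficient `0`, so the degree may be replaced
  -- by `n` throughout.
  have hdeg : ((Finsupp.embDomain e η).degree : K) * co (Finsupp.embDomain e η) f =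
      (n : K) * co (Finsupp.embDomain e η) f := by
    by_cases h : (Finsupp.embDomain e η).degree = n
    · rw [h]
    · rw [co_eq_zero hf h, mul_zero, mul_zero]
  rw [← co_embDomain e, ← lbCoeff_embDomain α e, lbOp_apply, map_smul, map_sub, map_smul,
    co_nsOp α hn hf 3 h0]
  change (2 * α)⁻¹ • (MvPowerSeries.coeff _ (dunkl α (dunkl α (dunkl α (toSym f)))) - _) = _
  rw [coeff_dunkl_three_toSym α f h0, smul_eq_mul, smul_eq_mul, mul_assoc ((α - 1) * α), hdeg,
    mul_assoc ((α - 1) * α), add_sub_cancel_right, ← mul_assoc, inv_mul_cancel₀, one_mul]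
  exact mul_ne_zero two_ne_zero hα

theorem toSym_lbOp [CharZero K] {α : K} (hα : α ≠ 0) {M n : ℕ} (hn : n ≤ M) {f : Fock K}
    (hf : f ∈ H K n) : toSym (lbOp α M n f) = laplaceBeltrami α (toSym f) := by
  ext η
  rw [← co_apply, co_lbOp hα hn hf, coeff_laplaceBeltrami]

end JackLB
end

/-! ### Triangularity of the Dunkl operator and its diagonal entries -/

noncomputable section

namespace JackLB

variable {K : Type*} [Field K]

/-! ### An order on multisets of parts -/

/-- The sum of the excesses over `c` of the parts. -/
def excess (c : ℕ) (s : Multiset ℕ) : ℕ := (s.map (· - c)).sum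

/-- The order on multisets of parts given by comparison of all excesses. -/
def Below (s t : Multiset ℕ) : Prop := ∀ c, excess c s ≤ excess c t

theorem Below.refl (s : Multiset ℕ) : Below s s := fun _ => le_rfl

theorem Below.trans {s t u : Multiset ℕ} (h : Below s t) (h' : Below t u) : Below s u :=
  fun c => (h c).trans (h' c)

/-- As a function of `c`, the truncated difference `x - c` has a single kink, at `c = x`. Excesses
therefore determine all multiplicities of positive parts. -/
theorem excess_second_difference (s : Multiset ℕ) (a : ℕ) :
    excess a s + excess (a + 2) s = 2 * excess (a + 1) s + s.count (a + 1) := by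
  induction s using Multiset.induction_on with
  | empty => simp [excess]
  | cons x s ih =>
    simp only [excess, Multiset.map_cons, Multiset.sum_cons, Multiset.count_cons] at ih ⊢
    split_ifs <;> omega

theorem eq_of_excess_eq {s t : Multiset ℕ} (hs : ∀ a ∈ s, 0 < a) (ht : ∀ a ∈ t, 0 < a)
    (h : ∀ c, excess c s = excess c t) : s = t := by
  ext a
  rcases a with _ | a
  · rw [Multiset.count_eq_zero_of_notMem fun h => lt_irrefl _ (hs _ h),
      Multiset.count_eq_zero_of_notMem fun h => lt_irrefl _ (ht _ h)]
  · have h1 := excess_second_difference s a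
    have h2 := excess_second_difference t a
    have h3 := h a
    have h4 := h (a + 1)
    have h5 := h (a + 2)
    omega

theorem Below.antisymm {s t : Multiset ℕ} (hs : ∀ a ∈ s, 0 < a) (ht : ∀ a ∈ t, 0 < a)
    (h : Below s t) (h' : Below t s) : s = t :=
  eq_of_excess_eq hs ht fun c => le_antisymm (h c) (h' c)

theorem excess_shape (c : ℕ) (η : ℕ →₀ ℕ) {S : Finset ℕ} (hS : η.support ⊆ S) :
    excess c (shape η) = ∑ i ∈ S, (η i - c) := by
  rw [excess, sum_map_shape]
  refine Finset.sum_subset hS fun i _ hi => ?_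
  rw [Finsupp.notMem_support_iff.1 hi, Nat.zero_sub]

theorem excess_zero_shape (η : ℕ →₀ ℕ) : excess 0 (shape η) = η.degree := by
  rw [excess_shape 0 η subset_rfl]; rfl

theorem support_put_subset (η : ℕ →₀ ℕ) (i j a b : ℕ) :
    (put η i j a b).support ⊆ insert i (insert j η.support) := by
  intro l hl
  rw [Finsupp.mem_support_iff, put_apply] at hl
  simp only [Finset.mem_insert, Finsupp.mem_support_iff]
  split_ifs at hl with h1 h2
  · exact Or.inr (Or.inl h1)
  · exact Or.inl h2
  · exact Or.inr (Or.inr hl)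

theorem sum_insert_pair {η : ℕ →₀ ℕ} {i j : ℕ} (hij : i ≠ j) (g : ℕ → ℕ) :
    ∑ l ∈ insert i (insert j η.support), g l =
      g i + g j + ∑ l ∈ (η.support.erase i).erase j, g l := by
  have h : insert i (insert j η.support) = insert i (insert j ((η.support.erase i).erase j)) := by
    ext l
    simp only [Finset.mem_insert, Finset.mem_erase]
    tauto
  rw [h, Finset.sum_insert (by simp [hij]), Finset.sum_insert (by simp), add_assoc]

theorem excess_put (c : ℕ) (η : ℕ →₀ ℕ) {i j : ℕ} (hij : i ≠ j) (a b : ℕ) :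
    excess c (shape (put η i j a b)) + (η i - c) + (η j - c) =
      excess c (shape η) + (a - c) + (b - c) := by
  rw [excess_shape c _ (support_put_subset η i j a b),
    excess_shape c η (S := insert i (insert j η.support)) (by intro l hl; simp [hl]),
    sum_insert_pair hij, sum_insert_pair hij]
  have h1 : put η i j a b i = a := by rw [put_apply, if_neg hij, if_pos rfl]
  have h2 : put η i j a b j = b := by rw [put_apply, if_pos rfl]
  have h3 : ∑ l ∈ (η.support.erase i).erase j, (put η i j a b l - c) =
      ∑ l ∈ (η.support.erase i).erase j, (η l - c) := by
    refine Finset.sum_congr rfl fun l hl => ?_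
    rw [put_apply, if_neg (Finset.ne_of_mem_erase hl),
      if_neg (Finset.ne_of_mem_erase (Finset.mem_of_mem_erase hl))]
  rw [h1, h2, h3]
  omega

theorem degree_put (η : ℕ →₀ ℕ) {i j : ℕ} (hij : i ≠ j) {a b : ℕ} (hab : a + b = η i + η j) :
    (put η i j a b).degree = η.degree := by
  have := excess_put 0 η hij a b
  rw [excess_zero_shape, excess_zero_shape] at this
  omega

/-- Spreading two numbers apart with fixed sum does not decrease the sum of values of the convex
function `x ↦ max (x - c) 0`. That exchanges of exponents are controlled without sorting is the
reason for using `Below` in place of dominance. -/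
theorem below_put (η : ℕ →₀ ℕ) {i j : ℕ} (hij : i ≠ j) {a b : ℕ} (hab : a + b = η i + η j)
    (h : min a b ≤ min (η i) (η j)) : Below (shape η) (shape (put η i j a b)) := by
  intro c
  have := excess_put c η hij a b
  omega

theorem not_below_put (η : ℕ →₀ ℕ) {i j : ℕ} (hij : i ≠ j) {a b : ℕ} (hab : a + b = η i + η j)
    (h : min a b < min (η i) (η j)) : ¬ Below (shape (put η i j a b)) (shape η) := by
  intro h2
  -- At this `c` both old exponents have excess `0`, while the larger new one has positive excess.
  have := excess_put (max (η i) (η j)) η hij a b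
  have := h2 (max (η i) (η j))
  omega

theorem shape_put_swap (η : ℕ →₀ ℕ) {i j : ℕ} (hij : i ≠ j) :
    shape (put η i j (η j) (η i)) = shape η := by
  rw [← embDomain_swap η hij, shape_embDomain]

/-! ### Triangularity of the Dunkl operator -/

/-- Terms with `η 0 < b < η j` cancel in pairs under `b ↦ η 0 + η j - b`. What remains are exponents
strictly more spread than `η`, and the swap of `η`, which has the same shape: this is the
triangularity of the Dunkl operator. -/
theorem coeff_exch_window {j : ℕ} (hj : j ≠ 0) (F : MvPowerSeries ℕ K) (η : ℕ →₀ ℕ) :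
    MvPowerSeries.coeff η (exch j F) = ∑ b ∈ Finset.range (min (η 0) (η j)),
      (MvPowerSeries.coeff (put η 0 j (η 0 + η j - b) b) F -
        MvPowerSeries.coeff (put η 0 j b (η 0 + η j - b)) F) +
      if η 0 < η j then MvPowerSeries.coeff (put η 0 j (η j) (η 0)) F - MvPowerSeries.coeff η F
        else 0 := by
  rw [coeff_exch hj]
  split_ifs with h
  · rw [min_eq_left h.le, ← Finset.sum_range_add_sum_Ico _ h.le,
      Finset.sum_eq_sum_Ico_succ_bot h, Nat.add_sub_cancel_left]
    have h1 : ∑ b ∈ Finset.Ico (η 0 + 1) (η j),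
        (MvPowerSeries.coeff (put η 0 j (η 0 + η j - b) b) F -
          MvPowerSeries.coeff (put η 0 j b (η 0 + η j - b)) F) = 0 := by
      rw [Finset.sum_sub_distrib, sub_eq_zero]
      refine Finset.sum_nbij' (fun b => η 0 + η j - b) (fun b => η 0 + η j - b) ?_ ?_ ?_ ?_ ?_
      · intro b hb; rw [Finset.mem_Ico] at hb ⊢; omega
      · intro b hb; rw [Finset.mem_Ico] at hb ⊢; omega
      · intro b hb; rw [Finset.mem_Ico] at hb; omega
      · intro b hb; rw [Finset.mem_Ico] at hb; omega
      · intro b hb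
        rw [Finset.mem_Ico] at hb
        rw [show η 0 + η j - (η 0 + η j - b) = b by omega]
    rw [h1, add_zero, put_self]
  · rw [min_eq_right (not_lt.1 h), add_zero]

/-- Eigenvalue data of the Dunkl operator: the coefficient in the `k`-th iterate applied to the
monomial symmetric function with the parts `s` of the monomials with exponents `s` and `η 0 = a`. -/
def diagCoeff (α : K) (s : Multiset ℕ) : ℕ → ℕ → K
  | 0, _ => 1
  | k + 1, a => α * (a : K) * diagCoeff α s k a +
      (s.map fun b => if a < b then diagCoeff α s k b - diagCoeff α s k a else 0).sum

/-- Both claims go through one induction. At exponents of the extreme shape `s` the spread terms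
vanish by the support claim, leaving the Euler term and the swaps; a swap replaces `η 0` by a larger
part, which is the recursion `diagCoeff`. -/
theorem coeff_dunkl_iterate (α : K) {F : MvPowerSeries ℕ K} {s : Multiset ℕ}
    (h1 : ∀ η, MvPowerSeries.coeff η F ≠ 0 → Below (shape η) s)
    (h2 : ∀ η, shape η = s → MvPowerSeries.coeff η F = 1) (k : ℕ) (η : ℕ →₀ ℕ) :
    (MvPowerSeries.coeff η ((dunkl α)^[k] F) ≠ 0 → Below (shape η) s) ∧
      (shape η = s → MvPowerSeries.coeff η ((dunkl α)^[k] F) = diagCoeff α s k (η 0)) := by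
  induction k generalizing η with
  | zero => exact ⟨h1 η, h2 η⟩
  | succ k ih =>
    rw [Function.iterate_succ_apply']
    set G := (dunkl α)^[k] F
    have hG : ∀ θ, ¬ Below (shape θ) s → MvPowerSeries.coeff θ G = 0 := fun θ hθ => by
      by_contra h; exact hθ ((ih θ).1 h)
    constructor
    · intro h
      by_contra hη
      apply h
      have hz : ∀ (j : ℕ) (a b : ℕ), j ≠ 0 → a + b = η 0 + η j → min a b ≤ min (η 0) (η j) →
          MvPowerSeries.coeff (put η 0 j a b) G = 0 := fun j a b hj hab hm =>
        hG _ fun h' => hη ((below_put η hj.symm hab hm).trans h')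
      rw [coeff_dunkl, hG η hη, mul_zero, zero_add]
      refine Finset.sum_eq_zero fun j hj => ?_
      have hj0 := Finset.ne_of_mem_erase hj
      rw [coeff_exch_window hj0, Finset.sum_eq_zero, zero_add, hz j _ _ hj0 (by omega) (by omega),
        hG η hη, sub_zero, ite_self]
      intro b hb
      rw [Finset.mem_range] at hb
      rw [hz j _ _ hj0 (by omega) (by omega), hz j _ _ hj0 (by omega) (by omega), sub_zero]
    · intro hη
      have hz : ∀ (j : ℕ) (a b : ℕ), j ≠ 0 → a + b = η 0 + η j → min a b < min (η 0) (η j) →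
          MvPowerSeries.coeff (put η 0 j a b) G = 0 := fun j a b hj hab hm =>
        hG _ fun h' => not_below_put η hj.symm hab hm (by rwa [hη])
      rw [coeff_dunkl, (ih η).2 hη, diagCoeff]
      congr 1
      rw [← hη, sum_map_shape, hη]
      symm
      rw [← Finset.sum_subset (Finset.erase_subset 0 η.support)]
      · refine Finset.sum_congr rfl fun j hj => ?_
        have hj0 := Finset.ne_of_mem_erase hj
        rw [coeff_exch_window hj0, Finset.sum_eq_zero, zero_add, (ih η).2 hη,
          (ih (put η 0 j (η j) (η 0))).2 (by rw [shape_put_swap η hj0.symm, hη]), put_apply,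
          if_neg hj0.symm, if_pos rfl]
        intro b hb
        rw [Finset.mem_range] at hb
        rw [hz j _ _ hj0 (by omega) (by omega), hz j _ _ hj0 (by omega) (by omega), sub_zero]
      · intro j hj hj'
        have : j = 0 := by
          by_contra h
          exact hj' (Finset.mem_erase.2 ⟨h, hj⟩)
        rw [this, if_neg (lt_irrefl _)]

theorem co_mono [CharZero K] {n : ℕ} (lam : n.Partition) (η : ℕ →₀ ℕ) :
    co η (mono K lam) = if shape η = lam.parts then 1 else 0 := by
  rw [co_apply, toSym_mono, coeff_msym]

/-- The vector of parts of a partition, shifted so that the exponent of `x_0` vanishes. -/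
def shiftedRows {n : ℕ} (mu : n.Partition) : ℕ →₀ ℕ :=
  Finsupp.embDomain ⟨Nat.succ, Nat.succ_injective⟩ (rows mu)

theorem shiftedRows_zero {n : ℕ} (mu : n.Partition) : shiftedRows mu 0 = 0 :=
  Finsupp.embDomain_of_notMem_range _ _ _ (by rintro ⟨m, hm⟩; exact Nat.succ_ne_zero m hm)

theorem shape_shiftedRows {n : ℕ} (mu : n.Partition) : shape (shiftedRows mu) = mu.parts := by
  rw [shiftedRows, shape_embDomain, shape_rows]

theorem co_rows_nsOp_mono [CharZero K] (α : K) {n : ℕ} (lam mu : n.Partition) (k : ℕ) :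
    (co (rows mu) (nsOp α n k (mono K lam)) ≠ 0 → Below mu.parts lam.parts) ∧
      co (rows lam) (nsOp α n k (mono K lam)) = diagCoeff α lam.parts k 0 := by
  have key := coeff_dunkl_iterate α (F := toSym (mono K lam)) (s := lam.parts)
    (fun η h => by
      rw [← co_apply, co_mono] at h
      by_cases h' : shape η = lam.parts
      · rw [h']; exact Below.refl _
      · simp [h'] at h)
    (fun η h => by rw [← co_apply, co_mono, if_pos h]) k
  have h3 : ∀ mu : n.Partition, co (rows mu) (nsOp α n k (mono K lam)) =
      MvPowerSeries.coeff (shiftedRows mu) ((dunkl α)^[k] (toSym (mono K lam))) := by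
    intro mu
    rw [← co_nsOp α le_rfl (mono_mem lam) k (shiftedRows_zero mu)]
    exact co_eq_of_shape_eq (by rw [shape_rows, shape_shiftedRows]) _
  constructor
  · intro h
    rw [h3] at h
    have := (key (shiftedRows mu)).1 h
    rwa [shape_shiftedRows] at this
  · rw [h3, (key (shiftedRows lam)).2 (shape_shiftedRows lam), shiftedRows_zero]

end JackLB
end

/-! ### The diagonal entries separate partitions -/

noncomputable section

namespace JackLB

variable {K : Type*} [Field K]

/-! ### Separation of partitions by eigenvalues -/

theorem alpha_mul_add_ne_zero [CharZero K] {α : K} (hα : ∀ q : ℚ, q ≤ 0 → α ≠ (q : K)) {a b : ℕ}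
    (ha : 0 < a) : α * (a : K) + (b : K) ≠ 0 := by
  intro h
  have ha' : (a : K) ≠ 0 := Nat.cast_ne_zero.2 ha.ne'
  refine hα (-((b : ℚ) / (a : ℚ))) (neg_nonpos.2 (by positivity)) ?_
  push_cast
  rw [← neg_div, eq_div_iff ha']
  linear_combination h

/-- Reversing coefficients turns `1 - a X` into `X - a`, whose products determine the roots. Equal
cardinality is needed because `a = 0` contributes the invisible factor `1`. -/
theorem multiset_eq_of_prod_one_sub_eq {A B : Multiset K} (hc : A.card = B.card)
    (h : (A.map fun a => 1 - Polynomial.C a * Polynomial.X).prod =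
      (B.map fun a => 1 - Polynomial.C a * Polynomial.X).prod) : A = B := by
  have hdeg : ∀ a : K, (1 - Polynomial.C a * Polynomial.X : Polynomial K).natDegree ≤ 1 := by
    intro a
    refine (Polynomial.natDegree_sub_le _ _).trans ?_
    rw [Polynomial.natDegree_one]
    exact max_le (Nat.zero_le _) ((Polynomial.natDegree_C_mul_le _ _).trans
      Polynomial.natDegree_X_le)
  have key : ∀ A : Multiset K,
      ((A.map fun a => 1 - Polynomial.C a * Polynomial.X).prod.natDegree ≤ A.card) ∧
      Polynomial.reflect A.card (A.map fun a => 1 - Polynomial.C a * Polynomial.X).prod =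
        (A.map fun a => Polynomial.X - Polynomial.C a).prod := by
    intro A
    induction A using Multiset.induction_on with
    | empty => simp [Polynomial.reflect_one]
    | cons a A ih =>
      rw [Multiset.map_cons, Multiset.prod_cons, Multiset.card_cons, Multiset.map_cons,
        Multiset.prod_cons, add_comm A.card 1]
      refine ⟨Polynomial.natDegree_mul_le.trans (add_le_add (hdeg a) ih.1), ?_⟩
      rw [Polynomial.reflect_mul _ _ (hdeg a) ih.1, ih.2]
      congr 1
      rw [Polynomial.reflect_sub, Polynomial.reflect_one, Polynomial.reflect_C_mul]
      have : Polynomial.reflect 1 (Polynomial.X : Polynomial K) = 1 := by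
        have := Polynomial.reflect_monomial (R := K) 1 1
        rw [pow_one] at this
        rw [this, Polynomial.revAt_le le_rfl, Nat.sub_self, pow_zero]
      rw [this, pow_one, mul_one]
  have h1 := (key A).2
  rw [h, hc, (key B).2] at h1
  have h2 := congrArg Polynomial.roots h1
  rw [Polynomial.roots_multiset_prod_X_sub_C, Polynomial.roots_multiset_prod_X_sub_C] at h2
  exact h2.symm

/-- The difference of the multiplicities in `A` and `B` is invariant under `c ↦ c + 1`. If nonzero
anywhere, it would be nonzero on an infinite progression, in characteristic `0`. -/
theorem multiset_eq_of_shift_eq [CharZero K] {A B : Multiset K}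
    (h : A.map (· - 1) + B = B.map (· - 1) + A) : A = B := by
  classical
  have hc : ∀ (A : Multiset K) (c : K), (A.map (· - 1)).count c = A.count (c + 1) := by
    intro A c
    conv_lhs => rw [show c = (fun x : K => x - 1) (c + 1) by simp]
    exact Multiset.count_map_eq_count' _ _ sub_left_injective _
  have h1 : ∀ c, A.count (c + 1) + B.count c = B.count (c + 1) + A.count c := by
    intro c
    have := congrArg (Multiset.count c) h
    rwa [Multiset.count_add, Multiset.count_add, hc, hc] at this
  ext c
  by_contra hne
  have h2 : ∀ k : ℕ, A.count (c + k) ≠ B.count (c + k) := by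
    intro k
    induction k with
    | zero => simpa using hne
    | succ k ih =>
      have := h1 (c + k)
      push_cast
      rw [← add_assoc]
      omega
  have h3 : ∀ k : ℕ, c + (k : K) ∈ (A + B).toFinset := by
    intro k
    rw [Multiset.mem_toFinset, Multiset.mem_add]
    by_contra h4
    push Not at h4
    exact h2 k (by rw [Multiset.count_eq_zero_of_notMem h4.1, Multiset.count_eq_zero_of_notMem h4.2])
  refine Set.infinite_of_injective_forall_mem (f := fun k : ℕ => c + (k : K)) ?_ h3
    (Finset.finite_toSet _)
  intro a b hab
  exact Nat.cast_injective (add_left_cancel hab)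

theorem sum_map_parts {n : ℕ} (lam : n.Partition) {N : ℕ} (hN : len lam ≤ N)
    {M : Type*} [AddCommMonoid M] (g : ℕ → M) (hg : g 0 = 0) :
    (lam.parts.map g).sum = ∑ i ∈ Finset.range N, g (rows lam i) := by
  rw [← shape_rows, sum_map_shape, support_rows]
  refine Finset.sum_subset (Finset.range_mono hN) fun i _ hi => ?_
  have : rows lam i = 0 := by
    by_contra h
    exact hi (Finset.mem_range.2 ((rows_pos_iff lam i).1 h))
  rw [this, hg]

theorem len_le {n : ℕ} (lam : n.Partition) : len lam ≤ n := by
  have := Multiset.card_nsmul_le_sum (s := lam.parts) (a := 1) fun x hx => lam.parts_pos hx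
  rw [lam.parts_sum] at this
  simpa [len] using this

theorem rows_eq_zero {n : ℕ} (lam : n.Partition) {i : ℕ} (hi : len lam ≤ i) : rows lam i = 0 := by
  by_contra h
  exact absurd ((rows_pos_iff lam i).1 h) (by omega)

/-- Parts larger than `λ_i` lie in rows above row `i`, and rows above of equal length contribute
`0`; so the sum may run over all `j < i`, and the `i` subtracted copies shift `α λ_i` to `α λ_i -
i`. -/
theorem diagCoeff_rows_succ (α : K) {n : ℕ} (lam : n.Partition) (k i : ℕ) :
    diagCoeff α lam.parts (k + 1) (rows lam i) =
      (α * (rows lam i : K) - (i : K)) * diagCoeff α lam.parts k (rows lam i) +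
        ∑ j ∈ Finset.range i, diagCoeff α lam.parts k (rows lam j) := by
  rw [diagCoeff, sum_map_parts lam (N := max i (len lam)) (le_max_right _ _)
    (fun b => if rows lam i < b then diagCoeff α lam.parts k b - diagCoeff α lam.parts k (rows lam i)
      else 0) (if_neg (Nat.not_lt_zero _)),
    ← Finset.sum_subset (Finset.range_mono (le_max_left i (len lam)))]
  · have : ∀ j ∈ Finset.range i, (if rows lam i < rows lam j then
        diagCoeff α lam.parts k (rows lam j) - diagCoeff α lam.parts k (rows lam i) else 0) =
        diagCoeff α lam.parts k (rows lam j) - diagCoeff α lam.parts k (rows lam i) := by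
      intro j hj
      split_ifs with h
      · rfl
      · rw [le_antisymm (not_lt.1 h) (rows_antitone lam (Finset.mem_range.1 hj).le), sub_self]
    rw [Finset.sum_congr rfl this, Finset.sum_sub_distrib, Finset.sum_const, Finset.card_range,
      nsmul_eq_mul]
    ring
  · intro j _ hj
    rw [Finset.mem_range, not_lt] at hj
    exact if_neg (not_lt.2 (rows_antitone lam hj))

/-- The shifted row lengths `α lam_i - i`. -/
def node (α : K) {n : ℕ} (lam : n.Partition) (i : ℕ) : K := α * (rows lam i : K) - (i : K)

-- With `D_i` the generating series attached to row `i` and `S_i = 1 + X ∑_(j<i) D_j`, the recursion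
-- reads `(1 - node_i X) D_i = S_i`. Hence `S_(i+1) (1 - node_i X) = S_i (1 - (node_i - 1) X)`, and
-- the product telescopes. Row `n` is empty, so `D_n` is the series sought and its node is `-n`.
open PowerSeries in
theorem diagSeries_mul_prod (α : K) {n : ℕ} (lam : n.Partition) :
    (1 + (n : K⟦X⟧) * X) * PowerSeries.mk (fun k => diagCoeff α lam.parts k 0) *
      ∏ i ∈ Finset.range n, (1 - C (node α lam i) * X) =
    ∏ i ∈ Finset.range n, (1 - C (node α lam i - 1) * X) := by
  set D : ℕ → K⟦X⟧ := fun i => PowerSeries.mk fun k => diagCoeff α lam.parts k (rows lam i) with hD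
  set S : ℕ → K⟦X⟧ := fun i => 1 + X * ∑ j ∈ Finset.range i, D j with hS
  have h1 : ∀ i, (1 - C (node α lam i) * X) * D i = S i := by
    intro i
    have : D i = 1 + X * (C (node α lam i) * D i + ∑ j ∈ Finset.range i, D j) := by
      ext k
      rcases k with _ | k
      · simp [hD, diagCoeff]
      · rw [map_add, mul_comm X, PowerSeries.coeff_succ_mul_X, map_add, PowerSeries.coeff_C_mul,
          map_sum]
        simp only [hD, PowerSeries.coeff_mk]
        rw [diagCoeff_rows_succ, PowerSeries.coeff_one, if_neg (Nat.succ_ne_zero k), zero_add]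
        rfl
    simp only [hS]
    linear_combination this
  have h2 : ∀ m, S m * ∏ i ∈ Finset.range m, (1 - C (node α lam i) * X) =
      ∏ i ∈ Finset.range m, (1 - C (node α lam i - 1) * X) := by
    intro m
    induction m with
    | zero => simp [hS]
    | succ m ih =>
      rw [Finset.prod_range_succ, Finset.prod_range_succ, ← ih]
      have h3 : S (m + 1) = S m + X * D m := by
        simp only [hS, Finset.sum_range_succ]; ring
      rw [h3, map_sub, map_one]
      linear_combination (X * ∏ i ∈ Finset.range m, (1 - C (node α lam i) * X)) * h1 m
  rw [← h2 n, ← h1 n]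
  congr 2
  · simp only [node, rows_eq_zero lam (len_le lam)]
    simp
  · simp only [hD, rows_eq_zero lam (len_le lam)]

/-- Cross-multiplying the two product formulas and comparing factors shows that the multisets of
nodes agree. Nodes determine the rows because `α a + b ≠ 0` for integers `a > 0`, `b ≥ 0`. -/
theorem eq_of_diagCoeff_eq [CharZero K] {α : K} (hα : ∀ q : ℚ, q ≤ 0 → α ≠ (q : K)) {n : ℕ}
    {lam mu : n.Partition} (h : ∀ k, diagCoeff α lam.parts k 0 = diagCoeff α mu.parts k 0) :
    lam = mu := by
  have hset : (Multiset.range n).map (node α lam) = (Multiset.range n).map (node α mu) := by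
    apply multiset_eq_of_shift_eq
    apply multiset_eq_of_prod_one_sub_eq
    · simp
    · apply Polynomial.coe_injective
      have h1 := diagSeries_mul_prod α lam
      have h2 := diagSeries_mul_prod α mu
      have h3 : PowerSeries.mk (fun k => diagCoeff α lam.parts k 0) =
        PowerSeries.mk (fun k => diagCoeff α mu.parts k 0) := by ext k; simp [h]
      rw [h3] at h1
      simp only [Multiset.map_add, Multiset.prod_add, Multiset.map_map, Function.comp_def]
      change ((∏ i ∈ Finset.range n, _ : Polynomial K) *
          (∏ i ∈ Finset.range n, _ : Polynomial K) : Polynomial K).toPowerSeries =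
        ((∏ i ∈ Finset.range n, _ : Polynomial K) *
          (∏ i ∈ Finset.range n, _ : Polynomial K) : Polynomial K).toPowerSeries
      rw [Polynomial.coe_mul, Polynomial.coe_mul]
      rw [← Polynomial.coeToPowerSeries.ringHom_apply, ← Polynomial.coeToPowerSeries.ringHom_apply,
        ← Polynomial.coeToPowerSeries.ringHom_apply, ← Polynomial.coeToPowerSeries.ringHom_apply,
        map_prod, map_prod, map_prod, map_prod]
      simp only [Polynomial.coeToPowerSeries.ringHom_apply, Polynomial.coe_sub, Polynomial.coe_mul,
        Polynomial.coe_one, Polynomial.coe_C, Polynomial.coe_X]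
      rw [← h1, ← h2]
      ring
  -- At the first differing row, the node of the longer row must occur for the other partition in
  -- some row `j`. Whether `j` lies above or not, equating nodes gives `α a + b = 0` with `a > 0`,
  -- or two equal indices.
  have hlt : ∀ (mu lam : n.Partition) (i : ℕ), (∀ j < i, rows mu j = rows lam j) →
      (Multiset.range n).map (node α lam) = (Multiset.range n).map (node α mu) →
      ¬ rows mu i < rows lam i := by
    intro mu lam i hj hset hi
    have hin : i < n := by
      by_contra h
      rw [rows_eq_zero lam ((len_le lam).trans (by omega))] at hi
      omega
    have hmem : node α lam i ∈ (Multiset.range n).map (node α mu) := by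
      rw [← hset]; exact Multiset.mem_map_of_mem _ (Multiset.mem_range.2 hin)
    obtain ⟨j, -, hj'⟩ := Multiset.mem_map.1 hmem
    simp only [node] at hj'
    rcases lt_or_ge j i with hji | hji
    · rw [hj j hji] at hj'
      rcases (rows_antitone lam hji.le).eq_or_lt with he | hl
      · rw [he] at hj'
        have : (j : K) = (i : K) := by linear_combination -hj'
        exact hji.ne (Nat.cast_injective this)
      · refine alpha_mul_add_ne_zero hα (a := rows lam j - rows lam i) (b := i - j) (by omega) ?_
        rw [Nat.cast_sub hl.le, Nat.cast_sub hji.le]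
        linear_combination hj'
    · have hl : rows mu j < rows lam i := (rows_antitone mu hji).trans_lt hi
      refine alpha_mul_add_ne_zero hα (a := rows lam i - rows mu j) (b := j - i) (by omega) ?_
      rw [Nat.cast_sub hl.le, Nat.cast_sub hji]
      linear_combination -hj'
  apply rows_injective
  ext i
  induction i using Nat.strong_induction_on with
  | _ i ih =>
    have h1 := hlt mu lam i (fun j hj => (ih j hj).symm) hset
    have h2 := hlt lam mu i ih hset.symm
    omega

end JackLB
end

/-! ### Linear algebra of triangular families; comparison with dominance -/

noncomputable section

namespace JackLB

variable {K : Type*} [Field K]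

/-! ### Triangular families -/

section Triangular

variable {ι V : Type*} [Fintype ι] [PartialOrder ι] [AddCommGroup V] [Module K V]

/-- At a maximal index outside `D` with nonzero coefficient, no other term can cancel the diagonal
entry. -/
theorem coeff_mem_of_triangular (b : Module.Basis ι K V) {P : ι → V}
    (hd : ∀ l, b.repr (P l) l ≠ 0) (ht : ∀ l m, b.repr (P l) m ≠ 0 → m ≤ l) {D : Set ι}
    (hD : IsLowerSet D) {c : ι → K} (h : ∀ m, b.repr (∑ l, c l • P l) m ≠ 0 → m ∈ D) {l : ι}
    (hl : c l ≠ 0) : l ∈ D := by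
  classical
  by_contra hlD
  obtain ⟨m, hm⟩ := (Finset.univ.filter fun m => c m ≠ 0 ∧ m ∉ D).exists_maximal
    ⟨l, by simp [hl, hlD]⟩
  obtain ⟨hm1, hm2⟩ := (Finset.mem_filter.1 hm.1).2
  apply hm2
  apply h
  have : b.repr (∑ l, c l • P l) m = c m * b.repr (P m) m := by
    rw [map_sum, Finsupp.finsetSum_apply, Finset.sum_eq_single m]
    · rw [map_smul, Finsupp.smul_apply, smul_eq_mul]
    · intro k _ hk
      rw [map_smul, Finsupp.smul_apply, smul_eq_mul]
      by_contra h2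
      have hck := left_ne_zero_of_mul h2
      have hmk := ht k m (right_ne_zero_of_mul h2)
      have := hm.2 (y := k) (by
        simp only [Finset.mem_filter, Finset.mem_univ, true_and]
        exact ⟨hck, fun hkD => hm2 (hD hmk hkD)⟩) hmk
      exact hk (le_antisymm this hmk)
    · simp
  rw [this]
  exact mul_ne_zero hm1 (hd m)

theorem exists_triangular_expansion (b : Module.Basis ι K V) {P : ι → V}
    (hd : ∀ l, b.repr (P l) l ≠ 0) (ht : ∀ l m, b.repr (P l) m ≠ 0 → m ≤ l) {D : Set ι}
    (hD : IsLowerSet D) {f : V} (hf : ∀ m, b.repr f m ≠ 0 → m ∈ D) :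
    ∃ c : ι → K, f = ∑ l, c l • P l ∧ ∀ l, c l ≠ 0 → l ∈ D := by
  classical
  have hli : LinearIndependent K P := by
    rw [Fintype.linearIndependent_iff]
    intro c hc l
    by_contra hl
    exact coeff_mem_of_triangular b hd ht isLowerSet_empty (c := c)
      (fun m hm => by rw [hc, map_zero] at hm; exact hm rfl) hl
  have := Module.Finite.of_basis b
  have hspan := hli.span_eq_top_of_card_eq_finrank' (Module.finrank_eq_card_basis b).symm
  have hmem : f ∈ Submodule.span K (Set.range P) := by rw [hspan]; trivial
  obtain ⟨c, hc⟩ := (Submodule.mem_span_range_iff_exists_fun K).1 hmem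
  refine ⟨c, hc.symm, fun l hl => coeff_mem_of_triangular b hd ht hD (c := c) (fun m hm => ?_) hl⟩
  rw [hc] at hm
  exact hf m hm

theorem triangular_apply (b : Module.Basis ι K V) {T : V →ₗ[K] V}
    (hT : ∀ l m, b.repr (T (b l)) m ≠ 0 → m ≤ l) {D : Set ι} (hD : IsLowerSet D) {f : V}
    (hf : ∀ m, b.repr f m ≠ 0 → m ∈ D) {m : ι} (hm : b.repr (T f) m ≠ 0) : m ∈ D := by
  rw [← b.sum_repr f, map_sum, map_sum, Finsupp.finsetSum_apply] at hm
  obtain ⟨k, -, hk⟩ := Finset.exists_ne_zero_of_sum_ne_zero hm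
  rw [map_smul, map_smul, Finsupp.smul_apply, smul_eq_mul] at hk
  exact hD (hT k m (right_ne_zero_of_mul hk)) (hf k (left_ne_zero_of_mul hk))

theorem exists_triangular_eigenvector (b : Module.Basis ι K V) {T : V →ₗ[K] V}
    (hT : ∀ l m, b.repr (T (b l)) m ≠ 0 → m ≤ l)
    (hne : ∀ l m, m < l → b.repr (T (b m)) m ≠ b.repr (T (b l)) l) (l : ι) :
    ∃ P : V, b.repr P l = 1 ∧ (∀ m, b.repr P m ≠ 0 → m ≤ l) ∧ T P = b.repr (T (b l)) l • P := by
  classical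
  set t := b.repr (T (b l)) l with ht
  set U : V →ₗ[K] V := T - t • LinearMap.id with hU
  have hUa : ∀ m k, b.repr (U (b m)) k = b.repr (T (b m)) k - t * (if m = k then 1 else 0) := by
    intro m k
    simp [hU, Finsupp.single_apply]
  -- The eigenvector is sought as `b l - ∑ c m • b m` over `m < l`, which amounts to expanding `U (b
  -- l)` in the vectors `U (b m)` with `m < l`. Padding by `b m` elsewhere makes a full triangular
  -- family, whose diagonal is nonzero by `hne`; the padding receives coefficient `0`.
  set Q : ι → V := fun m => if m < l then U (b m) else b m with hQ
  obtain ⟨c, hc1, hc2⟩ := exists_triangular_expansion b (P := Q) (D := Set.Iio l) (f := U (b l))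
    (fun m => by
      by_cases hm : m < l
      · simp only [hQ, if_pos hm, hUa, if_true, mul_one]
        exact sub_ne_zero.2 (hne l m hm)
      · simp [hQ, if_neg hm])
    (fun m k hk => by
      by_cases hm : m < l
      · simp only [hQ, if_pos hm, hUa] at hk
        by_cases hmk : m = k
        · exact hmk.ge
        · rw [if_neg hmk, mul_zero, sub_zero] at hk
          exact hT m k hk
      · simp only [hQ, if_neg hm, Module.Basis.repr_self, Finsupp.single_apply] at hk
        by_contra h
        exact hk (if_neg fun h' => h h'.ge))
    (isLowerSet_Iio l)
    (fun m hm => by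
      rw [hUa] at hm
      by_cases hml : l = m
      · rw [if_pos hml, mul_one, ← hml, ← ht, sub_self] at hm
        exact absurd rfl hm
      · rw [if_neg hml, mul_zero, sub_zero] at hm
        exact lt_of_le_of_ne (hT l m hm) (Ne.symm hml))
  have hP : ∀ k, b.repr (b l - ∑ m, c m • b m) k = (if l = k then 1 else 0) - c k := by
    intro k
    rw [map_sub, Finsupp.sub_apply, Module.Basis.repr_self, Finsupp.single_apply,
      b.repr_sum_self]
  refine ⟨b l - ∑ m, c m • b m, ?_, ?_, ?_⟩
  · rw [hP, if_pos rfl, sub_eq_self]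
    by_contra h
    exact lt_irrefl l (hc2 l h)
  · intro m hm
    rw [hP] at hm
    by_cases hml : l = m
    · exact hml.ge
    · rw [if_neg hml, zero_sub, neg_ne_zero] at hm
      exact (hc2 m hm).le
  · have h0 : U (b l - ∑ m, c m • b m) = 0 := by
      rw [map_sub, hc1, map_sum, ← Finset.sum_sub_distrib]
      refine Finset.sum_eq_zero fun m _ => ?_
      by_cases hm : c m = 0
      · simp [hm]
      · have : m < l := hc2 m hm
        simp [hQ, if_pos this]
    rw [hU, LinearMap.sub_apply, LinearMap.smul_apply, LinearMap.id_apply, sub_eq_zero] at h0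
    exact h0

theorem form_self_ne_zero (b : Module.Basis ι K V) (B : V →ₗ[K] V →ₗ[K] K)
    (hB : ∀ f, (∀ g, B f g = 0) → f = 0) {P : ι → V} (hd : ∀ l, b.repr (P l) l ≠ 0)
    (ht : ∀ l m, b.repr (P l) m ≠ 0 → m ≤ l) (ho : ∀ l m, l ≠ m → B (P l) (P m) = 0) (l : ι) :
    B (P l) (P l) ≠ 0 := by
  intro h0
  have : P l = 0 := by
    apply hB
    intro g
    obtain ⟨c, hc, -⟩ := exists_triangular_expansion b hd ht (D := Set.univ) isLowerSet_univ
      (f := g) (fun _ _ => trivial)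
    rw [hc, map_sum]
    refine Finset.sum_eq_zero fun m _ => ?_
    rw [map_smul]
    by_cases h : l = m
    · rw [← h, h0, smul_zero]
    · rw [ho l m h, smul_zero]
  exact hd l (by rw [this, map_zero]; rfl)

theorem eq_smul_of_orthogonal (b : Module.Basis ι K V) (B : V →ₗ[K] V →ₗ[K] K)
    (hB : ∀ f, (∀ g, B f g = 0) → f = 0) {P : ι → V} (hd : ∀ l, b.repr (P l) l ≠ 0)
    (ht : ∀ l m, b.repr (P l) m ≠ 0 → m ≤ l) (ho : ∀ l m, l ≠ m → B (P l) (P m) = 0) {l : ι} {f : V}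
    (hf : ∀ m, b.repr f m ≠ 0 → m ≤ l) (hfo : ∀ m < l, B f (P m) = 0) :
    ∃ c : K, f = c • P l := by
  obtain ⟨c, hc, hc2⟩ := exists_triangular_expansion b hd ht (D := Set.Iic l) (isLowerSet_Iic l) hf
  refine ⟨c l, hc.trans (Finset.sum_eq_single l (fun m _ hm => ?_) (by simp))⟩
  by_cases h : c m = 0
  · rw [h, zero_smul]
  · exfalso
    have h1 := hfo m (lt_of_le_of_ne (hc2 m h) hm)
    rw [hc, map_sum, LinearMap.sum_apply, Finset.sum_eq_single m] at h1
    · rw [map_smul, LinearMap.smul_apply, smul_eq_mul] at h1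
      exact mul_ne_zero h (form_self_ne_zero b B hB hd ht ho m) h1
    · intro k _ hk
      rw [map_smul, LinearMap.smul_apply, ho k m hk, smul_zero]
    · simp

/-- `T (P l)` stays in the span of indices `≤ l`. For `m < l` it is orthogonal to `P m`, since `T`
can be moved to `P m`, whose image involves only indices `≤ m`. -/
theorem eigenvector_of_selfAdjoint (b : Module.Basis ι K V) (B : V →ₗ[K] V →ₗ[K] K)
    (hB : ∀ f, (∀ g, B f g = 0) → f = 0) {P : ι → V} (hd : ∀ l, b.repr (P l) l ≠ 0)
    (ht : ∀ l m, b.repr (P l) m ≠ 0 → m ≤ l) (ho : ∀ l m, l ≠ m → B (P l) (P m) = 0)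
    {T : V →ₗ[K] V} (hT : ∀ l m, b.repr (T (b l)) m ≠ 0 → m ≤ l)
    (hTs : ∀ f g, B (T f) g = B f (T g)) (l : ι) : ∃ c : K, T (P l) = c • P l := by
  refine eq_smul_of_orthogonal b B hB hd ht ho
    (fun m hm => triangular_apply b hT (isLowerSet_Iic l) (ht l) hm) fun m hm => ?_
  obtain ⟨c, hc, hc2⟩ := exists_triangular_expansion b hd ht (isLowerSet_Iic m) (f := T (P m))
    (fun k hk => triangular_apply b hT (isLowerSet_Iic m) (ht m) hk)
  rw [hTs, hc, map_sum]
  refine Finset.sum_eq_zero fun k _ => ?_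
  rw [map_smul]
  by_cases h : c k = 0
  · rw [h, zero_smul]
  · rw [ho l k (fun hlk => absurd (hc2 k h) (by rw [← hlk]; exact not_le_of_gt hm)), smul_zero]

/-- Uniqueness of Gram-Schmidt: `P m` with `m < l` is a combination of `J k` with `k ≤ m`, all
orthogonal to `J l`. -/
theorem eq_smul_of_triangular_orthogonal (b : Module.Basis ι K V) (B : V →ₗ[K] V →ₗ[K] K)
    (hB : ∀ f, (∀ g, B f g = 0) → f = 0) {P J : ι → V}
    (hd : ∀ l, b.repr (P l) l ≠ 0) (ht : ∀ l m, b.repr (P l) m ≠ 0 → m ≤ l)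
    (ho : ∀ l m, l ≠ m → B (P l) (P m) = 0)
    (hd' : ∀ l, b.repr (J l) l ≠ 0) (ht' : ∀ l m, b.repr (J l) m ≠ 0 → m ≤ l)
    (ho' : ∀ l m, l ≠ m → B (J l) (J m) = 0) (l : ι) : ∃ c : K, J l = c • P l := by
  refine eq_smul_of_orthogonal b B hB hd ht ho (ht' l) fun m hm => ?_
  obtain ⟨c, hc, hc2⟩ := exists_triangular_expansion b hd' ht' (isLowerSet_Iic m) (ht m)
  rw [hc, map_sum]
  refine Finset.sum_eq_zero fun k _ => ?_
  rw [map_smul]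
  by_cases h : c k = 0
  · rw [h, zero_smul]
  · rw [ho' l k (fun hlk => absurd (hc2 k h) (by rw [← hlk]; exact not_le_of_gt hm)), smul_zero]

end Triangular

/-! ### Orders on partitions -/

theorem sum_take_eq (l : List ℕ) (i : ℕ) : (l.take i).sum = ∑ k ∈ Finset.range i, l.getD k 0 := by
  induction l generalizing i with
  | nil => simp
  | cons a l ih =>
    rcases i with _ | i
    · simp
    · rw [List.take_succ_cons, List.sum_cons, ih, Finset.sum_range_succ', add_comm]
      simp

theorem sum_take_sortedParts {n : ℕ} (lam : n.Partition) (i : ℕ) :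
    ((sortedParts lam).take i).sum = ∑ k ∈ Finset.range i, rows lam k := sum_take_eq _ _

/-- The order on partitions given by comparison of all excesses. -/
abbrev belowOrder (n : ℕ) : PartialOrder n.Partition where
  le mu lam := Below mu.parts lam.parts
  le_refl lam := Below.refl _
  le_trans _ _ _ := Below.trans
  le_antisymm _ _ h h' := Nat.Partition.ext
    (Below.antisymm (fun _ ha => Nat.Partition.parts_pos _ ha)
      (fun _ ha => Nat.Partition.parts_pos _ ha) h h')

/-- The dominance order on partitions. -/
abbrev dominanceOrder (n : ℕ) : PartialOrder n.Partition where
  le mu lam := ∀ i, ∑ k ∈ Finset.range i, rows mu k ≤ ∑ k ∈ Finset.range i, rows lam k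
  le_refl lam _ := le_rfl
  le_trans _ _ _ h h' i := (h i).trans (h' i)
  le_antisymm mu lam h h' := by
    apply rows_injective
    ext i
    have h1 := le_antisymm (h i) (h' i)
    have h2 := le_antisymm (h (i + 1)) (h' (i + 1))
    rw [Finset.sum_range_succ, Finset.sum_range_succ] at h2
    omega

theorem domLT_iff {n : ℕ} (mu lam : n.Partition) :
    DomLT mu lam ↔ mu ≠ lam ∧ (dominanceOrder n).le mu lam := by
  rw [DomLT]
  simp only [sum_take_sortedParts]
  rfl

/-- The bound is attained at `c = rows lam i` (`sum_rows_eq_excess`), so the partial sums of the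
rows are a Legendre transform of the excesses. This converts `Below` into dominance. -/
theorem sum_rows_le_excess {n : ℕ} (lam : n.Partition) (c i : ℕ) :
    ∑ k ∈ Finset.range i, rows lam k ≤ i * c + excess c lam.parts := by
  rw [excess, sum_map_parts lam (N := max i (len lam)) (le_max_right _ _) _ (Nat.zero_sub c)]
  have h1 : ∑ k ∈ Finset.range i, rows lam k ≤ ∑ k ∈ Finset.range i, (c + (rows lam k - c)) :=
    Finset.sum_le_sum fun k _ => by omega
  rw [Finset.sum_add_distrib, Finset.sum_const, Finset.card_range, smul_eq_mul] at h1
  have h2 : ∑ k ∈ Finset.range i, (rows lam k - c) ≤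
      ∑ k ∈ Finset.range (max i (len lam)), (rows lam k - c) :=
    Finset.sum_le_sum_of_subset (Finset.range_mono (le_max_left _ _))
  omega

theorem sum_rows_eq_excess {n : ℕ} (lam : n.Partition) (i : ℕ) :
    ∑ k ∈ Finset.range i, rows lam k = i * rows lam i + excess (rows lam i) lam.parts := by
  rw [excess, sum_map_parts lam (N := max i (len lam)) (le_max_right _ _) _
    (Nat.zero_sub (rows lam i)), ← Finset.sum_subset (Finset.range_mono (le_max_left i (len lam)))]
  · have h1 : ∑ k ∈ Finset.range i, rows lam k =
        ∑ k ∈ Finset.range i, (rows lam i + (rows lam k - rows lam i)) :=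
      Finset.sum_congr rfl fun k hk => by
        have := rows_antitone lam (Finset.mem_range.1 hk).le
        omega
    rw [h1, Finset.sum_add_distrib, Finset.sum_const, Finset.card_range, smul_eq_mul]
  · intro k _ hk
    rw [Finset.mem_range, not_lt] at hk
    exact Nat.sub_eq_zero_of_le (rows_antitone lam hk)

theorem Below.dominance {n : ℕ} {mu lam : n.Partition} (h : Below mu.parts lam.parts) :
    (dominanceOrder n).le mu lam := by
  intro i
  rw [sum_rows_eq_excess lam i]
  exact (sum_rows_le_excess mu (rows lam i) i).trans (Nat.add_le_add_left (h _) _)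

end JackLB
end

/-! ### Existence of an orthogonal unitriangular basis -/

noncomputable section

namespace JackLB

variable {K : Type*} [Field K]

/-! ### The Jack basis -/

/-- The basis of the homogeneous polynomials in the power sums that corresponds to the monomial
symmetric functions. -/
def monoBasis (K : Type*) [Field K] [CharZero K] (n : ℕ) : Module.Basis n.Partition K (H K n) :=
  Module.Basis.ofEquivFun
    { toFun := fun f lam => co (rows lam) (f : Fock K)
      map_add' := fun f g => by ext lam; simp
      map_smul' := fun c f => by ext lam; simp
      invFun := fun v => ∑ lam, v lam • ⟨mono K lam, mono_mem lam⟩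
      left_inv := fun f => by
        apply Subtype.ext
        rw [Submodule.coe_sum]
        exact (eq_sum_mono f.2).symm
      right_inv := fun v => by
        classical
        ext mu
        dsimp only
        rw [Submodule.coe_sum]
        simp [co_rows_mono] }

theorem monoBasis_repr [CharZero K] {n : ℕ} (f : H K n) (lam : n.Partition) :
    (monoBasis K n).repr f lam = co (rows lam) (f : Fock K) := rfl

theorem coe_monoBasis [CharZero K] {n : ℕ} (lam : n.Partition) :
    ((monoBasis K n lam : H K n) : Fock K) = mono K lam := by
  classical
  rw [monoBasis, Module.Basis.coe_ofEquivFun]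
  change ((∑ mu, _ • _ : H K n) : Fock K) = _
  rw [Submodule.coe_sum, Finset.sum_eq_single lam]
  · simp
  · intro mu _ hmu
    simp [hmu]
  · simp

/-- The bilinear form on the homogeneous polynomials in the power sums. -/
def formH (α : K) (n : ℕ) : H K n →ₗ[K] H K n →ₗ[K] K :=
  (form α).compl₁₂ (H K n).subtype (H K n).subtype

theorem formH_apply (α : K) {n : ℕ} (f g : H K n) : formH α n f g = form α (f : Fock K) g := rfl

/-- An orthogonal family of polynomials in the power sums, unitriangular with respect to the
monomial symmetric functions. -/
structure IsJackBasis [CharZero K] (α : K) (n : ℕ) (P : n.Partition → Fock K) : Prop where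
  mem : ∀ lam, P lam ∈ H K n
  diag : ∀ lam : n.Partition, co (rows lam) (P lam) = 1
  below : ∀ lam mu : n.Partition, co (rows mu) (P lam) ≠ 0 → Below mu.parts lam.parts
  orthogonal : ∀ lam mu, lam ≠ mu → form α (P lam) (P mu) = 0

theorem alpha_ne_zero {α : K} (hα : ∀ q : ℚ, q ≤ 0 → α ≠ (q : K)) : α ≠ 0 := by
  simpa using hα 0 le_rfl

theorem formH_nondegenerate [CharZero K] {α : K} (hα : α ≠ 0) (n : ℕ) (f : H K n)
    (h : ∀ g, formH α n f g = 0) : f = 0 :=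
  Subtype.ext (eq_zero_of_form hα f.2 fun g hg => h ⟨g, hg⟩)

/-- A linear combination `T` of the commonly triangular, self-adjoint operators `nsOp` is chosen
with pairwise distinct diagonal entries. Its triangular eigenvectors are then orthogonal. -/
theorem exists_isJackBasis [CharZero K] {α : K} (hα : ∀ q : ℚ, q ≤ 0 → α ≠ (q : K)) (n : ℕ) :
    ∃ P : n.Partition → Fock K, IsJackBasis α n P := by
  classical
  let := belowOrder n
  let ns : ℕ → H K n →ₗ[K] H K n := fun k =>
    (nsOp α n k).restrict fun f hf => nsOp_mem α n k hf
  have hk : ∀ p : n.Partition × n.Partition, ∃ k : ℕ, p.1 ≠ p.2 →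
      diagCoeff α p.1.parts k 0 ≠ diagCoeff α p.2.parts k 0 := by
    intro p
    by_contra! h
    exact (h 0).1 (eq_of_diagCoeff_eq hα fun k => (h k).2)
  choose k hk using hk
  let v : n.Partition → (n.Partition × n.Partition → K) := fun lam p =>
    diagCoeff α lam.parts (k p) 0
  -- Each pair of partitions is separated by some `k p`, so the finitely many vectors `v lam - v mu`
  -- are nonzero; over an infinite field some functional vanishes on none of them. Its coordinates
  -- are the coefficients of `T`.
  obtain ⟨s, hs⟩ := Module.exists_dual_forall_apply_ne_zero (K := K)
    (fun p : {p : n.Partition × n.Partition // p.1 ≠ p.2} => v p.1.1 - v p.1.2) (by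
      intro p h
      have := congrFun h p.1
      exact hk p.1 p.2 (sub_eq_zero.1 this))
  let T : H K n →ₗ[K] H K n := ∑ p, s (Pi.single p 1) • ns (k p)
  have hTc : ∀ f : H K n, ((T f : H K n) : Fock K) =
      ∑ p, s (Pi.single p 1) • nsOp α n (k p) (f : Fock K) := by
    intro f
    simp only [T, LinearMap.sum_apply, LinearMap.smul_apply, Submodule.coe_sum]
    rfl
  have hTr : ∀ lam mu, (monoBasis K n).repr (T (monoBasis K n lam)) mu =
      ∑ p, s (Pi.single p 1) * co (rows mu) (nsOp α n (k p) (mono K lam)) := by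
    intro lam mu
    rw [monoBasis_repr, hTc, map_sum, coe_monoBasis]
    simp only [map_smul, smul_eq_mul]
  have hdiag : ∀ lam, (monoBasis K n).repr (T (monoBasis K n lam)) lam = s (v lam) := by
    intro lam
    rw [hTr, LinearMap.pi_apply_eq_sum_univ s (v lam)]
    refine Finset.sum_congr rfl fun p _ => ?_
    rw [(co_rows_nsOp_mono α lam lam (k p)).2, smul_eq_mul, mul_comm]
    congr 2
    ext q
    simp [Pi.single_apply, eq_comm]
  have hT : ∀ lam mu, (monoBasis K n).repr (T (monoBasis K n lam)) mu ≠ 0 → mu ≤ lam := by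
    intro lam mu h
    rw [hTr] at h
    obtain ⟨p, -, hp⟩ := Finset.exists_ne_zero_of_sum_ne_zero h
    exact (co_rows_nsOp_mono α lam mu (k p)).1 (right_ne_zero_of_mul hp)
  have hne : ∀ lam mu : n.Partition, lam ≠ mu → s (v lam) ≠ s (v mu) := by
    intro lam mu h
    have := hs ⟨(lam, mu), h⟩
    rw [map_sub] at this
    exact sub_ne_zero.1 this
  choose P hP1 hP2 hP3 using fun lam => exists_triangular_eigenvector (monoBasis K n) hT
    (fun l m hlt => by rw [hdiag, hdiag]; exact hne m l hlt.ne) lam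
  refine ⟨fun lam => P lam, fun lam => (P lam).2, hP1, hP2, fun lam mu h => ?_⟩
  have hsa : form α ((T (P lam) : H K n) : Fock K) (P mu) =
      form α (P lam : Fock K) (T (P mu) : H K n) := by
    rw [hTc, hTc, map_sum, map_sum, LinearMap.sum_apply]
    refine Finset.sum_congr rfl fun p _ => ?_
    rw [map_smul, map_smul, LinearMap.smul_apply, nsOp_selfAdjoint]
  rw [hP3, hP3, hdiag, hdiag, Submodule.coe_smul, Submodule.coe_smul, map_smul, map_smul,
    LinearMap.smul_apply, smul_eq_mul, smul_eq_mul, ← sub_eq_zero, ← sub_mul] at hsa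
  exact (mul_eq_zero.1 hsa).resolve_left (sub_ne_zero.2 (hne lam mu h))

/-- The monic Jack symmetric functions as polynomials in the power sums. -/
def jackP (α : K) {n : ℕ} [CharZero K] (lam : n.Partition) : Fock K :=
  open Classical in
  if h : ∃ P : n.Partition → Fock K, IsJackBasis α n P then h.choose lam else 0

theorem isJackBasis_jackP [CharZero K] {α : K} (hα : ∀ q : ℚ, q ≤ 0 → α ≠ (q : K)) (n : ℕ) :
    IsJackBasis α n (jackP α (n := n)) := by
  have h := exists_isJackBasis hα n
  have : jackP α (n := n) = h.choose := by
    ext1 lam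
    rw [jackP, dif_pos h]
  rw [this]
  exact h.choose_spec

section

variable [CharZero K] {α : K} {n : ℕ} {P : n.Partition → Fock K}

theorem IsJackBasis.form_self_ne_zero (hP : IsJackBasis α n P) (hα : α ≠ 0) (lam : n.Partition) :
    form α (P lam) (P lam) ≠ 0 :=
  let := belowOrder n
  JackLB.form_self_ne_zero (monoBasis K n) (formH α n) (formH_nondegenerate hα n)
    (P := fun lam => ⟨P lam, hP.mem lam⟩)
    (fun l => by rw [monoBasis_repr, hP.diag]; exact one_ne_zero) hP.below hP.orthogonal lam

theorem IsJackBasis.eq_sum (hP : IsJackBasis α n P) (hα : α ≠ 0) {f : Fock K} (hf : f ∈ H K n) :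
    f = ∑ lam, (form α f (P lam) / form α (P lam) (P lam)) • P lam := by
  let := belowOrder n
  obtain ⟨c, hc, -⟩ := exists_triangular_expansion (monoBasis K n)
    (P := fun lam => ⟨P lam, hP.mem lam⟩)
    (fun l => by rw [monoBasis_repr, hP.diag]; exact one_ne_zero) hP.below isLowerSet_univ
    (f := ⟨f, hf⟩) (fun _ _ => trivial)
  have hc' : f = ∑ lam, c lam • P lam := by
    have := congrArg (fun g : H K n => (g : Fock K)) hc
    simpa [Submodule.coe_sum] using this
  have h : ∀ lam, form α f (P lam) / form α (P lam) (P lam) = c lam := by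
    intro lam
    rw [div_eq_iff (hP.form_self_ne_zero hα lam), hc', map_sum, LinearMap.sum_apply,
      Finset.sum_eq_single lam]
    · simp
    · intro mu _ hmu
      rw [map_smul, LinearMap.smul_apply, hP.orthogonal mu lam hmu, smul_zero]
    · simp
  simp only [h]
  exact hc'

theorem IsJackBasis.co_ne_zero (hP : IsJackBasis α n P) {lam : n.Partition} {η : ℕ →₀ ℕ}
    (h : co η (P lam) ≠ 0) : Below (shape η) lam.parts := by
  by_cases hη : η.degree = n
  · have h2 : shape η = shape (rows (ofShape η hη)) := by rw [shape_rows]; rfl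
    rw [co_eq_of_shape_eq h2] at h
    exact hP.below _ _ h
  · exact absurd (co_eq_zero (hP.mem lam) hη) h

theorem IsJackBasis.co_eq_one (hP : IsJackBasis α n P) {lam : n.Partition} {η : ℕ →₀ ℕ}
    (h : shape η = lam.parts) : co η (P lam) = 1 := by
  rw [co_eq_of_shape_eq (θ := rows lam) (by rw [shape_rows, h]), hP.diag]

end

end JackLB
end

/-! ### The Jack functions and the eigenvalues of the Laplace-Beltrami operator -/

noncomputable section

namespace JackLB

variable {K : Type*} [Field K]

/-! ### The Jack symmetric functions -/

theorem hook_ne_zero [CharZero K] {α : K} (hα : ∀ q : ℚ, q ≤ 0 → α ≠ (q : K)) {n : ℕ}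
    (lam : n.Partition) : hook α lam ≠ 0 := by
  refine Finset.prod_ne_zero_iff.2 fun s _ => ?_
  rcases Nat.eq_zero_or_pos (arm (diagram lam) s) with h | h
  · rw [h, Nat.cast_zero, mul_zero, zero_add]
    exact Nat.cast_add_one_ne_zero _
  · rw [add_assoc]
    exact_mod_cast alpha_mul_add_ne_zero hα (b := leg (diagram lam) s + 1) h

theorem IsJackBasis.isJackFamily [CharZero K] {α : K} {n : ℕ} {P : n.Partition → Fock K}
    (hP : IsJackBasis α n P) : IsJackFamily α n fun lam => hook α lam • toSym (P lam) := by
  classical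
  refine ⟨fun lam mu h => ?_, fun lam => ?_⟩
  · simp only [← map_smul]
    rw [scal_toSym α (Submodule.smul_mem _ _ (hP.mem lam)) (Submodule.smul_mem _ _ (hP.mem mu)),
      map_smul, map_smul, LinearMap.smul_apply, hP.orthogonal lam mu h, smul_zero, smul_zero]
  · refine ⟨fun mu => if mu = lam then 0 else hook α lam * co (rows mu) (P lam), ?_, ?_⟩
    · intro mu h
      rw [domLT_iff, not_and] at h
      dsimp only
      split_ifs with h1
      · rfl
      · by_contra h2
        exact h h1 (hP.below _ _ (right_ne_zero_of_mul h2)).dominance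
    · dsimp only
      conv_lhs => rw [eq_sum_mono (hP.mem lam)]
      rw [map_sum, Finset.smul_sum, ← Finset.add_sum_erase _ _ (Finset.mem_univ lam),
        ← Finset.add_sum_erase (a := lam) (s := Finset.univ)
          (f := fun mu => (if mu = lam then 0 else hook α lam * co (rows mu) (P lam)) • msym K mu)
          (Finset.mem_univ lam)]
      rw [hP.diag, one_smul, toSym_mono, if_pos rfl, zero_smul, zero_add]
      congr 1
      refine Finset.sum_congr rfl fun mu hmu => ?_
      rw [if_neg (Finset.ne_of_mem_erase hmu), map_smul, toSym_mono, smul_smul]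

/-- Both families are orthogonal and triangular for dominance, `P` because `Below` implies
dominance. They are therefore proportional, and the factor is read off on the diagonal;
`hook_ne_zero` guarantees that `J` has a nonzero diagonal. -/
theorem IsJackFamily.eq_smul [CharZero K] {α : K} (hα : ∀ q : ℚ, q ≤ 0 → α ≠ (q : K)) {n : ℕ}
    {P : n.Partition → Fock K} (hP : IsJackBasis α n P) {J : n.Partition → MvPowerSeries ℕ K}
    (hJ : IsJackFamily α n J) (lam : n.Partition) : J lam = hook α lam • toSym (P lam) := by
  classical
  choose u hu hJu using hJ.triangular
  let j : n.Partition → Fock K := fun lam =>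
    hook α lam • mono K lam + ∑ mu, u lam mu • mono K mu
  have hj : ∀ lam, j lam ∈ H K n := fun lam => Submodule.add_mem _
    (Submodule.smul_mem _ _ (mono_mem lam))
    (Submodule.sum_mem _ fun mu _ => Submodule.smul_mem _ _ (mono_mem mu))
  have hJj : ∀ lam, J lam = toSym (j lam) := by
    intro lam
    rw [hJu]
    simp only [j, map_add, map_sum, map_smul, toSym_mono]
  have hco : ∀ lam mu, co (rows mu) (j lam) = (if mu = lam then hook α lam else 0) + u lam mu := by
    intro lam mu
    simp only [j, map_add, map_sum, map_smul, co_rows_mono, smul_eq_mul, mul_ite, mul_one, mul_zero,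
      Finset.sum_ite_eq, Finset.mem_univ, if_true]
  have hdiag : ∀ lam, co (rows lam) (j lam) = hook α lam := by
    intro lam
    rw [hco, if_pos rfl, hu lam lam fun h => h.1 rfl, add_zero]
  have hP1 := fun lam mu (h : co (rows mu) (P lam) ≠ 0) => (hP.below lam mu h).dominance
  let := dominanceOrder n
  obtain ⟨c, hc⟩ := eq_smul_of_triangular_orthogonal (monoBasis K n) (formH α n)
    (formH_nondegenerate (alpha_ne_zero hα) n) (P := fun lam => ⟨P lam, hP.mem lam⟩)
    (J := fun lam => ⟨j lam, hj lam⟩)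
    (fun l => by rw [monoBasis_repr, hP.diag]; exact one_ne_zero) hP1 hP.orthogonal
    (fun l => by rw [monoBasis_repr, hdiag]; exact hook_ne_zero hα l)
    (fun l m hm => by
      rw [monoBasis_repr, hco] at hm
      by_cases h : m = l
      · exact h.le
      · rw [if_neg h, zero_add] at hm
        by_contra h2
        exact hm (hu l m fun h3 => h2 ((domLT_iff m l).1 h3).2))
    (fun l m h => by
      rw [formH_apply, ← scal_toSym α (hj l) (hj m), ← hJj, ← hJj]
      exact hJ.orthogonal l m h) lam
  have hc' : j lam = c • P lam := congrArg (fun g : H K n => (g : Fock K)) hc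
  have : c = hook α lam := by
    rw [← hdiag, hc', map_smul, hP.diag, smul_eq_mul, mul_one]
  rw [hJj, hc', this, map_smul]

theorem jack_eq [CharZero K] {α : K} (hα : ∀ q : ℚ, q ≤ 0 → α ≠ (q : K)) {n : ℕ}
    (lam : n.Partition) : jack α lam = hook α lam • toSym (jackP α lam) := by
  have h : ∃ J : n.Partition → MvPowerSeries ℕ K, IsJackFamily α n J :=
    ⟨_, (isJackBasis_jackP hα n).isJackFamily⟩
  rw [jack, dif_pos h]
  exact IsJackFamily.eq_smul hα (isJackBasis_jackP hα n) h.choose_spec lam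

/-! ### Eigenvalues of the Laplace-Beltrami operator -/

/-- The diagonal part of the Laplace-Beltrami operator on monomials in the variables `S`. -/
def lbDiag (α : K) (S : Finset ℕ) (η : ℕ →₀ ℕ) : K :=
  α / 2 * ∑ i ∈ S, (η i : K) * ((η i : K) - 1) -
    1 / 2 * ∑ i ∈ S, ∑ j ∈ S.erase i, ((min (η i) (η j) : ℕ) : K)

/-- The strictly triangular part of the Laplace-Beltrami operator. -/
def lbSpread (S : Finset ℕ) (η : ℕ →₀ ℕ) (f : Fock K) : K :=
  1 / 2 * ∑ i ∈ S, ∑ j ∈ S.erase i, ∑ b ∈ Finset.range (min (η i) (η j)),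
    ((η i : K) + (η j : K) - 2 * (b : K)) * co (put η i j (η i + η j - b) b) f

theorem lbCoeff_eq (α : K) {S : Finset ℕ} {η : ℕ →₀ ℕ} (hS : η.support ⊆ S) (f : Fock K) :
    lbCoeff α η f = lbDiag α S η * co η f + lbSpread S η f := by
  have h0 : ∀ i j, η i = 0 ∨ η j = 0 → pairTerm η i j f = 0 := by
    intro i j h
    have : min (η i) (η j) = 0 := by omega
    rw [pairTerm, this]
    simp
  have h1 : ∑ i ∈ η.support, ∑ j ∈ η.support.erase i, pairTerm η i j f =
      ∑ i ∈ S, ∑ j ∈ S.erase i, pairTerm η i j f := by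
    rw [← Finset.sum_subset hS]
    · refine Finset.sum_congr rfl fun i _ => Finset.sum_subset (Finset.erase_subset_erase i hS) ?_
      intro j hj hj'
      refine h0 i j (Or.inr ?_)
      by_contra h
      exact hj' (Finset.mem_erase.2 ⟨Finset.ne_of_mem_erase hj, Finsupp.mem_support_iff.2 h⟩)
    · intro i _ hi
      exact Finset.sum_eq_zero fun j _ => h0 i j (Or.inl (Finsupp.notMem_support_iff.1 hi))
  have h2 : ∑ i ∈ η.support, (η i : K) * ((η i : K) - 1) * co η f =
      ∑ i ∈ S, (η i : K) * ((η i : K) - 1) * co η f := by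
    refine Finset.sum_subset hS fun i _ hi => ?_
    rw [Finsupp.notMem_support_iff.1 hi]
    simp
  rw [lbCoeff, h1, h2, lbDiag, lbSpread, ← Finset.sum_mul]
  simp only [pairTerm, Finset.sum_sub_distrib, ← Finset.sum_mul]
  ring

theorem lbSpread_eq_zero (S : Finset ℕ) {η : ℕ →₀ ℕ} {f : Fock K} {s : Multiset ℕ}
    (hf : ∀ η, co η f ≠ 0 → Below (shape η) s) (hη : Below s (shape η)) :
    lbSpread S η f = 0 := by
  rw [lbSpread, Finset.sum_eq_zero, mul_zero]
  intro i _
  refine Finset.sum_eq_zero fun j hj => Finset.sum_eq_zero fun b hb => ?_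
  rw [Finset.mem_range] at hb
  have hij := Finset.ne_of_mem_erase hj
  have : co (put η i j (η i + η j - b) b) f = 0 := by
    by_contra h
    exact not_below_put η hij.symm (by omega) (by omega) ((hf _ h).trans hη)
  rw [this, mul_zero]

theorem below_of_co_mono [CharZero K] {n : ℕ} {lam : n.Partition} {η : ℕ →₀ ℕ}
    (h : co η (mono K lam) ≠ 0) : Below (shape η) lam.parts := by
  rw [co_mono] at h
  by_cases h' : shape η = lam.parts
  · rw [h']; exact Below.refl _
  · simp [h'] at h

/-- The eigenvalues of the Laplace-Beltrami operator. -/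
def eig (α : K) {n : ℕ} (lam : n.Partition) : K := lbDiag α (Finset.range n) (rows lam)

theorem support_rows_subset {n N : ℕ} {lam : n.Partition} (h : len lam ≤ N) :
    (rows lam).support ⊆ Finset.range N := by
  rw [support_rows]; exact Finset.range_mono h

/-- Both numbers are the coefficient of `m_lam` in `D m_lam`, which depends neither on the
arrangement of the exponents nor on `S`. -/
theorem lbDiag_eq_eig [CharZero K] {α : K} (hα : α ≠ 0) {n : ℕ} {lam : n.Partition} {S : Finset ℕ}
    {η : ℕ →₀ ℕ} (hS : η.support ⊆ S) (hη : shape η = lam.parts) : lbDiag α S η = eig α lam := by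
  have key : ∀ (S : Finset ℕ) (η : ℕ →₀ ℕ), η.support ⊆ S → shape η = lam.parts →
      lbDiag α S η = co (rows lam) (lbOp α n n (mono K lam)) := by
    intro S η hS hη
    rw [co_eq_of_shape_eq (θ := η) (by rw [shape_rows, hη]), co_lbOp hα le_rfl (mono_mem lam),
      lbCoeff_eq α hS, lbSpread_eq_zero S (fun η h => below_of_co_mono h)
      (by rw [hη]; exact Below.refl _), co_mono, if_pos hη, mul_one, add_zero]
  rw [key S η hS hη, eig, key _ _ (support_rows_subset (len_le lam)) (shape_rows lam)]

theorem sum_rows {n : ℕ} (lam : n.Partition) : ∑ i ∈ Finset.range n, rows lam i = n := by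
  have := sum_map_parts lam (len_le lam) id rfl
  rw [Multiset.map_id, lam.parts_sum] at this
  exact this.symm

/-- Rows decrease, so in a pair `i < j` the minimum is row `j`; it is counted for `j` values of `i`,
in both orders. -/
theorem sum_min_rows (K : Type*) [Field K] {n : ℕ} (lam : n.Partition) :
    ∑ i ∈ Finset.range n, ∑ j ∈ (Finset.range n).erase i,
      ((min (rows lam i) (rows lam j) : ℕ) : K) =
      2 * ((∑ i ∈ Finset.range n, i * rows lam i : ℕ) : K) := by
  have h5 : ∀ m : ℕ, ∑ i ∈ Finset.range m, ∑ j ∈ (Finset.range m).erase i,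
      min (rows lam i) (rows lam j) = 2 * ∑ i ∈ Finset.range m, i * rows lam i := by
    intro m
    induction m with
    | zero => simp
    | succ m ih =>
      have h6 : ∀ i ∈ Finset.range m, ∑ j ∈ (Finset.range (m + 1)).erase i,
          min (rows lam i) (rows lam j) =
          ∑ j ∈ (Finset.range m).erase i, min (rows lam i) (rows lam j) + rows lam m := by
        intro i hi
        rw [Finset.mem_range] at hi
        rw [Finset.range_add_one, Finset.erase_insert_of_ne (by omega),
          Finset.sum_insert (by simp), add_comm,
          min_eq_right (rows_antitone lam hi.le)]
      rw [Finset.sum_range_succ, Finset.sum_congr rfl h6, Finset.sum_add_distrib, ih,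
        Finset.sum_const, Finset.card_range, smul_eq_mul, Finset.range_add_one,
        Finset.erase_insert (by simp), Finset.sum_insert (by simp)]
      have h7 : ∀ j ∈ Finset.range m, min (rows lam m) (rows lam j) = rows lam m := fun j hj =>
        min_eq_left (rows_antitone lam (Finset.mem_range.1 hj).le)
      rw [Finset.sum_congr rfl h7, Finset.sum_const, Finset.card_range, smul_eq_mul]
      ring
  have := congrArg (Nat.cast : ℕ → K) (h5 n)
  push_cast at this ⊢
  exact this

theorem eig_eq [CharZero K] (α : K) {n : ℕ} (lam : n.Partition) :
    eig α lam = α * ((∑ c ∈ Finset.range n, excess (c + 1) lam.parts : ℕ) : K) -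
      ((∑ i ∈ Finset.range n, i * rows lam i : ℕ) : K) := by
  have hle : ∀ i, rows lam i ≤ n := by
    intro i
    by_cases hi : i < n
    · conv_rhs => rw [← sum_rows lam]
      exact Finset.single_le_sum (f := fun i => rows lam i) (fun _ _ => Nat.zero_le _)
        (Finset.mem_range.2 hi)
    · rw [rows_eq_zero lam ((len_le lam).trans (not_lt.1 hi))]
      exact Nat.zero_le _
  have h1 : ∀ m N : ℕ, m ≤ N → 2 * ∑ c ∈ Finset.range N, ((m - (c + 1) : ℕ) : K) =
      (m : K) * ((m : K) - 1) := by
    intro m N hm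
    rw [← Finset.sum_subset (Finset.range_mono hm)]
    · rw [← Finset.sum_range_reflect]
      have : ∀ c ∈ Finset.range m, ((m - (m - 1 - c + 1) : ℕ) : K) = (c : K) := by
        intro c hc
        rw [Finset.mem_range] at hc
        congr 1
        omega
      rw [Finset.sum_congr rfl this]
      have h := Finset.sum_range_id_mul_two m
      have h' := congrArg (Nat.cast : ℕ → K) h
      push_cast at h'
      rcases m with _ | m
      · simp
      · simp only [Nat.add_sub_cancel] at h'
        push_cast at h' ⊢
        linear_combination h'
    · intro c _ hc
      rw [Finset.mem_range, not_lt] at hc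
      rw [show m - (c + 1) = 0 by omega, Nat.cast_zero]
  have h2 : 2 * ((∑ c ∈ Finset.range n, excess (c + 1) lam.parts : ℕ) : K) =
      ∑ i ∈ Finset.range n, (rows lam i : K) * ((rows lam i : K) - 1) := by
    have h3 : ∀ c ∈ Finset.range n, excess (c + 1) lam.parts =
        ∑ i ∈ Finset.range n, (rows lam i - (c + 1)) := fun c _ =>
      sum_map_parts lam (len_le lam) (· - (c + 1)) (Nat.zero_sub _)
    rw [Finset.sum_congr rfl h3, Finset.sum_comm]
    push_cast
    rw [Finset.mul_sum]
    exact Finset.sum_congr rfl fun i _ => h1 _ _ (hle i)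
  rw [eig, lbDiag, sum_min_rows, ← h2]
  ring

theorem eig_eq_sum [CharZero K] (α : K) {n : ℕ} (lam : n.Partition) :
    eig α lam = ∑ i ∈ Finset.range n,
      (α / 2 * ((rows lam i : K) * ((rows lam i : K) - 1)) - (i : K) * (rows lam i : K)) := by
  rw [eig, lbDiag, sum_min_rows, Finset.sum_sub_distrib, ← Finset.mul_sum]
  push_cast
  ring

/-- By `eig_eq` the eigenvalue is `α A - B` with natural numbers `A`, `B`. Descending strictly in
the order lowers `A` strictly and does not lower `B`, so equality would give `α a + b = 0` with `a >
0`. -/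
theorem eig_ne_of_below [CharZero K] {α : K} (hα : ∀ q : ℚ, q ≤ 0 → α ≠ (q : K)) {n : ℕ}
    {lam mu : n.Partition} (h : Below mu.parts lam.parts) (hne : mu ≠ lam) :
    eig α lam ≠ eig α mu := by
  have hA : ∑ c ∈ Finset.range n, excess (c + 1) mu.parts <
      ∑ c ∈ Finset.range n, excess (c + 1) lam.parts := by
    refine lt_of_le_of_ne (Finset.sum_le_sum fun c _ => h _) fun heq => hne ?_
    have h1 := (Finset.sum_eq_sum_iff_of_le fun c _ => h (c + 1)).1 heq
    apply Nat.Partition.ext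
    refine eq_of_excess_eq (fun a ha => mu.parts_pos ha) (fun a ha => lam.parts_pos ha) ?_
    have hbig : ∀ (c : ℕ) (nu : n.Partition), n ≤ c → excess c nu.parts = 0 := by
      intro c nu hc
      refine Multiset.sum_eq_zero fun x hx => ?_
      obtain ⟨a, ha, rfl⟩ := Multiset.mem_map.1 hx
      have := Multiset.le_sum_of_mem ha
      rw [nu.parts_sum] at this
      omega
    intro c
    rcases c with _ | c
    · simp [excess, mu.parts_sum, lam.parts_sum]
    · by_cases hc : c < n
      · exact h1 c (Finset.mem_range.2 hc)
      · rw [hbig _ _ (by omega), hbig _ _ (by omega)]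
  have hB : ∑ i ∈ Finset.range n, i * rows lam i ≤ ∑ i ∈ Finset.range n, i * rows mu i := by
    -- Summation by parts, which reduces the comparison of `∑ i λ_i` to dominance of partial sums.
    have h1 : ∀ (nu : n.Partition) (m : ℕ), ∑ i ∈ Finset.range m, i * rows nu i +
        ∑ i ∈ Finset.range m, ∑ k ∈ Finset.range (i + 1), rows nu k =
        m * ∑ k ∈ Finset.range m, rows nu k := by
      intro nu m
      induction m with
      | zero => simp
      | succ m ih =>
        rw [Finset.sum_range_succ, Finset.sum_range_succ (n := m)
          (f := fun i => ∑ k ∈ Finset.range (i + 1), rows nu k)]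
        rw [Finset.sum_range_succ] at *
        linarith
    have h2 := h1 lam n
    have h3 := h1 mu n
    rw [sum_rows] at h2 h3
    have h4 : ∑ i ∈ Finset.range n, ∑ k ∈ Finset.range (i + 1), rows mu k ≤
        ∑ i ∈ Finset.range n, ∑ k ∈ Finset.range (i + 1), rows lam k :=
      Finset.sum_le_sum fun i _ => h.dominance (i + 1)
    omega
  rw [eig_eq, eig_eq]
  intro heq
  refine alpha_mul_add_ne_zero hα (Nat.sub_pos_of_lt hA)
    (b := ∑ i ∈ Finset.range n, i * rows mu i - ∑ i ∈ Finset.range n, i * rows lam i) ?_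
  rw [Nat.cast_sub hA.le, Nat.cast_sub hB]
  linear_combination heq

theorem lbOp_eq_of_le [CharZero K] {α : K} (hα : α ≠ 0) {M n : ℕ} (hn : n ≤ M) {f : Fock K}
    (hf : f ∈ H K n) : lbOp α M n f = lbOp α n n f :=
  ext_co (lbOp_mem α M hf) (lbOp_mem α n hf) fun lam => by
    rw [co_lbOp hα hn hf, co_lbOp hα le_rfl hf]

theorem IsJackBasis.lbOp_eq [CharZero K] {α : K} (hα : α ≠ 0) {M n : ℕ} (hn : n ≤ M)
    {P : n.Partition → Fock K} (hP : IsJackBasis α n P) (lam : n.Partition) :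
    lbOp α M n (P lam) = eig α lam • P lam := by
  obtain ⟨T, hT⟩ : ∃ T : H K n →ₗ[K] H K n, ∀ f : H K n,
      ((T f : H K n) : Fock K) = lbOp α n n (f : Fock K) :=
    ⟨(lbOp α n n).restrict fun f hf => lbOp_mem α n hf, fun f => LinearMap.coe_restrict_apply _ f⟩
  have hTs : ∀ f g, formH α n (T f) g = formH α n f (T g) := by
    intro f g
    rw [formH_apply, formH_apply, hT, hT]
    exact lbOp_selfAdjoint α n n f g
  let := belowOrder n
  obtain ⟨c, hc⟩ := eigenvector_of_selfAdjoint (monoBasis K n) (formH α n)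
    (formH_nondegenerate hα n) (P := fun lam => ⟨P lam, hP.mem lam⟩)
    (fun l => by rw [monoBasis_repr, hP.diag]; exact one_ne_zero) hP.below hP.orthogonal
    (T := T) (fun l m h => by
      rw [monoBasis_repr, hT, coe_monoBasis, lbOp_apply, map_smul, map_sub, map_smul] at h
      change Below m.parts l.parts
      by_contra hb
      refine h ?_
      have h1 : co (rows m) (nsOp α n 3 (mono K l)) = 0 := by
        by_contra h2; exact hb ((co_rows_nsOp_mono α l m 3).1 h2)
      have h3 : co (rows m) (mono K l) = 0 := by
        by_contra h2
        have := below_of_co_mono h2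
        rw [shape_rows] at this
        exact hb this
      rw [h1, h3, smul_zero, sub_zero, smul_zero])
    hTs lam
  have hc' := congrArg (fun g : H K n => (g : Fock K)) hc
  rw [hT, Submodule.coe_smul] at hc'
  rw [lbOp_eq_of_le hα hn (hP.mem lam), hc']
  congr 1
  -- The eigenvalue is the diagonal entry: at `rows lam` all spread terms are strictly above `lam`
  -- and vanish.
  have h1 := congrArg (co (rows lam)) hc'
  rw [map_smul, hP.diag, smul_eq_mul, mul_one, co_lbOp hα le_rfl (hP.mem lam),
    lbCoeff_eq α (support_rows_subset (len_le lam)), hP.diag,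
    lbSpread_eq_zero _ (fun η h => hP.co_ne_zero h) (by rw [shape_rows]; exact Below.refl _)] at h1
  rw [← h1, eig]
  ring

end JackLB
end

/-! ### Adding a full column to a Jack function -/

noncomputable section

namespace JackLB

variable {K : Type*} [Field K]

/-! ### Removal of a full column -/

/-- The exponent vector of `x_0 x_1 ... x_(N-1)`. -/
def colVec (N : ℕ) : ℕ →₀ ℕ := ∑ i ∈ Finset.range N, Finsupp.single i 1

theorem colVec_apply (N i : ℕ) : colVec N i = if i < N then 1 else 0 := by
  classical
  rw [colVec, Finsupp.finsetSum_apply]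
  simp [Finsupp.single_apply]

theorem support_add_colVec {η : ℕ →₀ ℕ} {N : ℕ} (hη : η.support ⊆ Finset.range N) :
    (η + colVec N).support ⊆ Finset.range N := by
  intro i hi
  rw [Finsupp.mem_support_iff, Finsupp.add_apply, colVec_apply] at hi
  by_contra h
  rw [Finset.mem_range] at h
  rw [if_neg h, add_zero] at hi
  exact h (Finset.mem_range.1 (hη (Finsupp.mem_support_iff.2 hi)))

theorem excess_succ_add_colVec {η : ℕ →₀ ℕ} {N : ℕ} (hη : η.support ⊆ Finset.range N) (c : ℕ) :
    excess (c + 1) (shape (η + colVec N)) = excess c (shape η) := by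
  rw [excess_shape _ _ (support_add_colVec hη), excess_shape _ _ hη]
  refine Finset.sum_congr rfl fun i hi => ?_
  rw [Finsupp.add_apply, colVec_apply, if_pos (Finset.mem_range.1 hi)]
  omega

theorem degree_colVec (N : ℕ) : (colVec N).degree = N := by
  simp [colVec]

theorem below_add_colVec {η θ : ℕ →₀ ℕ} {N : ℕ} (hη : η.support ⊆ Finset.range N)
    (hθ : θ.support ⊆ Finset.range N) :
    Below (shape (η + colVec N)) (shape (θ + colVec N)) ↔ Below (shape η) (shape θ) := by
  constructor
  · intro h c
    have := h (c + 1)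
    rwa [excess_succ_add_colVec hη, excess_succ_add_colVec hθ] at this
  · intro h c
    rcases c with _ | c
    · have := h 0
      rw [excess_zero_shape, excess_zero_shape] at *
      rw [map_add, map_add]
      exact Nat.add_le_add_right this _
    · rw [excess_succ_add_colVec hη, excess_succ_add_colVec hθ]
      exact h c

theorem shape_add_colVec {η θ : ℕ →₀ ℕ} {N : ℕ} (hη : η.support ⊆ Finset.range N)
    (hθ : θ.support ⊆ Finset.range N) (h : shape η = shape θ) :
    shape (η + colVec N) = shape (θ + colVec N) := by
  refine Below.antisymm (fun _ => shape_pos) (fun _ => shape_pos) ?_ ?_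
  · rw [below_add_colVec hη hθ, h]; exact Below.refl _
  · rw [below_add_colVec hθ hη, h]; exact Below.refl _

theorem put_add_colVec (η : ℕ →₀ ℕ) {i j N : ℕ} (hi : i < N) (hj : j < N) (a b : ℕ) :
    put (η + colVec N) i j (a + 1) (b + 1) = put η i j a b + colVec N := by
  ext l
  simp only [put_apply, Finsupp.add_apply, colVec_apply]
  split_ifs <;> first | rfl | omega

theorem card_add_excess_one {s : Multiset ℕ} (hs : ∀ a ∈ s, 0 < a) :
    s.card + excess 1 s = excess 0 s := by
  induction s using Multiset.induction_on with
  | empty => simp [excess]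
  | cons x s ih =>
    have h1 := ih fun a ha => hs a (Multiset.mem_cons_of_mem ha)
    have h2 := hs x (Multiset.mem_cons_self x s)
    simp only [excess, Multiset.map_cons, Multiset.sum_cons, Multiset.card_cons] at h1 ⊢
    omega

/-- The number of positive parts is the excess over `0` minus the excess over `1`. Hence `P_lam`
vanishes in fewer than `ℓ(lam)` variables (`IsJackBasis.len_le_card`). -/
theorem Below.card_le {s t : Multiset ℕ} (hs : ∀ a ∈ s, 0 < a) (ht : ∀ a ∈ t, 0 < a)
    (h : Below s t) (h0 : s.sum = t.sum) : t.card ≤ s.card := by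
  have h1 := card_add_excess_one hs
  have h2 := card_add_excess_one ht
  have h3 := h 1
  have h4 : excess 0 s = s.sum := by simp [excess]
  have h5 : excess 0 t = t.sum := by simp [excess]
  omega

theorem IsJackBasis.len_le_card [CharZero K] {α : K} {n : ℕ} {P : n.Partition → Fock K}
    (hP : IsJackBasis α n P) {lam : n.Partition} {η : ℕ →₀ ℕ} (h : co η (P lam) ≠ 0) :
    len lam ≤ η.support.card := by
  have hd : η.degree = n := by
    by_contra hd
    exact h (co_eq_zero (hP.mem lam) hd)
  rw [← card_shape]
  exact (hP.co_ne_zero h).card_le (fun _ => shape_pos) (fun _ ha => lam.parts_pos ha)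
    (by rw [sum_shape, hd, lam.parts_sum])

theorem lbDiag_add_colVec [CharZero K] (α : K) {η : ℕ →₀ ℕ} {n N : ℕ}
    (hη : η.support ⊆ Finset.range N) (hd : η.degree = n) :
    lbDiag α (Finset.range N) (η + colVec N) = lbDiag α (Finset.range N) η +
      (α * (n : K) - 1 / 2 * ∑ i ∈ Finset.range N, ∑ _j ∈ (Finset.range N).erase i, (1 : K)) := by
  have h1 : ∀ i ∈ Finset.range N, (((η + colVec N) i : ℕ) : K) = (η i : K) + 1 := by
    intro i hi
    rw [Finsupp.add_apply, colVec_apply, if_pos (Finset.mem_range.1 hi)]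
    push_cast
    rfl
  have h2 : ∀ i ∈ Finset.range N, ∀ j ∈ (Finset.range N).erase i,
      ((min ((η + colVec N) i) ((η + colVec N) j) : ℕ) : K) = ((min (η i) (η j) : ℕ) : K) + 1 := by
    intro i hi j hj
    have hj' := Finset.mem_of_mem_erase hj
    rw [Finsupp.add_apply, colVec_apply, if_pos (Finset.mem_range.1 hi), Finsupp.add_apply,
      colVec_apply, if_pos (Finset.mem_range.1 hj'), min_add_add_right]
    push_cast
    rfl
  have h3 : ∑ i ∈ Finset.range N, (η i : K) = n := by
    rw [← hd, ← excess_zero_shape, excess_shape 0 η hη]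
    push_cast
    rfl
  rw [lbDiag, lbDiag, Finset.sum_congr rfl fun i hi => Finset.sum_congr rfl (h2 i hi),
    Finset.sum_congr rfl fun i hi => by rw [h1 i hi], ← h3]
  simp only [Finset.sum_add_distrib]
  have h4 : ∑ i ∈ Finset.range N, ((η i : K) + 1) * ((η i : K) + 1 - 1) =
      ∑ i ∈ Finset.range N, (η i : K) * ((η i : K) - 1) + 2 * ∑ i ∈ Finset.range N, (η i : K) := by
    rw [Finset.mul_sum, ← Finset.sum_add_distrib]
    exact Finset.sum_congr rfl fun i _ => by ring
  rw [h4]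
  ring

theorem IsJackBasis.eig_mul_co [CharZero K] {α : K} (hα : α ≠ 0) {n : ℕ} {P : n.Partition → Fock K}
    (hP : IsJackBasis α n P) (lam : n.Partition) {S : Finset ℕ} {η : ℕ →₀ ℕ} (hS : η.support ⊆ S) :
    eig α lam * co η (P lam) = lbDiag α S η * co η (P lam) + lbSpread S η (P lam) := by
  have h := co_lbOp hα le_rfl (hP.mem lam) η
  rwa [hP.lbOp_eq hα le_rfl, map_smul, smul_eq_mul, lbCoeff_eq α hS] at h

/-- The eigenvalue equation determines a coefficient from those of strictly more spread exponents,
since `eig lam - eig mu ≠ 0` below `lam`. Adding a column shifts every diagonal entry by the same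
constant and preserves the spread part, so both sides solve the same recursion downward from `lam`.
-/
theorem IsJackBasis.co_add_colVec [CharZero K] {α : K} (hα : ∀ q : ℚ, q ≤ 0 → α ≠ (q : K))
    {n n' N : ℕ} {P : n.Partition → Fock K} {P' : n'.Partition → Fock K} (hP : IsJackBasis α n P)
    (hP' : IsJackBasis α n' P') {lam : n.Partition} {lam' : n'.Partition} (hN : len lam ≤ N)
    (hrows : rows lam' = rows lam + colVec N) {η : ℕ →₀ ℕ} (hη : η.support ⊆ Finset.range N) :
    co (η + colVec N) (P' lam') = co η (P lam) := by
  have hα0 := alpha_ne_zero hα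
  have hn' : n' = n + N := by
    rw [← degree_rows lam', hrows, map_add, degree_rows, degree_colVec]
  have hlam : (rows lam).support ⊆ Finset.range N := support_rows_subset hN
  have hlen : len lam' = N := by
    have h := support_rows lam'
    rw [len, ← shape_rows, card_shape, hrows]
    have : (rows lam + colVec N).support = Finset.range N := by
      refine subset_antisymm (support_add_colVec hlam) fun i hi => ?_
      rw [Finsupp.mem_support_iff, Finsupp.add_apply, colVec_apply,
        if_pos (Finset.mem_range.1 hi)]
      exact Nat.succ_ne_zero _
    rw [this, Finset.card_range]
  have hbelow : ∀ η : ℕ →₀ ℕ, η.support ⊆ Finset.range N →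
      (Below (shape (η + colVec N)) lam'.parts ↔ Below (shape η) lam.parts) := by
    intro η hη
    rw [← shape_rows lam', hrows, below_add_colVec hη hlam, shape_rows]
  by_cases hd : η.degree = n
  swap
  · rw [co_eq_zero (hP.mem lam) hd, co_eq_zero (hP'.mem lam')]
    rw [map_add, degree_colVec]
    omega
  let := belowOrder n
  have key : ∀ mu : n.Partition, ∀ η : ℕ →₀ ℕ, η.support ⊆ Finset.range N → shape η = mu.parts →
      co (η + colVec N) (P' lam') = co η (P lam) := by
    intro mu
    induction mu using WellFoundedGT.induction with
    | _ mu ih =>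
      intro η hη hmu
      have hd : η.degree = n := by rw [← sum_shape, hmu, mu.parts_sum]
      by_cases hb : Below (shape η) lam.parts
      swap
      · have h1 : co η (P lam) = 0 := by
          by_contra h; exact hb (hP.co_ne_zero h)
        have h2 : co (η + colVec N) (P' lam') = 0 := by
          by_contra h; exact hb ((hbelow η hη).1 (hP'.co_ne_zero h))
        rw [h1, h2]
      by_cases hl : mu = lam
      · rw [hP.co_eq_one (by rw [hmu, hl]), hP'.co_eq_one]
        rw [← shape_rows lam', hrows]
        exact shape_add_colVec hη hlam (by rw [hmu, hl, shape_rows])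
      · have e1 := hP.eig_mul_co hα0 lam hη
        have e2 := hP'.eig_mul_co hα0 lam' (support_add_colVec hη)
        have e3 : eig α lam' = eig α lam +
            (α * (n : K) -
              1 / 2 * ∑ i ∈ Finset.range N, ∑ _j ∈ (Finset.range N).erase i, (1 : K)) := by
          rw [← lbDiag_eq_eig hα0 (support_add_colVec hlam) (by rw [← hrows, shape_rows]),
            lbDiag_add_colVec α hlam (degree_rows lam),
            lbDiag_eq_eig hα0 hlam (shape_rows lam)]
        have e4 : lbSpread (Finset.range N) (η + colVec N) (P' lam') =
            lbSpread (Finset.range N) η (P lam) := by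
          rw [lbSpread, lbSpread]
          congr 1
          refine Finset.sum_congr rfl fun i hi => Finset.sum_congr rfl fun j hj => ?_
          have hij := (Finset.ne_of_mem_erase hj).symm
          have hi' := Finset.mem_range.1 hi
          have hj' := Finset.mem_range.1 (Finset.mem_of_mem_erase hj)
          have hci : (η + colVec N) i = η i + 1 := by
            rw [Finsupp.add_apply, colVec_apply, if_pos hi']
          have hcj : (η + colVec N) j = η j + 1 := by
            rw [Finsupp.add_apply, colVec_apply, if_pos hj']
          rw [hci, hcj, min_add_add_right, Finset.sum_range_succ']
          -- The spread sum for `η + colVec N` has one extra term, `b = 0`. It removes a variable,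
          -- while `P' lam'` has no monomial in fewer than `N` variables.
          have hz : co (put (η + colVec N) i j (η i + 1 + (η j + 1) - 0) 0) (P' lam') = 0 := by
            by_contra h
            have h1 := hP'.len_le_card h
            have h2 : (put (η + colVec N) i j (η i + 1 + (η j + 1) - 0) 0).support ⊆
                (Finset.range N).erase j := by
              intro l hl
              rw [Finsupp.mem_support_iff, put_apply] at hl
              split_ifs at hl with h3 h4
              · exact absurd rfl hl
              · rw [h4]; exact Finset.mem_erase.2 ⟨hij, hi⟩
              · exact Finset.mem_erase.2 ⟨h3, support_add_colVec hη (Finsupp.mem_support_iff.2 hl)⟩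
            have h3 := Finset.card_le_card h2
            rw [Finset.card_erase_of_mem (Finset.mem_of_mem_erase hj), Finset.card_range] at h3
            omega
          rw [hz, mul_zero, add_zero]
          refine Finset.sum_congr rfl fun b hb => ?_
          rw [Finset.mem_range] at hb
          rw [show η i + 1 + (η j + 1) - (b + 1) = (η i + η j - b) + 1 by omega,
            put_add_colVec η hi' hj']
          have hdp : (put η i j (η i + η j - b) b).degree = n := by
            rw [degree_put η hij (by omega), hd]
          rw [ih (ofShape _ hdp) (lt_of_le_not_ge ?_ ?_) _ ?_ rfl]
          · push_cast
            ring
          · change Below mu.parts (shape _)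
            rw [← hmu]
            exact below_put η hij (by omega) (by omega)
          · change ¬ Below (shape _) mu.parts
            rw [← hmu]
            exact not_below_put η hij (by omega) (by omega)
          · intro l hl
            have := support_put_subset η i j _ _ hl
            simp only [Finset.mem_insert] at this
            rcases this with rfl | rfl | h
            · exact hi
            · exact Finset.mem_of_mem_erase hj
            · exact hη h
        rw [e4, e3, lbDiag_add_colVec α hη hd] at e2
        have e5 := lbDiag_eq_eig hα0 hη hmu
        rw [e5] at e1 e2
        have hne := eig_ne_of_below hα (by rwa [← hmu] : Below mu.parts lam.parts) hl
        have e6 : (eig α lam - eig α mu) * (co (η + colVec N) (P' lam') - co η (P lam)) = 0 := by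
          linear_combination e2 - e1
        exact sub_eq_zero.1 ((mul_eq_zero.1 e6).resolve_left (sub_ne_zero.2 hne))
  exact key (ofShape η hd) η hη rfl

end JackLB
end

/-! ### The branching rule for multiplication by `p_1` -/

noncomputable section

namespace JackLB

open MvPolynomial (pderiv)

variable {K : Type*} [Field K]

/-! ### The branching rule -/

/-- In the chain rule for `x_j ∂_j`, the part linear in `x_j` comes only from `p_1`; symmetry
reduces to `j = 0`. -/
theorem co_pderiv_zero {n : ℕ} {f : Fock K} (hf : f ∈ H K n) {m : ℕ →₀ ℕ} {j : ℕ} (hm : m j = 0) :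
    co m (pderiv 0 f) = co (m + Finsupp.single j 1) f := by
  classical
  have h0 : ∀ m : ℕ →₀ ℕ, m 0 = 0 → co m (pderiv 0 f) = co (m + Finsupp.single 0 1) f := by
    intro m hm
    have h1 := congrArg (MvPowerSeries.coeff (m + Finsupp.single 0 1))
      (X_mul_pderiv_toSym (Nat.le_succ n) hf)
    rw [coeff_X_mul_pderiv, Finsupp.add_apply, hm, Finsupp.single_eq_same, zero_add, Nat.cast_one,
      one_mul, map_sum, Finset.sum_eq_single 0] at h1
    · rw [co_apply, co_apply, h1, map_smul, coeff_X_pow_mul, if_pos (by simp [hm])]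
      simp
    · intro i _ hi
      rw [map_smul, coeff_X_pow_mul, if_neg, smul_zero]
      rw [Finsupp.add_apply, hm, Finsupp.single_eq_same]
      omega
    · simp
  have h1 : (Finsupp.embDomain (Equiv.swap 0 j).toEmbedding m) 0 = 0 := by
    have := Finsupp.embDomain_apply_self (Equiv.swap 0 j).toEmbedding m j
    rw [Equiv.coe_toEmbedding, Equiv.swap_apply_right] at this
    rw [this, hm]
  rw [← co_embDomain (Equiv.swap 0 j).toEmbedding m, h0 _ h1,
    ← co_embDomain (Equiv.swap 0 j).toEmbedding (m + _)]
  congr 1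
  rw [Finsupp.embDomain_eq_mapDomain, Finsupp.embDomain_eq_mapDomain, Finsupp.mapDomain_add,
    Finsupp.mapDomain_single, Equiv.coe_toEmbedding, Equiv.swap_apply_right]

theorem len_eq_of_rows {n n' N : ℕ} {lam : n.Partition} {lam' : n'.Partition} (hN : len lam ≤ N)
    (h : rows lam' = rows lam + colVec N) : len lam' = N := by
  apply le_antisymm
  · by_contra hlt
    refine (rows_pos_iff lam' N).2 (not_le.1 hlt) ?_
    rw [h, Finsupp.add_apply, rows_eq_zero lam hN, colVec_apply, if_neg (lt_irrefl N)]
  · by_contra hlt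
    have h1 := rows_eq_zero lam' (le_refl (len lam'))
    rw [h, Finsupp.add_apply, colVec_apply, if_pos (not_le.1 hlt)] at h1
    omega

theorem exists_rows_eq_add_colVec {n : ℕ} (lam : n.Partition) :
    ∃ k, n = k + len lam ∧ ∃ lam' : k.Partition, rows lam = rows lam' + colVec (len lam) ∧
      len lam' ≤ len lam := by
  have hle : rows lam - colVec (len lam) + colVec (len lam) = rows lam := by
    ext i
    rw [Finsupp.add_apply, Finsupp.tsub_apply, colVec_apply]
    split_ifs with h
    · have := Nat.pos_of_ne_zero ((rows_pos_iff lam i).2 h)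
      omega
    · omega
  have hanti : Antitone (rows lam - colVec (len lam)) := by
    intro i j hij
    rw [Finsupp.tsub_apply, Finsupp.tsub_apply, colVec_apply, colVec_apply]
    have h := rows_antitone lam hij
    split_ifs with h1 h2
    · omega
    · omega
    · rw [rows_eq_zero lam (not_lt.1 h1)]; omega
    · omega
  have hrows := rows_ofShape (h := rfl) hanti
  refine ⟨(rows lam - colVec (len lam)).degree, ?_, ofShape _ rfl, ?_, ?_⟩
  · have := congrArg Finsupp.degree hle
    rw [map_add, degree_colVec, degree_rows] at this
    exact this.symm
  · rw [hrows, hle]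
  · by_contra hlt
    refine (rows_pos_iff _ _).2 (not_le.1 hlt) ?_
    rw [hrows, Finsupp.tsub_apply, rows_eq_zero lam le_rfl, Nat.zero_sub]

theorem exists_rows_add_colVec {k n N : ℕ} (hn : n = k + N) (lam : k.Partition) :
    ∃ lam' : n.Partition, rows lam' = rows lam + colVec N := by
  refine ⟨ofShape (rows lam + colVec N) ?_, rows_ofShape _ ?_⟩
  · rw [map_add, degree_rows, degree_colVec, hn]
  · intro i j hij
    rw [Finsupp.add_apply, Finsupp.add_apply, colVec_apply, colVec_apply]
    have h := rows_antitone lam hij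
    split_ifs <;> omega

/-- Having more than `L` parts defines a lower set for `Below`. So `f` is a combination of those `P
lam` alone, and orthogonality finishes. In effect, pairings with `P mu` may be computed after
restriction to `ℓ(mu)` variables. -/
theorem IsJackBasis.form_eq_zero [CharZero K] {α : K} {n : ℕ}
    {P : n.Partition → Fock K} (hP : IsJackBasis α n P) {f : Fock K} (hf : f ∈ H K n) {L : ℕ}
    (h : ∀ mu : n.Partition, len mu ≤ L → co (rows mu) f = 0) {mu : n.Partition} (hmu : len mu ≤ L) :
    form α f (P mu) = 0 := by
  let := belowOrder n
  obtain ⟨c, hc, hc2⟩ := exists_triangular_expansion (monoBasis K n)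
    (P := fun lam => ⟨P lam, hP.mem lam⟩) (D := {mu | L < len mu})
    (fun l => by rw [monoBasis_repr, hP.diag]; exact one_ne_zero) hP.below
    (fun a b hab ha => lt_of_lt_of_le (show L < len a from ha)
      (Below.card_le (fun _ h => b.parts_pos h) (fun _ h => a.parts_pos h) hab
        (by rw [a.parts_sum, b.parts_sum])))
    (f := ⟨f, hf⟩) (fun m hm => by
      by_contra h2
      exact hm (h m (not_lt.1 h2)))
  have hc' : f = ∑ lam, c lam • P lam := by
    have := congrArg (fun g : H K n => (g : Fock K)) hc
    simpa [Submodule.coe_sum] using this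
  rw [hc', map_sum, LinearMap.sum_apply]
  refine Finset.sum_eq_zero fun lam _ => ?_
  rw [map_smul, LinearMap.smul_apply]
  by_cases hl : lam = mu
  · have : c lam = 0 := by
      by_contra h3
      have : L < len lam := hc2 lam h3
      rw [hl] at this
      omega
    rw [this, zero_smul]
  · rw [hP.orthogonal lam mu hl, smul_zero]

theorem form_X_zero_mul (α : K) (f g : Fock K) :
    form α (MvPolynomial.X 0 * f) g = α * form α f (pderiv 0 g) := by
  rw [form_X_mul, map_smul, zero_add, Nat.cast_one, mul_one, smul_eq_mul]

theorem add_single_support {m : ℕ →₀ ℕ} {j : ℕ} :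
    (m + Finsupp.single j 1).support ⊆ insert j m.support := by
  intro i hi
  rw [Finsupp.mem_support_iff, Finsupp.add_apply] at hi
  rw [Finset.mem_insert, Finsupp.mem_support_iff]
  by_contra h
  push Not at h
  rw [h.2, Finsupp.single_eq_of_ne h.1] at hi
  exact hi rfl

section

variable [CharZero K] {α : K}

theorem co_rows_eq_zero (hα : ∀ q : ℚ, q ≤ 0 → α ≠ (q : K)) {n : ℕ} {lam : n.Partition}
    {η : ℕ →₀ ℕ} {S : Finset ℕ} (hS : η.support ⊆ S) (h : S.card < len lam) :
    co η (jackP α lam) = 0 := by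
  by_contra h2
  have := (isJackBasis_jackP hα n).len_le_card h2
  have := Finset.card_le_card hS
  omega

/-- Strip the first column of `lam`, of height `L + 1`, to get `lam'`. Restricted to `L` variables,
`∂P_lam/∂p_1` is `x_1 ... x_L P_lam'`. If `lam'` has at most `L` parts this is the restriction of
`P_nu`, `nu` being `lam'` with a column of height `L` added; otherwise it is `0`. A nonzero pairing
with `P_mu` thus forces `nu = mu`. -/
theorem rows_of_branching_of_len_succ (hα : ∀ q : ℚ, q ≤ 0 → α ≠ (q : K)) {n : ℕ}
    {mu : n.Partition} {lam : (n + 1).Partition} (hlen : len lam = len mu + 1)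
    (h : form α (pderiv 0 (jackP α lam)) (jackP α mu) ≠ 0) :
    rows lam = rows mu + Finsupp.single (len mu) 1 := by
  have hJ := fun n => isJackBasis_jackP hα n
  set L := len mu with hL
  obtain ⟨k, hk, lam', hlam', hlen'⟩ := exists_rows_eq_add_colVec lam
  rw [hlen] at hlam' hlen' hk
  have hmem : pderiv 0 (jackP α lam) ∈ H K n := pderiv_mem_H ((hJ _).mem lam)
  have hsmall : ∀ mu' : n.Partition, len mu' < L → co (rows mu') (pderiv 0 (jackP α lam)) = 0 := by
    intro mu' hmu'
    rw [co_pderiv_zero ((hJ _).mem lam) (rows_eq_zero mu' le_rfl)]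
    refine co_rows_eq_zero hα (add_single_support.trans
      (Finset.insert_subset_insert _ (support_rows_subset le_rfl))) ?_
    refine lt_of_le_of_lt (Finset.card_insert_le _ _) ?_
    rw [Finset.card_range]
    omega
  have heq : ∀ mu' : n.Partition, len mu' = L → ∃ θ : ℕ →₀ ℕ, θ.support ⊆ Finset.range L ∧
      rows mu' = θ + colVec L ∧
      co (rows mu') (pderiv 0 (jackP α lam)) = co θ (jackP α lam') := by
    intro mu' hmu'
    obtain ⟨k', -, mu'', h1, h2⟩ := exists_rows_eq_add_colVec mu'
    rw [hmu'] at h1 h2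
    have hs := support_rows_subset h2
    refine ⟨rows mu'', hs, h1, ?_⟩
    rw [co_pderiv_zero ((hJ _).mem lam) (rows_eq_zero mu' hmu'.le), h1,
      ← (hJ _).co_add_colVec hα (hJ _) hlen' hlam'
      (hs.trans (Finset.range_mono (Nat.le_succ L))), colVec, colVec, Finset.sum_range_succ,
      add_assoc]
  by_cases hl : len lam' ≤ L
  · obtain ⟨nu, hnu⟩ := exists_rows_add_colVec (show n = k + L by omega) lam'
    have hnul := len_eq_of_rows hl hnu
    have h0 := (hJ n).form_eq_zero (L := L)
      (f := pderiv 0 (jackP α lam) - jackP α nu) (Submodule.sub_mem _ hmem ((hJ n).mem nu))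
      (fun mu' hmu' => by
        rw [map_sub, sub_eq_zero]
        rcases hmu'.lt_or_eq with hlt | he
        · rw [hsmall mu' hlt, co_rows_eq_zero hα (support_rows_subset le_rfl)]
          rw [Finset.card_range]
          omega
        · obtain ⟨θ, h1, h2, h3⟩ := heq mu' he
          rw [h3, h2, (hJ _).co_add_colVec hα (hJ _) hl hnu h1])
      (mu := mu) le_rfl
    rw [map_sub, LinearMap.sub_apply, sub_eq_zero] at h0
    rw [h0] at h
    have hnm : nu = mu := by
      by_contra h2
      exact h ((hJ n).orthogonal nu mu h2)
    rw [← hnm, hlam', hnu, colVec, colVec, Finset.sum_range_succ, add_assoc]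
  · exfalso
    refine h ((hJ n).form_eq_zero hmem (L := L) (fun mu' hmu' => ?_) le_rfl)
    rcases hmu'.lt_or_eq with hlt | he
    · exact hsmall mu' hlt
    · obtain ⟨θ, h1, h2, h3⟩ := heq mu' he
      rw [h3, co_rows_eq_zero hα h1]
      rw [Finset.card_range]
      omega

theorem len_le_of_branching (hα : ∀ q : ℚ, q ≤ 0 → α ≠ (q : K)) {n : ℕ}
    {mu : n.Partition} {lam : (n + 1).Partition}
    (h : form α (pderiv 0 (jackP α lam)) (jackP α mu) ≠ 0) : len lam ≤ len mu + 1 := by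
  by_contra hlt
  refine h ((isJackBasis_jackP hα n).form_eq_zero
    (pderiv_mem_H ((isJackBasis_jackP hα _).mem lam)) (L := len mu) (fun mu' hmu' => ?_) le_rfl)
  rw [co_pderiv_zero ((isJackBasis_jackP hα _).mem lam) (rows_eq_zero mu' le_rfl)]
  refine co_rows_eq_zero hα (add_single_support.trans
    (Finset.insert_subset_insert _ (support_rows_subset le_rfl))) ?_
  refine lt_of_le_of_lt (Finset.card_insert_le _ _) ?_
  rw [Finset.card_range]
  omega

theorem co_X_zero_mul_eq_zero (hα : ∀ q : ℚ, q ≤ 0 → α ≠ (q : K)) {n : ℕ} {mu : n.Partition}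
    {lam : (n + 1).Partition} (h : len lam < len mu) :
    co (rows lam) (MvPolynomial.X 0 * jackP α mu) = 0 := by
  rw [co_X_mul _ _ (support_rows_subset le_rfl)]
  refine Finset.sum_eq_zero fun j _ => ?_
  split_ifs
  · refine co_rows_eq_zero hα (S := Finset.range (len lam)) ?_ (by rwa [Finset.card_range])
    exact subset_trans (Finsupp.support_tsub) (support_rows_subset le_rfl)
  · rfl

theorem len_ge_of_branching (hα : ∀ q : ℚ, q ≤ 0 → α ≠ (q : K)) {n : ℕ}
    {mu : n.Partition} {lam : (n + 1).Partition}
    (h : form α (MvPolynomial.X 0 * jackP α mu) (jackP α lam) ≠ 0) : len mu ≤ len lam := by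
  by_contra hlt
  refine h ((isJackBasis_jackP hα (n + 1)).form_eq_zero
    (X_mul_mem_H ((isJackBasis_jackP hα _).mem mu)) (L := len lam) (fun lam' hlam' => ?_) le_rfl)
  exact co_X_zero_mul_eq_zero hα (by omega)

/-- In `N = ℓ(mu)` variables, `p_1 P_mu = x_1 ... x_N p_1 P_mu'` with `mu'` the result of removing
the first column. Expanding `p_1 P_mu'` and restoring the column reduces the claim to the smaller
degree `k`. -/
theorem rows_of_branching_of_len_eq (hα : ∀ q : ℚ, q ≤ 0 → α ≠ (q : K)) {n : ℕ}
    {mu : n.Partition} {lam : (n + 1).Partition} (hlen : len lam = len mu)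
    (h : form α (MvPolynomial.X 0 * jackP α mu) (jackP α lam) ≠ 0)
    (ih : ∀ k < n, ∀ (mu : k.Partition) (lam : (k + 1).Partition),
      form α (MvPolynomial.X 0 * jackP α mu) (jackP α lam) ≠ 0 →
      ∃ r, rows lam = rows mu + Finsupp.single r 1) :
    ∃ r, rows lam = rows mu + Finsupp.single r 1 := by
  classical
  have hα0 := alpha_ne_zero hα
  have hJ := fun n => isJackBasis_jackP hα n
  obtain ⟨k, hk, mu', hmu', hlen'⟩ := exists_rows_eq_add_colVec mu
  set N := len mu with hNdef
  -- `lam` has positive size and as many parts as `mu`, so the removed column is nonempty and the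
  -- degree really drops.
  have hN : N ≠ 0 := by
    intro h0
    have h1 := sum_map_parts lam (le_of_eq (hlen.trans h0)) id rfl
    rw [Multiset.map_id, lam.parts_sum] at h1
    simp at h1
  -- For `kap` with more than `N` parts a column of height `N` cannot be added; `lam` serves as a
  -- dummy value, and such terms get coefficient `0` in `g`.
  have hext : ∀ kap : (k + 1).Partition, ∃ lam' : (n + 1).Partition, len kap ≤ N →
      rows lam' = rows kap + colVec N := by
    intro kap
    by_cases hl : len kap ≤ N
    · obtain ⟨l, hl'⟩ := exists_rows_add_colVec (show n + 1 = (k + 1) + N by omega) kap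
      exact ⟨l, fun _ => hl'⟩
    · exact ⟨lam, fun h => absurd h hl⟩
  choose ext hext using hext
  have hX := (hJ (k + 1)).eq_sum hα0 (X_mul_mem_H ((hJ k).mem mu') (i := 0))
  set c : (k + 1).Partition → K := fun kap =>
    form α (MvPolynomial.X 0 * jackP α mu') (jackP α kap) /
      form α (jackP α kap) (jackP α kap) with hc
  set g : Fock K := ∑ kap, (if len kap ≤ N then c kap else 0) • jackP α (ext kap) with hg
  have hgm : g ∈ H K (n + 1) := Submodule.sum_mem _ fun kap _ =>
    Submodule.smul_mem _ _ ((hJ _).mem _)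
  have h0 := (hJ (n + 1)).form_eq_zero (L := N) (f := MvPolynomial.X 0 * jackP α mu - g)
    (Submodule.sub_mem _ (X_mul_mem_H ((hJ n).mem mu)) hgm)
    (fun lam' hl => by
      rw [map_sub, sub_eq_zero, hg, map_sum]
      simp only [map_smul, smul_eq_mul]
      rcases hl.lt_or_eq with hlt | he
      · rw [co_X_zero_mul_eq_zero hα hlt, eq_comm]
        refine Finset.sum_eq_zero fun kap _ => ?_
        split_ifs with hkl
        · rw [co_rows_eq_zero hα (support_rows_subset le_rfl), mul_zero]
          rw [Finset.card_range, len_eq_of_rows hkl (hext kap hkl)]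
          exact hlt
        · rw [zero_mul]
      · obtain ⟨k', -, th, h1, h2⟩ := exists_rows_eq_add_colVec lam'
        rw [he] at h1 h2
        have hs := support_rows_subset h2
        rw [h1]
        have e1 : co (rows th + colVec N) (MvPolynomial.X 0 * jackP α mu) =
            co (rows th) (MvPolynomial.X 0 * jackP α mu') := by
          rw [co_X_mul _ _ (support_add_colVec hs), co_X_mul _ _ hs]
          refine Finset.sum_congr rfl fun j hj => ?_
          have hj' := Finset.mem_range.1 hj
          have hjv : (rows th + colVec N) j = rows th j + 1 := by
            rw [Finsupp.add_apply, colVec_apply, if_pos hj']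
          rw [hjv, if_pos (Nat.le_add_left _ _)]
          split_ifs with hj1
          · have : rows th + colVec N - Finsupp.single j (0 + 1) =
                (rows th - Finsupp.single j (0 + 1)) + colVec N := by
              ext l
              simp only [Finsupp.tsub_apply, Finsupp.add_apply, Finsupp.single_apply]
              split_ifs with h3
              · subst h3; omega
              · omega
            rw [this, (hJ k).co_add_colVec hα (hJ n) hlen' hmu'
              (subset_trans Finsupp.support_tsub hs)]
          -- Here `x_j` has exponent `1` and removing it leaves fewer than `N` variables, too few
          -- for `P_mu`.
          · refine co_rows_eq_zero hα (S := (Finset.range N).erase j) ?_ ?_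
            · intro l hl
              rw [Finsupp.mem_support_iff, Finsupp.tsub_apply] at hl
              refine Finset.mem_erase.2 ⟨?_, ?_⟩
              · rintro rfl
                rw [hjv, Finsupp.single_eq_same] at hl
                omega
              · apply support_add_colVec hs
                rw [Finsupp.mem_support_iff]
                omega
            · rw [Finset.card_erase_of_mem hj, Finset.card_range]
              omega
        rw [e1, hX, map_sum]
        refine Finset.sum_congr rfl fun kap _ => ?_
        rw [map_smul, smul_eq_mul]
        split_ifs with hkl
        · rw [(hJ (k + 1)).co_add_colVec hα (hJ (n + 1)) hkl (hext kap hkl) hs]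
        · rw [co_rows_eq_zero hα hs, mul_zero, zero_mul]
          rw [Finset.card_range]
          omega)
    (mu := lam) hlen.le
  rw [map_sub, LinearMap.sub_apply, sub_eq_zero] at h0
  rw [h0, hg, map_sum, LinearMap.sum_apply] at h
  obtain ⟨kap, -, hkap⟩ := Finset.exists_ne_zero_of_sum_ne_zero h
  rw [map_smul, LinearMap.smul_apply, smul_eq_mul] at hkap
  have h1 := left_ne_zero_of_mul hkap
  have hkl : len kap ≤ N := by
    by_contra h2
    exact h1 (if_neg h2)
  rw [if_pos hkl] at h1
  have h2 : ext kap = lam := by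
    by_contra h3
    exact right_ne_zero_of_mul hkap ((hJ _).orthogonal _ _ h3)
  obtain ⟨r, hr⟩ := ih k (by omega) mu' kap (fun h3 => h1 (by
    simp only [hc]
    rw [h3, zero_div]))
  refine ⟨r, ?_⟩
  rw [← h2, hext kap hkl, hr, hmu', add_right_comm]

theorem rows_of_branching (hα : ∀ q : ℚ, q ≤ 0 → α ≠ (q : K)) {n : ℕ}
    (mu : n.Partition) (lam : (n + 1).Partition)
    (h : form α (MvPolynomial.X 0 * jackP α mu) (jackP α lam) ≠ 0) :
    ∃ r, rows lam = rows mu + Finsupp.single r 1 := by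
  induction n using Nat.strong_induction_on with
  | _ n ih =>
    have h1 := h
    rw [form_X_zero_mul, form_symm] at h1
    have h2 := right_ne_zero_of_mul h1
    have h3 := len_le_of_branching hα h2
    have h4 := len_ge_of_branching hα h
    by_cases h5 : len lam = len mu
    · exact rows_of_branching_of_len_eq hα h5 h ih
    · exact ⟨_, rows_of_branching_of_len_succ hα (by omega) h2⟩

end

end JackLB
end

/-! ### Principal specialization by the content product -/

noncomputable section

namespace JackLB

open MvPolynomial (pderiv)

variable {K : Type*} [Field K]

/-! ### Principal specialization -/

/-- The specialization of all power sums to one indeterminate. -/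
def spec : Fock K →ₐ[K] Polynomial K := MvPolynomial.aeval fun _ => Polynomial.X

theorem spec_X (i : ℕ) : spec (MvPolynomial.X i : Fock K) = Polynomial.X := by simp [spec]

theorem spec_monomial (d : ℕ →₀ ℕ) (c : K) :
    spec (MvPolynomial.monomial d c) = c • Polynomial.X ^ d.degree := by
  rw [spec, MvPolynomial.aeval_monomial, Algebra.smul_def, Finsupp.prod,
    Finset.prod_pow_eq_pow_sum]
  rfl

theorem spec_euler_monomial {n M : ℕ} (hn : n ≤ M) (lam : n.Partition) :
    (n : K) • spec (MvPolynomial.monomial (ex lam) 1) = ∑ i ∈ Finset.range M,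
      ((i + 1 : ℕ) : K) •
        (Polynomial.X * spec (pderiv i (MvPolynomial.monomial (ex lam) (1 : K)))) := by
  set d := ex lam with hd
  have h1 : ∀ i, Polynomial.X * spec (pderiv i (MvPolynomial.monomial d (1 : K))) =
      (d i : K) • Polynomial.X ^ d.degree := by
    intro i
    rw [MvPolynomial.pderiv_monomial, spec_monomial, one_mul]
    by_cases h : d i = 0
    · simp [h]
    · rw [mul_smul_comm, ← pow_succ']
      congr 2
      have h2 : d - Finsupp.single i 1 + Finsupp.single i 1 = d :=
        tsub_add_cancel_of_le (Finsupp.single_le_iff.2 (Nat.pos_of_ne_zero h))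
      conv_rhs => rw [← h2]
      rw [map_add, Finsupp.degree_single]
  have hw : ∑ i ∈ Finset.range M, (i + 1) * d i = n := by
    rw [← weight_ex lam, ← hd, Finsupp.weight_apply]
    have hs : d.support ⊆ Finset.range M := by
      intro i hi
      have h3 : d i * wt i ≤ Finsupp.weight wt d := by
        rw [Finsupp.weight_apply]
        exact Finset.single_le_sum (f := fun i => d i • wt i) (fun _ _ => Nat.zero_le _) hi
      rw [hd, weight_ex] at h3
      have h4 := Nat.pos_of_ne_zero (Finsupp.mem_support_iff.1 hi)
      rw [← hd] at h3
      have h5 : wt i ≤ d i * wt i := Nat.le_mul_of_pos_left _ h4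
      simp only [wt] at h3 h5
      rw [Finset.mem_range]
      omega
    rw [Finsupp.sum_of_support_subset _ hs _ (by simp)]
    exact Finset.sum_congr rfl fun i _ => by rw [wt, smul_eq_mul, mul_comm]
  simp only [h1, smul_smul]
  rw [← Finset.sum_smul, spec_monomial, one_smul]
  congr 1
  rw [← hw]
  push_cast
  rfl

theorem spec_euler {n M : ℕ} (hn : n ≤ M) {f : Fock K} (hf : f ∈ H K n) :
    (n : K) • spec f = ∑ i ∈ Finset.range M,
      ((i + 1 : ℕ) : K) • (Polynomial.X * spec (pderiv i f)) := by
  rw [eq_sum_monomial hf]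
  simp only [map_sum, pderiv_smul, map_smul, Finset.mul_sum, mul_smul_comm, Finset.smul_sum]
  rw [Finset.sum_comm]
  refine Finset.sum_congr rfl fun lam _ => ?_
  rw [smul_comm, spec_euler_monomial hn, Finset.smul_sum]
  refine Finset.sum_congr rfl fun i _ => ?_
  rw [smul_comm]

/-- Once all power sums equal `X`, the factor `X` in Euler's identity may be read as `p_k` in front
of `∂/∂p_(k+1)`. The terms beyond the first then form `lowerOp`. -/
theorem spec_recursion {n M : ℕ} (hn : n ≤ M) (hM : 1 ≤ M) {f : Fock K} (hf : f ∈ H K n) :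
    (n : K) • spec f = Polynomial.X * spec (pderiv 0 f) + spec (lowerOp M f) := by
  obtain ⟨M, rfl⟩ : ∃ m, M = m + 1 := ⟨M - 1, by omega⟩
  rw [spec_euler hn hf, Finset.sum_range_succ', lowerOp_apply, map_sum, add_comm]
  congr 1
  · simp
  · refine Finset.sum_congr rfl fun j _ => ?_
    rw [map_smul, map_mul, spec_X]

/-- The product of the factors `X + α j - i` over the boxes `(i, j)` of a diagram with the given
row lengths. -/
def contentPoly (α : K) (η : ℕ →₀ ℕ) : Polynomial K :=
  η.prod fun i a => ∏ j ∈ Finset.range a,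
    (Polynomial.X + Polynomial.C (α * (j : K) - (i : K)))

theorem contentPoly_eq (α : K) {η : ℕ →₀ ℕ} {S : Finset ℕ} (hS : η.support ⊆ S) :
    contentPoly α η = ∏ i ∈ S, ∏ j ∈ Finset.range (η i),
      (Polynomial.X + Polynomial.C (α * (j : K) - (i : K))) :=
  Finsupp.prod_of_support_subset η hS _ (by simp)

theorem contentPoly_add_single (α : K) (η : ℕ →₀ ℕ) (r : ℕ) :
    contentPoly α (η + Finsupp.single r 1) = contentPoly α η *
      (Polynomial.X + Polynomial.C (α * (η r : K) - (r : K))) := by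
  rw [contentPoly_eq α add_single_support, contentPoly_eq α (Finset.subset_insert r η.support),
    ← Finset.mul_prod_erase _ _ (Finset.mem_insert_self r η.support),
    ← Finset.mul_prod_erase (a := r) (insert r η.support)
      (fun i => ∏ j ∈ Finset.range (η i),
        (Polynomial.X + Polynomial.C (α * (j : K) - (i : K)))) (Finset.mem_insert_self r η.support),
    Finsupp.add_apply, Finsupp.single_eq_same, Finset.prod_range_succ]
  have : ∀ i ∈ (insert r η.support).erase r, ∏ j ∈ Finset.range ((η + Finsupp.single r 1 : ℕ →₀ ℕ) i),
      (Polynomial.X + Polynomial.C (α * (j : K) - (i : K))) = ∏ j ∈ Finset.range (η i),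
      (Polynomial.X + Polynomial.C (α * (j : K) - (i : K))) := by
    intro i hi
    rw [Finsupp.add_apply, Finsupp.single_eq_of_ne (Finset.ne_of_mem_erase hi), add_zero]
  rw [Finset.prod_congr rfl this]
  ring

theorem eig_sub_eig [CharZero K] (α : K) {n : ℕ} {mu : n.Partition} {lam : (n + 1).Partition}
    {r : ℕ} (h : rows lam = rows mu + Finsupp.single r 1) :
    eig α lam - eig α mu = α * (rows mu r : K) - (r : K) := by
  have hr : r < n + 1 := by
    refine lt_of_lt_of_le ((rows_pos_iff lam r).1 ?_) (len_le lam)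
    rw [h, Finsupp.add_apply, Finsupp.single_eq_same]
    exact Nat.succ_ne_zero _
  have hmu : eig α mu = ∑ i ∈ Finset.range (n + 1),
      (α / 2 * ((rows mu i : K) * ((rows mu i : K) - 1)) - (i : K) * (rows mu i : K)) := by
    rw [eig_eq_sum, Finset.sum_range_succ, rows_eq_zero mu (len_le mu)]
    simp
  rw [eig_eq_sum, hmu, ← Finset.sum_sub_distrib, Finset.sum_eq_single r]
  · rw [h, Finsupp.add_apply, Finsupp.single_eq_same]
    push_cast
    ring
  · intro i _ hi
    rw [h, Finsupp.add_apply, Finsupp.single_eq_of_ne hi, add_zero, sub_self]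
  · intro h2
    exact absurd (Finset.mem_range.2 hr) h2

/-- The extra multiple of `∂/∂p_1` in `pderiv_zero_nsOp_three` is absorbed by the degree correction
in `lbOp`, which changes from `n + 1` to `n`. -/
theorem pderiv_zero_lbOp [CharZero K] {α : K} (hα : α ≠ 0) {M : ℕ} (hM : 1 ≤ M) (n : ℕ)
    (f : Fock K) :
    pderiv 0 (lbOp α M (n + 1) f) = lbOp α M n (pderiv 0 f) + lowerOp M f := by
  have h2 : (2 * α)⁻¹ * (2 * α) = 1 := inv_mul_cancel₀ (mul_ne_zero two_ne_zero hα)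
  rw [lbOp_apply, lbOp_apply, pderiv_smul, map_sub, pderiv_smul, pderiv_zero_nsOp_three α hM]
  have h3 : lowerOp M f = (2 * α)⁻¹ • (2 * α) • lowerOp M f := by rw [smul_smul, h2, one_smul]
  conv_rhs => rw [h3, ← smul_add]
  congr 1
  push_cast
  simp only [mul_add, add_smul, mul_one]
  abel

theorem eq_smul_one_of_mem_H_zero {f : Fock K} (hf : f ∈ H K 0) :
    f = MvPolynomial.coeff 0 f • (1 : Fock K) := by
  have h := eq_sum_monomial hf
  rw [Fintype.sum_unique] at h
  have h2 : ex (default : Nat.Partition 0) = 0 := by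
    have h3 := weight_ex (default : Nat.Partition 0)
    have h4 : (default : Nat.Partition 0).parts = 0 :=
      Multiset.eq_zero_of_forall_notMem fun a ha => by
        have h5 := Multiset.le_sum_of_mem ha
        have h6 := (default : Nat.Partition 0).parts_pos ha
        rw [(default : Nat.Partition 0).parts_sum] at h5
        omega
    rw [ex, h4]
    simp
  rw [h2] at h
  exact h

/-- Write `∂P_lam/∂p_1 = ∑ d mu • P_mu`. The commutator with `D` multiplies the terms of `lowerOp
P_lam` by `eig lam - eig mu`, which by the branching rule is the content of the added box. In
`spec_recursion` each term becomes `d mu` times `X + content` times the product for `mu`, that is, a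
multiple of the product for `lam`; the sum of the multiples is read from the coefficient of `p_1 ^
n` in `∂P_lam/∂p_1`. -/
theorem spec_jackP [CharZero K] {α : K} (hα : ∀ q : ℚ, q ≤ 0 → α ≠ (q : K)) {n : ℕ}
    (lam : n.Partition) :
    spec (jackP α lam) = MvPolynomial.coeff (Finsupp.single 0 n) (jackP α lam) •
      contentPoly α (rows lam) := by
  have hα0 := alpha_ne_zero hα
  have hJ := fun n => isJackBasis_jackP hα n
  induction n with
  | zero =>
    have h := eq_smul_one_of_mem_H_zero ((hJ 0).mem lam)
    have h2 : rows lam = 0 := by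
      rw [← Finsupp.degree_eq_zero_iff, degree_rows]
    rw [Finsupp.single_zero, h2]
    conv_lhs => rw [h]
    rw [map_smul, map_one, contentPoly, Finsupp.prod_zero_index]
  | succ n ih =>
    have hmem := (hJ (n + 1)).mem lam
    set d : n.Partition → K := fun mu => form α (pderiv 0 (jackP α lam)) (jackP α mu) /
      form α (jackP α mu) (jackP α mu) with hd
    have hsum : pderiv 0 (jackP α lam) = ∑ mu, d mu • jackP α mu :=
      (hJ n).eq_sum hα0 (pderiv_mem_H hmem)
    have hlow : lowerOp (n + 1) (jackP α lam) =
        ∑ mu, (d mu * (eig α lam - eig α mu)) • jackP α mu := by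
      have h := pderiv_zero_lbOp hα0 (Nat.le_add_left 1 n) n (jackP α lam)
      rw [(hJ (n + 1)).lbOp_eq hα0 le_rfl, pderiv_smul, hsum, map_sum] at h
      have h2 : lowerOp (n + 1) (jackP α lam) = eig α lam • ∑ mu, d mu • jackP α mu -
          ∑ mu, lbOp α (n + 1) n (d mu • jackP α mu) := by
        rw [h, add_sub_cancel_left]
      rw [h2, Finset.smul_sum, ← Finset.sum_sub_distrib]
      refine Finset.sum_congr rfl fun mu _ => ?_
      rw [map_smul, (hJ n).lbOp_eq hα0 (Nat.le_succ n), smul_smul, smul_smul, ← sub_smul]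
      ring_nf
    have hco : ((n + 1 : ℕ) : K) * MvPolynomial.coeff (Finsupp.single 0 (n + 1)) (jackP α lam) =
        ∑ mu, d mu * MvPolynomial.coeff (Finsupp.single 0 n) (jackP α mu) := by
      have h := congrArg (MvPolynomial.coeff (Finsupp.single 0 n)) hsum
      rw [MvPolynomial.coeff_pderiv, MvPolynomial.coeff_sum] at h
      simp only [MvPolynomial.coeff_smul, smul_eq_mul] at h
      rw [← h, ← Finsupp.single_add, Finsupp.single_eq_same]
      push_cast
      ring
    have hrec := spec_recursion le_rfl (Nat.le_add_left 1 n) hmem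
    rw [hsum, hlow, map_sum, map_sum, Finset.mul_sum, ← Finset.sum_add_distrib] at hrec
    have hterm : ∀ mu ∈ Finset.univ, Polynomial.X * spec (d mu • jackP α mu) +
        spec ((d mu * (eig α lam - eig α mu)) • jackP α mu) =
        (d mu * MvPolynomial.coeff (Finsupp.single 0 n) (jackP α mu)) •
          contentPoly α (rows lam) := by
      intro mu _
      by_cases hdm : d mu = 0
      · simp [hdm]
      · have h1 : form α (MvPolynomial.X 0 * jackP α mu) (jackP α lam) ≠ 0 := by
          rw [form_X_zero_mul, form_symm]
          refine mul_ne_zero hα0 fun h => hdm ?_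
          rw [hd]
          simp only
          rw [h, zero_div]
        obtain ⟨r, hr⟩ := rows_of_branching hα mu lam h1
        rw [map_smul, map_smul, ih, hr, contentPoly_add_single, ← eig_sub_eig α hr]
        simp only [Polynomial.smul_eq_C_mul, map_mul]
        ring
    rw [Finset.sum_congr rfl hterm, ← Finset.sum_smul, ← hco, mul_smul] at hrec
    exact smul_right_injective _ (Nat.cast_ne_zero.2 (Nat.succ_ne_zero n)) hrec

end JackLB
end

/-! ### The coefficient of `p_1 ^ n` and the hook product -/

noncomputable section

namespace JackLB

variable {K : Type*} [Field K]

/-! ### Restriction to finitely many variables -/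

/-- The symmetric polynomial in `N` variables given by a polynomial in the power sums. -/
def res (K : Type*) [Field K] (N : ℕ) : Fock K →ₐ[K] MvPolynomial (Fin N) K :=
  MvPolynomial.aeval fun i => MvPolynomial.psum (Fin N) K (i + 1)

theorem killCompl_psum_fin (N : ℕ) {k : ℕ} (hk : k ≠ 0) :
    MvPowerSeries.killCompl (Fin.valEmbedding (n := N)) (psum K k) =
      MvPolynomial.coeToMvPowerSeries.algHom K (MvPolynomial.psum (Fin N) K k) := by
  classical
  ext ξ
  have h1 : MvPolynomial.coeToMvPowerSeries.algHom K (MvPolynomial.psum (Fin N) K k) =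
      ((MvPolynomial.psum (Fin N) K k : MvPolynomial (Fin N) K) : MvPowerSeries (Fin N) K) := by
    simp
  rw [MvPowerSeries.coeff_killCompl, coeff_psum, h1, MvPolynomial.coeff_coe, MvPolynomial.psum,
    MvPolynomial.coeff_sum]
  simp only [MvPolynomial.coeff_X_pow]
  split_ifs with h
  · obtain ⟨i, hi⟩ := h
    have hs : (Finsupp.embDomain Fin.valEmbedding ξ) i = k := by rw [hi, Finsupp.single_eq_same]
    have hiN : i ∈ Set.range (Fin.valEmbedding (n := N)) := by
      by_contra hn
      rw [Finsupp.embDomain_of_notMem_range _ _ _ hn] at hs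
      exact hk hs.symm
    obtain ⟨j, rfl⟩ := hiN
    have hξ : ξ = Finsupp.single j k := by
      apply Finsupp.embDomain_injective Fin.valEmbedding
      rw [hi, Finsupp.embDomain_single]
    rw [Finset.sum_eq_single j]
    · rw [if_pos hξ.symm]
    · intro l _ hl
      rw [if_neg]
      intro h2
      rw [hξ] at h2
      exact hl (Finsupp.single_left_injective hk h2)
    · simp
  · symm
    refine Finset.sum_eq_zero fun j _ => if_neg fun h2 => h ⟨j, ?_⟩
    rw [← h2, Finsupp.embDomain_single]
    rfl

theorem coeff_res {N : ℕ} (ξ : Fin N →₀ ℕ) (f : Fock K) :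
    MvPolynomial.coeff ξ (res K N f) = co (Finsupp.embDomain Fin.valEmbedding ξ) f := by
  have h : (MvPolynomial.coeToMvPowerSeries.algHom K).comp (res K N) =
      (MvPowerSeries.killCompl Fin.valEmbedding).comp (toSym (K := K)) := by
    apply MvPolynomial.algHom_ext
    intro i
    rw [AlgHom.comp_apply, AlgHom.comp_apply, toSym_X, killCompl_psum_fin N (Nat.succ_ne_zero i),
      res, MvPolynomial.aeval_X]
  have h2 := congrArg (MvPowerSeries.coeff ξ) (DFunLike.congr_fun h f)
  rw [AlgHom.comp_apply, AlgHom.comp_apply, MvPowerSeries.coeff_killCompl] at h2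
  rw [co_apply, ← h2]
  simp

theorem eval_one_res (N : ℕ) (f : Fock K) :
    MvPolynomial.aeval (fun _ => (1 : K)) (res K N f) = Polynomial.eval (N : K) (spec f) := by
  have h : (MvPolynomial.aeval (fun _ => (1 : K))).comp (res K N) =
      (Polynomial.aeval (N : K)).comp (spec (K := K)) := by
    apply MvPolynomial.algHom_ext
    intro i
    rw [AlgHom.comp_apply, AlgHom.comp_apply, spec_X, res, MvPolynomial.aeval_X,
      MvPolynomial.psum]
    simp
  have h2 := DFunLike.congr_fun h f
  rwa [AlgHom.comp_apply, AlgHom.comp_apply, Polynomial.coe_aeval_eq_eval] at h2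

theorem res_jackP_of_rows [CharZero K] {α : K} (hα : ∀ q : ℚ, q ≤ 0 → α ≠ (q : K)) {n n' N : ℕ}
    {lam : n.Partition} {lam' : n'.Partition} (hN : len lam ≤ N)
    (h : rows lam' = rows lam + colVec N) :
    res K N (jackP α lam') =
      MvPolynomial.monomial (Finsupp.equivFunOnFinite.symm fun _ => 1) 1 *
        res K N (jackP α lam) := by
  classical
  ext ξ
  have hsupp : ∀ ζ : Fin N →₀ ℕ,
      (Finsupp.embDomain Fin.valEmbedding ζ).support ⊆ Finset.range N := by
    intro ζ i hi
    rw [Finsupp.support_embDomain, Finset.mem_map] at hi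
    obtain ⟨j, -, rfl⟩ := hi
    exact Finset.mem_range.2 j.2
  set o : Fin N →₀ ℕ := Finsupp.equivFunOnFinite.symm fun _ => 1 with ho
  have ho' : ∀ i, o i = 1 := fun i => rfl
  rw [MvPolynomial.coeff_monomial_mul', one_mul, coeff_res, coeff_res]
  split_ifs with hle
  · have hη : Finsupp.embDomain Fin.valEmbedding ξ =
        Finsupp.embDomain Fin.valEmbedding (ξ - o) + colVec N := by
      ext i
      rw [Finsupp.add_apply, colVec_apply]
      by_cases hi : i < N
      · have h1 := Finsupp.embDomain_apply_self (Fin.valEmbedding (n := N)) ξ ⟨i, hi⟩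
        have h2 := Finsupp.embDomain_apply_self (Fin.valEmbedding (n := N)) (ξ - o) ⟨i, hi⟩
        rw [Fin.valEmbedding_apply] at h1 h2
        rw [h1, h2, if_pos hi, Finsupp.tsub_apply, ho']
        have := hle ⟨i, hi⟩
        rw [ho'] at this
        omega
      · have hni : i ∉ Set.range (Fin.valEmbedding (n := N)) := by
          rintro ⟨j, rfl⟩
          exact hi j.2
        rw [if_neg hi, Finsupp.embDomain_of_notMem_range _ _ _ hni,
          Finsupp.embDomain_of_notMem_range _ _ _ hni, zero_add]
    rw [hη, (isJackBasis_jackP hα n).co_add_colVec hα (isJackBasis_jackP hα n') hN h (hsupp _)]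
  · rw [Finsupp.le_def] at hle
    push Not at hle
    obtain ⟨i, hi⟩ := hle
    rw [ho'] at hi
    refine co_rows_eq_zero hα (S := (Finset.range N).erase i) ?_ ?_
    · intro l hl
      refine Finset.mem_erase.2 ⟨?_, hsupp _ hl⟩
      rintro rfl
      rw [Finsupp.mem_support_iff] at hl
      have h1 := Finsupp.embDomain_apply_self (Fin.valEmbedding (n := N)) ξ i
      rw [Fin.valEmbedding_apply] at h1
      rw [h1] at hl
      omega
    · rw [len_eq_of_rows hN h, Finset.card_erase_of_mem (Finset.mem_range.2 i.2),
        Finset.card_range]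
      have := i.2
      omega

theorem eval_contentPoly (α : K) {η : ℕ →₀ ℕ} {N : ℕ} (hη : η.support ⊆ Finset.range N) :
    Polynomial.eval (N : K) (contentPoly α η) = ∏ i ∈ Finset.range N, ∏ j ∈ Finset.range (η i),
      (α * (j : K) + ((N - i : ℕ) : K)) := by
  rw [contentPoly_eq α hη, Polynomial.eval_prod]
  refine Finset.prod_congr rfl fun i hi => ?_
  rw [Polynomial.eval_prod]
  refine Finset.prod_congr rfl fun j _ => ?_
  rw [Nat.cast_sub (Finset.mem_range.1 hi).le]
  simp
  ring

/-- The coefficient of `p_1 ^ n`. -/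
def onesCoeff (n : ℕ) : Fock K →ₗ[K] K := MvPolynomial.lcoeff K (Finsupp.single 0 n)

theorem onesCoeff_apply (n : ℕ) (f : Fock K) :
    onesCoeff n f = MvPolynomial.coeff (Finsupp.single 0 n) f := rfl

/-- Setting `N` variables equal to `1` in `res_jackP_of_rows` equates two principal specializations.
Their content products differ by the last box of each of the `N` rows, which gives the displayed
factor; the common part is nonzero by the assumption on `α`. -/
theorem onesCoeff_jackP_of_rows [CharZero K] {α : K} (hα : ∀ q : ℚ, q ≤ 0 → α ≠ (q : K))
    {n n' N : ℕ} {lam : n.Partition} {lam' : n'.Partition} (hN : len lam ≤ N)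
    (h : rows lam' = rows lam + colVec N) :
    onesCoeff n' (jackP α lam') *
      ∏ i ∈ Finset.range N, (α * (rows lam i : K) + ((N - i : ℕ) : K)) =
    onesCoeff n (jackP α lam) := by
  have hs := support_rows_subset hN
  have h1 := eval_one_res N (jackP α lam')
  rw [res_jackP_of_rows hα hN h, map_mul, eval_one_res, MvPolynomial.aeval_monomial, map_one,
    one_mul] at h1
  simp only [one_pow, Finsupp.prod, Finset.prod_const_one, one_mul] at h1
  rw [spec_jackP hα, spec_jackP hα, Polynomial.eval_smul, Polynomial.eval_smul, smul_eq_mul,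
    smul_eq_mul, h, eval_contentPoly α hs, eval_contentPoly α (support_add_colVec hs)] at h1
  have h2 : ∏ i ∈ Finset.range N, ∏ j ∈ Finset.range ((rows lam + colVec N) i),
      (α * (j : K) + ((N - i : ℕ) : K)) =
      (∏ i ∈ Finset.range N, ∏ j ∈ Finset.range (rows lam i),
        (α * (j : K) + ((N - i : ℕ) : K))) *
      ∏ i ∈ Finset.range N, (α * (rows lam i : K) + ((N - i : ℕ) : K)) := by
    rw [← Finset.prod_mul_distrib]
    refine Finset.prod_congr rfl fun i hi => ?_
    rw [Finsupp.add_apply, colVec_apply, if_pos (Finset.mem_range.1 hi), Finset.prod_range_succ]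
  have h3 : ∏ i ∈ Finset.range N, ∏ j ∈ Finset.range (rows lam i),
      (α * (j : K) + ((N - i : ℕ) : K)) ≠ 0 := by
    refine Finset.prod_ne_zero_iff.2 fun i hi => Finset.prod_ne_zero_iff.2 fun j _ => ?_
    rcases Nat.eq_zero_or_pos j with hj | hj
    · rw [hj, Nat.cast_zero, mul_zero, zero_add]
      refine Nat.cast_ne_zero.2 ?_
      have := Finset.mem_range.1 hi
      omega
    · exact alpha_mul_add_ne_zero hα hj
  rw [h2] at h1
  rw [onesCoeff_apply, onesCoeff_apply]
  refine mul_right_cancel₀ h3 ?_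
  rw [h1]
  ring

/-! ### The hook product -/

theorem mem_diagram {n : ℕ} (lam : n.Partition) (i j : ℕ) :
    (i, j) ∈ diagram lam ↔ j < rows lam i := by
  rw [diagram, YoungDiagram.mem_ofRowLens, rows_apply]
  constructor
  · rintro ⟨h, h2⟩
    rwa [List.getD_eq_getElem _ _ h]
  · intro h
    by_cases hi : i < (sortedParts lam).length
    · rw [List.getD_eq_getElem _ _ hi] at h
      exact ⟨hi, h⟩
    · rw [List.getD_eq_default _ _ (not_lt.1 hi)] at h
      omega

theorem rowLen_diagram {n : ℕ} (lam : n.Partition) (i : ℕ) :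
    (diagram lam).rowLen i = rows lam i :=
  eq_of_forall_lt_iff fun j => by rw [← YoungDiagram.mem_iff_lt_rowLen, mem_diagram]

theorem hook_eq (α : K) {n N : ℕ} {lam : n.Partition} (hN : len lam ≤ N) :
    hook α lam = ∏ i ∈ Finset.range N, ∏ j ∈ Finset.range (rows lam i),
      (α * ((rows lam i - (j + 1) : ℕ) : K) +
        (((diagram lam).colLen j - (i + 1) : ℕ) : K) + 1) := by
  rw [hook, Finset.prod_finset_product (diagram lam).cells (Finset.range N)
    fun i => Finset.range (rows lam i)]
  · simp only [arm, leg, rowLen_diagram]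
  · rintro ⟨i, j⟩
    rw [YoungDiagram.mem_cells, mem_diagram, Finset.mem_range, Finset.mem_range]
    constructor
    · intro h
      exact ⟨((rows_pos_iff lam i).1 (by omega)).trans_le hN, h⟩
    · exact fun h => h.2

/-- A box of the new first column has arm `λ_i` and leg `N - i - 1`. All other boxes are those of
`lam` moved one column to the right, with unchanged arms and legs. -/
theorem hook_of_rows (α : K) {n n' N : ℕ} {lam : n.Partition} {lam' : n'.Partition}
    (hN : len lam ≤ N) (h : rows lam' = rows lam + colVec N) :
    hook α lam' =
      (∏ i ∈ Finset.range N, (α * (rows lam i : K) + ((N - i : ℕ) : K))) * hook α lam := by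
  have hlen := len_eq_of_rows hN h
  have hcol : ∀ j, (diagram lam').colLen (j + 1) = (diagram lam).colLen j := by
    intro j
    refine eq_of_forall_lt_iff fun i => ?_
    rw [← YoungDiagram.mem_iff_lt_colLen, ← YoungDiagram.mem_iff_lt_colLen, mem_diagram,
      mem_diagram, h, Finsupp.add_apply, colVec_apply]
    split_ifs with hi
    · omega
    · rw [rows_eq_zero lam (hN.trans (not_lt.1 hi))]
      omega
  have hcol0 : (diagram lam').colLen 0 = N := by
    refine eq_of_forall_lt_iff fun i => ?_
    rw [← YoungDiagram.mem_iff_lt_colLen, mem_diagram, Nat.pos_iff_ne_zero, rows_pos_iff, hlen]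
  rw [hook_eq α hlen.le, hook_eq α hN, ← Finset.prod_mul_distrib]
  refine Finset.prod_congr rfl fun i hi => ?_
  have hi' := Finset.mem_range.1 hi
  have hrow : rows lam' i = rows lam i + 1 := by
    rw [h, Finsupp.add_apply, colVec_apply, if_pos hi']
  rw [hrow, Finset.prod_range_succ', mul_comm, hcol0]
  congr 1
  · rw [show rows lam i + 1 - (0 + 1) = rows lam i by omega,
      show N - i = N - (i + 1) + 1 by omega]
    push_cast
    ring
  · refine Finset.prod_congr rfl fun j _ => ?_
    rw [hcol, show rows lam i + 1 - (j + 1 + 1) = rows lam i - (j + 1) by omega]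

/-- Removing the first column divides `hook` and multiplies the coefficient of `p_1 ^ n` by the same
product, so the claim descends to the empty partition. In terms of `J`, the coefficient of `p_1 ^ n`
is `1`. -/
theorem onesCoeff_jackP_mul_hook [CharZero K] {α : K} (hα : ∀ q : ℚ, q ≤ 0 → α ≠ (q : K)) {n : ℕ}
    (lam : n.Partition) : hook α lam * onesCoeff n (jackP α lam) = 1 := by
  induction n using Nat.strong_induction_on with
  | _ n ih =>
    by_cases hl : len lam = 0
    · have hn : n = 0 := by
        rw [← degree_rows lam, Finsupp.degree_eq_zero_iff, ← Finsupp.support_eq_empty, support_rows,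
          hl, Finset.range_zero]
      subst hn
      have h := eq_smul_one_of_mem_H_zero ((isJackBasis_jackP hα 0).mem lam)
      have h2 := (isJackBasis_jackP hα 0).diag lam
      have h3 : rows lam = 0 := by rw [← Finsupp.degree_eq_zero_iff, degree_rows]
      rw [h, h3, map_smul, co_apply, map_one, MvPowerSeries.coeff_zero_one, smul_eq_mul,
        mul_one] at h2
      rw [onesCoeff_apply, Finsupp.single_zero, h2, hook_eq α hl.le]
      simp
    · obtain ⟨k, hk, lam', h1, h2⟩ := exists_rows_eq_add_colVec lam
      rw [hook_of_rows α h2 h1, mul_right_comm, mul_comm (Finset.prod _ _),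
        onesCoeff_jackP_of_rows hα h2 h1, mul_comm]
      exact ih k (by omega) lam'

end JackLB
end

/-! ### Several alphabets and the connection coefficients -/

noncomputable section

namespace JackLB

variable {K : Type*} [Field K]

/-! ### Several alphabets -/

/-- The embedding of the `i`-th alphabet. -/
abbrev alphabet {s : ℕ} (i : Fin s) : ℕ ↪ Fin s × ℕ := Function.Embedding.sectR i ℕ

/-- The alphabets are disjoint, so an exponent vector splits among the factors in only one way. -/
theorem coeff_prod_inAlphabet {s : ℕ} (F : Fin s → MvPowerSeries ℕ K) (η : Fin s → ℕ →₀ ℕ) :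
    MvPowerSeries.coeff (∑ i, Finsupp.embDomain (alphabet i) (η i)) (∏ i, inAlphabet i (F i)) =
      ∏ i, MvPowerSeries.coeff (η i) (F i) := by
  classical
  set E : Fin s → (Fin s × ℕ →₀ ℕ) := fun i => Finsupp.embDomain (alphabet i) (η i) with hE
  rw [MvPowerSeries.coeff_prod, Finset.sum_eq_single (Finsupp.equivFunOnFinite.symm E)]
  · refine Finset.prod_congr rfl fun i _ => ?_
    exact MvPowerSeries.coeff_embDomain_rename (alphabet i) (F i) (η i)
  · intro l hl hne
    rw [Finset.mem_finsuppAntidiag] at hl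
    by_contra h
    have hran : ∀ i, ∃ ζ, l i = Finsupp.embDomain (alphabet i) ζ := by
      intro i
      by_contra hi
      refine Finset.prod_ne_zero_iff.1 h i (Finset.mem_univ i) ?_
      have hr : l i ∉ Set.range (Finsupp.mapDomain (alphabet i)) := by
        rintro ⟨ζ, hζ⟩
        exact hi ⟨ζ, by rw [Finsupp.embDomain_eq_mapDomain, ← hζ]⟩
      exact MvPowerSeries.coeff_rename_eq_zero (alphabet i) (F i) hr
    choose ζ hζ using hran
    have hzero : ∀ (ξ : Fin s → ℕ →₀ ℕ) (i : Fin s) (k : ℕ),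
        (∑ j, Finsupp.embDomain (alphabet j) (ξ j)) (i, k) = ξ i k := by
      intro ξ i k
      rw [Finsupp.finsetSum_apply, Finset.sum_eq_single i]
      · exact Finsupp.embDomain_apply_self (alphabet i) (ξ i) k
      · intro j _ hj
        refine Finsupp.embDomain_of_notMem_range _ _ _ ?_
        rintro ⟨m, hm⟩
        exact hj (congrArg Prod.fst hm)
      · simp
    apply hne
    ext i p
    have h1 := hl.1
    change ∑ i, l i = ∑ i, E i at h1
    rw [Finset.sum_congr rfl fun i _ => hζ i] at h1
    have h2 : ζ i = η i := by
      ext k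
      rw [← hzero ζ i k, h1, hE, hzero η i k]
    rw [hζ i, h2]
    rfl
  · intro h
    refine absurd (Finset.mem_finsuppAntidiag.2 ⟨?_, Finset.subset_univ _⟩) h
    rfl

/-- Taking coefficients at monomials in each alphabet gives a tensor power of the transition matrix
from power sums to monomial functions. It is inverted by the tensor power of the inverse matrix,
whose entries are the coefficients of `mono` (`h2`). -/
theorem linearIndependent_prod_inAlphabet [CharZero K] (n s : ℕ) :
    LinearIndependent K fun mu : Fin s → n.Partition =>
      ∏ i, inAlphabet i (psumPart K (mu i)) := by
  classical
  rw [Fintype.linearIndependent_iff]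
  intro c hc nu
  have h1 : ∀ th : Fin s → n.Partition, ∑ mu : Fin s → n.Partition, c mu *
      ∏ i, co (rows (th i)) (MvPolynomial.monomial (ex (mu i)) (1 : K)) = 0 := by
    intro th
    have h := congrArg (MvPowerSeries.coeff
      (∑ i, Finsupp.embDomain (alphabet i) (rows (th i)))) hc
    rw [map_sum, map_zero] at h
    rw [← h]
    refine Finset.sum_congr rfl fun mu _ => ?_
    rw [map_smul, coeff_prod_inAlphabet, smul_eq_mul]
    simp only [co_apply, toSym_monomial_ex]
  have h2 : ∀ a b : n.Partition, ∑ lam : n.Partition,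
      MvPolynomial.coeff (ex a) (mono K lam) *
        co (rows lam) (MvPolynomial.monomial (ex b) (1 : K)) = if b = a then 1 else 0 := by
    intro a b
    have h := congrArg (MvPolynomial.coeff (ex a)) (eq_sum_mono (monomial_mem_H (K := K) b))
    rw [MvPolynomial.coeff_monomial, MvPolynomial.coeff_sum] at h
    simp only [ex_injective.eq_iff, MvPolynomial.coeff_smul, smul_eq_mul] at h
    rw [h]
    exact Finset.sum_congr rfl fun lam _ => mul_comm _ _
  have h3 : ∑ th : Fin s → n.Partition, (∏ i, MvPolynomial.coeff (ex (nu i)) (mono K (th i))) *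
      ∑ mu : Fin s → n.Partition, c mu *
        ∏ i, co (rows (th i)) (MvPolynomial.monomial (ex (mu i)) (1 : K)) = 0 :=
    Finset.sum_eq_zero fun th _ => by rw [h1, mul_zero]
  simp only [Finset.mul_sum] at h3
  rw [Finset.sum_comm] at h3
  have h4 : ∀ mu : Fin s → n.Partition, ∑ th : Fin s → n.Partition,
      (∏ i, MvPolynomial.coeff (ex (nu i)) (mono K (th i))) * (c mu *
        ∏ i, co (rows (th i)) (MvPolynomial.monomial (ex (mu i)) (1 : K))) =
      c mu * ∏ i, (if mu i = nu i then 1 else 0) := by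
    intro mu
    simp only [← h2]
    rw [Finset.prod_univ_sum, Fintype.piFinset_univ, Finset.mul_sum]
    refine Finset.sum_congr rfl fun th _ => ?_
    rw [Finset.prod_mul_distrib]
    ring
  rw [Finset.sum_congr rfl fun mu _ => h4 mu, Finset.sum_eq_single nu] at h3
  · simpa using h3
  · intro mu _ hmu
    obtain ⟨i, hi⟩ := Function.ne_iff.1 hmu
    rw [Finset.prod_eq_zero (Finset.mem_univ i) (if_neg hi), mul_zero]
  · simp

theorem coeffIn_prod_inAlphabet [CharZero K] {n s : ℕ} (a : n.Partition → K)
    {g : n.Partition → Fock K} (hg : ∀ β, g β ∈ H K n) (lam : Fin s → n.Partition) :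
    coeffIn (fun mu : Fin s → n.Partition => ∏ i, inAlphabet i (psumPart K (mu i)))
      (∑ β, a β • ∏ i, inAlphabet i (toSym (g β))) lam =
      ∑ β, a β * ∏ i, MvPolynomial.coeff (ex (lam i)) (g β) := by
  have hsum : ∑ β, a β • ∏ i, inAlphabet i (toSym (g β)) = ∑ mu : Fin s → n.Partition,
      (∑ β, a β * ∏ i, MvPolynomial.coeff (ex (mu i)) (g β)) •
        ∏ i, inAlphabet i (psumPart K (mu i)) := by
    simp only [Finset.sum_smul]
    rw [Finset.sum_comm]
    refine Finset.sum_congr rfl fun β _ => ?_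
    have h1 : ∀ i : Fin s, inAlphabet i (toSym (g β)) = ∑ mu : n.Partition,
        MvPolynomial.coeff (ex mu) (g β) • inAlphabet i (psumPart K mu) := by
      intro i
      rw [toSym_eq_sum (hg β)]
      simp only [inAlphabet, map_sum, map_smul]
    rw [Finset.prod_congr rfl fun i _ => h1 i, Finset.prod_univ_sum, Fintype.piFinset_univ,
      Finset.smul_sum]
    refine Finset.sum_congr rfl fun mu _ => ?_
    rw [mul_smul]
    congr 1
    simp only [Algebra.smul_def, Finset.prod_mul_distrib, map_prod]
  have hv := linearIndependent_prod_inAlphabet (K := K) n s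
  exact coeffIn_eq (c := fun mu => ∑ β, a β * ∏ i, MvPolynomial.coeff (ex (mu i)) (g β))
    hv hsum lam

/-! ### The Laplace-Beltrami operator and the connection coefficients -/

theorem ex_rho {n : ℕ} (hn : 2 ≤ n) :
    ex (rho n hn) = Finsupp.single 0 (n - 2) + Finsupp.single 1 1 := by
  classical
  ext i
  rw [ex, rho, Multiset.toFinsupp_apply]
  simp only [Multiset.map_cons, Multiset.map_replicate, Multiset.count_cons,
    Multiset.count_replicate, Finsupp.add_apply, Finsupp.single_apply]
  simp [eq_comm]

theorem form_X_pow (α : K) (n : ℕ) (f : Fock K) :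
    form α (MvPolynomial.X 0 ^ n) f = α ^ n * (n.factorial : K) * onesCoeff n f := by
  rw [MvPolynomial.X_pow_eq_monomial, form_monomial, monoNorm, Finsupp.prod_single_index (by simp),
    onesCoeff_apply]
  simp

theorem X_pow_mem_H (K : Type*) [Field K] (n : ℕ) :
    (MvPolynomial.X 0 ^ n : Fock K) ∈ H K n := by
  have h := (MvPolynomial.isWeightedHomogeneous_X K wt 0).pow n
  simpa [wt] using h

/-- Compare `⟨p_1^n, D f⟩` with `⟨D p_1^n, f⟩`, where `D p_1^n` is `α n (n - 1) / 2` times `p_ρ`.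
The norms of `p_1^n` and `p_ρ` make the constants cancel exactly. -/
theorem onesCoeff_lbOp [CharZero K] {α : K} (hα : α ≠ 0) {n : ℕ} (hn : 2 ≤ n) (f : Fock K) :
    onesCoeff n (lbOp α n n f) = MvPolynomial.coeff (ex (rho n hn)) f := by
  have h1 : lbOp α n n (MvPolynomial.X 0 ^ n : Fock K) =
      ((2 * α)⁻¹ * (α ^ 2 * ((n * (n - 1) : ℕ) : K))) •
        MvPolynomial.monomial (ex (rho n hn)) (1 : K) := by
    rw [lbOp_apply, nsOp_three_X_pow α hn, add_sub_cancel_left, smul_smul, ex_rho,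
      MvPolynomial.X_pow_eq_monomial, MvPolynomial.X, MvPolynomial.monomial_mul, mul_one,
      add_comm (Finsupp.single 1 1)]
  have h2 := lbOp_selfAdjoint α n n (MvPolynomial.X 0 ^ n) f
  rw [h1, form_X_pow, map_smul, LinearMap.smul_apply, form_monomial, ex_rho, monoNorm_add_single,
    monoNorm, Finsupp.prod_single_index (by simp), ← ex_rho hn, smul_eq_mul] at h2
  obtain ⟨m, rfl⟩ : ∃ m, n = m + 2 := ⟨n - 2, by omega⟩
  have hf : ((m + 2).factorial : K) = ((m : K) + 2) * (((m : K) + 1) * (m.factorial : K)) := by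
    rw [Nat.factorial_succ, Nat.factorial_succ]
    push_cast
    ring
  have hne : α ^ (m + 2) * ((m + 2).factorial : K) ≠ 0 :=
    mul_ne_zero (pow_ne_zero _ hα) (Nat.cast_ne_zero.2 (Nat.factorial_ne_zero _))
  refine mul_left_cancel₀ hne (h2.symm.trans ?_)
  rw [hf, Nat.add_sub_cancel, show m + 2 - 1 = m + 1 by omega, Finsupp.single_eq_of_ne one_ne_zero]
  push_cast
  field_simp
  ring

theorem laplaceBeltrami_iterate_toSym [CharZero K] {α : K} (hα : α ≠ 0) {n : ℕ} {f : Fock K}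
    (hf : f ∈ H K n) (r : ℕ) :
    (lbOp α n n)^[r] f ∈ H K n ∧
      (laplaceBeltrami α)^[r] (toSym f) = toSym ((lbOp α n n)^[r] f) := by
  induction r with
  | zero => exact ⟨hf, rfl⟩
  | succ r ih =>
    rw [Function.iterate_succ_apply', Function.iterate_succ_apply', ih.2]
    exact ⟨lbOp_mem α n ih.1, (toSym_lbOp hα le_rfl ih.1).symm⟩

theorem lbOp_iterate_X_pow [CharZero K] {α : K} (hα : ∀ q : ℚ, q ≤ 0 → α ≠ (q : K)) (n r : ℕ) :
    (lbOp α n n)^[r] (MvPolynomial.X 0 ^ n) = ∑ β : n.Partition,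
      (α ^ n * (n.factorial : K) * (onesCoeff n (jackP α β) /
        form α (jackP α β) (jackP α β)) * eig α β ^ r) • jackP α β := by
  have hα0 := alpha_ne_zero hα
  have hJ := isJackBasis_jackP hα n
  induction r with
  | zero =>
    rw [Function.iterate_zero, id, hJ.eq_sum hα0 (X_pow_mem_H K n)]
    refine Finset.sum_congr rfl fun β _ => ?_
    rw [form_X_pow, pow_zero, mul_one, mul_div_assoc]
  | succ r ih =>
    rw [Function.iterate_succ_apply', ih, map_sum]
    refine Finset.sum_congr rfl fun β _ => ?_
    rw [map_smul, hJ.lbOp_eq hα0 le_rfl, smul_smul, pow_succ, mul_assoc]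

/-- Each of the `r` factors at `ρ` equals `[p_1^n] D J_β = eig β`, as `[p_1^n] J_β = 1`. The
remaining `hook` from `J_β(x^1)` and the `hook ^ 2` in the norm leave `1 / hook`, which is `[p_1^n]
P_β`. -/
theorem aCoeff_eq [CharZero K] {α : K} (hα : ∀ q : ℚ, q ≤ 0 → α ≠ (q : K)) {n : ℕ} (r : ℕ)
    (hn : r = 0 ∨ 2 ≤ n) (lam : n.Partition) :
    aCoeff α r hn lam = ∑ β : n.Partition, onesCoeff n (jackP α β) /
      form α (jackP α β) (jackP α β) * eig α β ^ r * MvPolynomial.coeff (ex lam) (jackP α β) := by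
  have hα0 := alpha_ne_zero hα
  have hJ := isJackBasis_jackP hα n
  have hmem : ∀ β : n.Partition, hook α β • jackP α β ∈ H K n := fun β =>
    Submodule.smul_mem _ _ (hJ.mem β)
  have hjack : ∀ β : n.Partition, jack α β = toSym (hook α β • jackP α β) := fun β => by
    rw [jack_eq hα, map_smul]
  simp only [aCoeff, connCoeff, hjack, scal_toSym α (hmem _) (hmem _)]
  rw [coeffIn_prod_inAlphabet _ hmem]
  refine Finset.sum_congr rfl fun β _ => ?_
  have h1 := onesCoeff_jackP_mul_hook hα β
  have hh := hook_ne_zero hα β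
  have hones : onesCoeff n (jackP α β) = (hook α β)⁻¹ := eq_inv_of_mul_eq_one_right h1
  rw [Fin.prod_univ_succ, Fin.cons_zero]
  have h2 : ∏ i : Fin r, MvPolynomial.coeff
      (ex ((Fin.cons lam (fun i : Fin r => rho n (hn.resolve_left (Nat.ne_zero_of_lt i.isLt))) :
        Fin (r + 1) → n.Partition) i.succ)) (hook α β • jackP α β) = eig α β ^ r := by
    have h3 : ∀ i : Fin r, MvPolynomial.coeff
        (ex ((Fin.cons lam (fun i : Fin r => rho n (hn.resolve_left (Nat.ne_zero_of_lt i.isLt))) :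
          Fin (r + 1) → n.Partition) i.succ)) (hook α β • jackP α β) = eig α β := by
      intro i
      rw [Fin.cons_succ, ← onesCoeff_lbOp hα0, map_smul, hJ.lbOp_eq hα0 le_rfl, smul_comm, map_smul,
        map_smul, smul_eq_mul, smul_eq_mul, h1, mul_one]
    rw [Finset.prod_congr rfl fun i _ => h3 i, Finset.prod_const, Finset.card_univ, Fintype.card_fin]
  have h4 := hJ.form_self_ne_zero hα0 β
  rw [h2, hones, map_smul, map_smul, LinearMap.smul_apply, MvPolynomial.coeff_smul]
  simp only [smul_eq_mul]
  field_simp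

end JackLB

end


theorem mainTheorem6 {K : Type*} [Field K] [CharZero K] (α : K)
    (hα : ∀ q : ℚ, q ≤ 0 → α ≠ (q : K)) (n r : ℕ) (hn : r = 0 ∨ 2 ≤ n) (lam : n.Partition) :
    (JackLB.laplaceBeltrami α)^[r] (JackLB.psum K 1 ^ n) ∈
        Submodule.span K (Set.range fun mu : n.Partition => JackLB.psumPart K mu) ∧
      JackLB.aCoeff α r hn lam =
        1 / (α ^ n * (n.factorial : K)) *
          JackLB.pCoeff lam ((JackLB.laplaceBeltrami α)^[r] (JackLB.psum K 1 ^ n)) := by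
  have hα0 := JackLB.alpha_ne_zero hα
  have hX : JackLB.psum K 1 ^ n = JackLB.toSym (MvPolynomial.X 0 ^ n) := by
    rw [map_pow, JackLB.toSym_X]
  obtain ⟨hmem, hiter⟩ := JackLB.laplaceBeltrami_iterate_toSym hα0 (JackLB.X_pow_mem_H K n) r
  rw [hX, hiter]
  constructor
  · rw [JackLB.toSym_eq_sum hmem]
    exact Submodule.sum_mem _ fun mu _ => Submodule.smul_mem _ _ (Submodule.subset_span ⟨mu, rfl⟩)
  · have hne : α ^ n * (n.factorial : K) ≠ 0 :=
      mul_ne_zero (pow_ne_zero _ hα0) (Nat.cast_ne_zero.2 (Nat.factorial_ne_zero _))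
    rw [JackLB.pCoeff_toSym lam hmem, JackLB.lbOp_iterate_X_pow hα, JackLB.aCoeff_eq hα,
      MvPolynomial.coeff_sum, Finset.mul_sum]
    refine Finset.sum_congr rfl fun β _ => ?_
    rw [MvPolynomial.coeff_smul, smul_eq_mul, mul_assoc (α ^ n * (n.factorial : K)), ← mul_assoc,
      ← mul_assoc, one_div, inv_mul_cancel₀ hne, one_mul]
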